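/- Fix $d\ge 1$ and let $\mathcal X=\{x\in\mathbb R^d:\|x\|_2\le 1,\ x\ge 0\}$. For $X=[x_1,\dots,x_n]^{\mathrm T}$ with rows in $\mathcal X$ write $Y\sim\mathrm{RDPG}(X)$ if $Y=(y_{ij})$ is a symmetric binary $n\times n$ matrix whose entries $y_{ij}$, $i\le j$, are independent with $y_{ij}\sim\mathrm{Bernoulli}(x_i^{\mathrm T}x_j)$, and let $p(Y\mid X)=\prod_{i\le j}(x_i^{\mathrm T}x_j)^{y_{ij}}(1-x_i^{\mathrm T}x_j)^{1-y_{ij}}$. The prior $\Pi$ makes the rows of $X$ independent with a probability density $\pi_x$ supported on $\mathcal X$ and bounded away from $0$ and $\infty$ on $\mathcal X$. The posterior is $\Pi(A\mid Y)=\int_A p(Y\mid X)\,\Pi(dX)\big/\int p(Y\mid X)\,\Pi(dX)$. Let $\Delta\in\mathbb R^{d\times d}$ be positive definite with smallest eigenvalue $\lambda_d(\Delta)$, and let $\delta\in(0,1/2)$. For every $n$ let $X_0=X_0^{(n)}=[x_{01},\dots,x_{0n}]^{\mathrm T}$ have rows in $\mathcal X$ with $\delta\le x_{0i}^{\mathrm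 T}x_{0j}\le 1-\delta$ for all $i,j$ and $n^{-1}X_0^{\mathrm T}X_0\to\Delta$; call such a sequence regular. Let $\mathbb P_0,\mathbb E_0$ refer to $Y\sim\mathrm{RDPG}(X_0)$, and let $\|\cdot\|_{\mathrm F}$ be the Frobenius norm. Let $\tilde P=\int XX^{\mathrm T}\,\Pi(dX\mid Y)$, with spectral decomposition $\tilde P=\sum_{j=1}^n\hat\lambda_j\hat u_j\hat u_j^{\mathrm T}$ (orthonormal $\hat u_j$, $\hat\lambda_1\ge\dots\ge\hat\lambda_n$), and for $n\ge d$ put $\hat U=[\hat u_1,\dots,\hat u_d]$, $\hat S=\mathrm{diag}(\hat\lambda_1,\dots,\hat\lambda_d)$, $\hat X=\hat U\hat S^{1/2}$. Let $U_0$ be a left-singular vector matrix ($n\times d$, orthonormal columns) of $X_0$. Infima over $W$ range over the orthogonal $d\times d$ matrices. **Theorem.** Say that $M_1>0$ is a contraction constant for a regular sequence $X_0$ if $$\mathbb E_0\Big\{\Pi\Big(\tfrac1n\|XX^{\mathrm T}-X_0X_0^{\mathrm T}\|_{\mathrm F}>\tfrac{M_1}{\sqrt n}\,\Big|\,Y\Big)\Big\}\le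 8e^{-nd/2}\qquad\text{for all sufficiently large } n .$$ 1. There is an $M_1>0$, depending only on $d,\pi_x,\Delta,\delta$, that is a contraction constant for every regular sequence. 2. For every $M_1>0$ there is a constant $C>0$ (not depending on $n$ or on the sequence $X_0$) such that, for every regular sequence $X_0$ for which $M_1$ is a contraction constant and for all sufficiently large $n$, whatever spectral decompositions are chosen, $$\mathbb E_0\Big\{\tfrac1n\inf_W\|\hat X-X_0W\|_{\mathrm F}^2\Big\}\le\frac Cn,\qquad \mathbb P_0\Big(\inf_W\|\hat U-U_0W\|_{\mathrm F}^2>\frac{128M_1^2d}{\lambda_d(\Delta)^2n}\Big)\le 2\exp\Big(-\tfrac14M_1d\sqrt n\Big).$$ 3. The rate $1/n$ is the minimax lower bound: there is $c>0$ such that for all $n\ge1$ $$\inf_{\hat X}\ \sup_{X\in\mathcal X^n}\mathbb E_X\Big\{\tfrac1n\inf_W\|\hat X-XW\|_{\mathrm F}^2\Big\}\ge\frac cn ,$$ where the first infimum is over all estimators $\hat X=\hat X(Y)\in\mathbb R^{n\times d}$; more precisely, for every estimator $\hat X$ some $X\in\mathcal X^n$ has risk at least $c/n$. -/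

import Mathlib

open MeasureTheory ProbabilityTheory Filter Topology
open scoped Matrix Matrix.Norms.Frobenius

noncomputable section

namespace RDPG

/-- The space `{x ∈ ℝ^d : ‖x‖₂ ≤ 1, x ≥ 0}` of latent positions. -/
def latentSpace (d : ℕ) : Set (EuclideanSpace ℝ (Fin d)) :=
  {x | ‖x‖ ≤ 1 ∧ ∀ k, 0 ≤ x k}

/-- The `n × d` matrix whose rows are the latent positions `x 0, …, x (n-1)`. -/
def latentMatrix {n d : ℕ} (x : Fin n → EuclideanSpace ℝ (Fin d)) : Matrix (Fin n) (Fin d) ℝ :=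
  Matrix.of fun i k => x i k

/-- Unordered pairs `{i, j}` of vertices (self-pairs included), listed as `(i, j)` with `i ≤ j`. -/
abbrev VertexPair (n : ℕ) : Type := {e : Fin n × Fin n // e.1 ≤ e.2}

/-- A symmetric binary `n × n` matrix, given by its entries `y_{ij}` with `i ≤ j`
(`true` stands for `1` and `false` for `0`). -/
abbrev Adjacency (n : ℕ) : Type := VertexPair n → Bool

/-- The edge probability `x_iᵀ x_j`. -/
def edgeProb {n d : ℕ} (x : Fin n → EuclideanSpace ℝ (Fin d)) (e : VertexPair n) : ℝ :=
  inner ℝ (x e.1.1) (x e.1.2)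

/-- The law of the random dot product graph with latent positions `x`: the entries `y_{ij}`,
`i ≤ j`, are independent and `y_{ij} ∼ Bernoulli(x_iᵀ x_j)`. The projection onto `[0, 1]` is the
identity when the latent positions lie in `latentSpace d`. -/
def rdpg {n d : ℕ} (x : Fin n → EuclideanSpace ℝ (Fin d)) : Measure (Adjacency n) :=
  Measure.pi fun e : VertexPair n =>
    bernoulliMeasure true false (Set.projIcc (0 : ℝ) 1 zero_le_one (edgeProb x e))

/-- The likelihood `p(Y ∣ X) = ∏_{i ≤ j} (x_iᵀ x_j)^{y_ij} (1 - x_iᵀ x_j)^{1 - y_ij}`. -/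
def likelihood {n d : ℕ} (Y : Adjacency n) (x : Fin n → EuclideanSpace ℝ (Fin d)) : ℝ :=
  ∏ e : VertexPair n, if Y e then edgeProb x e else 1 - edgeProb x e

/-- `dens` is a probability density on `ℝ^d` that is supported on the space of latent positions
and bounded away from `0` and `∞` there. -/
structure IsPriorDensity {d : ℕ} (dens : EuclideanSpace ℝ (Fin d) → ℝ) : Prop where
  measurable : Measurable dens
  eq_zero : ∀ x, x ∉ latentSpace d → dens x = 0
  bounded : ∃ a b : ℝ, 0 < a ∧ ∀ x ∈ latentSpace d, a ≤ dens x ∧ dens x ≤ b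
  lintegral_eq_one : ∫⁻ x, ENNReal.ofReal (dens x) = 1

/-- The prior `Π`: the rows of `X` are independent with density `dens`. -/
def prior {d : ℕ} (dens : EuclideanSpace ℝ (Fin d) → ℝ) (n : ℕ) :
    Measure (Fin n → EuclideanSpace ℝ (Fin d)) :=
  Measure.pi fun _ : Fin n => volume.withDensity fun x => ENNReal.ofReal (dens x)

/-- The unnormalized posterior `A ↦ ∫_A p(Y ∣ X) Π(dX)`. -/
def unnormalizedPosterior {n d : ℕ} (dens : EuclideanSpace ℝ (Fin d) → ℝ) (Y : Adjacency n) :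
    Measure (Fin n → EuclideanSpace ℝ (Fin d)) :=
  (prior dens n).withDensity fun x => ENNReal.ofReal (likelihood Y x)

/-- The posterior distribution `Π(X ∈ · ∣ Y)` given by the Bayes formula. (Dividing the likelihood
by the number `p(Y ∣ X₀)`, in the numerator and in the denominator, does not change it.) -/
def posterior {n d : ℕ} (dens : EuclideanSpace ℝ (Fin d) → ℝ) (Y : Adjacency n) :
    Measure (Fin n → EuclideanSpace ℝ (Fin d)) :=
  (unnormalizedPosterior dens Y Set.univ)⁻¹ • unnormalizedPosterior dens Y

/-- The posterior mean `∫ X Xᵀ Π(dX ∣ Y)` of the edge probability matrix. -/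
def posteriorMean {n d : ℕ} (dens : EuclideanSpace ℝ (Fin d) → ℝ) (Y : Adjacency n) :
    Matrix (Fin n) (Fin n) ℝ :=
  Matrix.of fun i j => ∫ x, (latentMatrix x * (latentMatrix x)ᵀ) i j ∂(posterior dens Y)

/-- `inf_W ‖A - B W‖_F²` over the orthogonal `d × d` matrices `W`. -/
def procrustesSq {n d : ℕ} (A B : Matrix (Fin n) (Fin d) ℝ) : ℝ :=
  ⨅ W : Matrix.orthogonalGroup (Fin d) ℝ, ‖A - B * (W : Matrix (Fin d) (Fin d) ℝ)‖ ^ 2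

/-- `P` has a spectral decomposition `P = ∑_j lam_j v_j v_jᵀ` with orthonormal eigenvectors `v_j`
and eigenvalues `lam_j` in non-increasing order, such that `U = [v_1, …, v_d]` and
`s = (lam_1, …, lam_d)`. -/
def IsLeadingEigenpairs {n d : ℕ} (P : Matrix (Fin n) (Fin n) ℝ) (U : Matrix (Fin n) (Fin d) ℝ)
    (s : Fin d → ℝ) : Prop :=
  ∃ (hdn : d ≤ n) (lam : Fin n → ℝ) (V : Matrix (Fin n) (Fin n) ℝ),
    Antitone lam ∧ V ∈ Matrix.orthogonalGroup (Fin n) ℝ ∧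
      P = V * Matrix.diagonal lam * Vᵀ ∧
      U = V.submatrix id (Fin.castLE hdn) ∧ s = fun k => lam (Fin.castLE hdn k)

/-- `U` is the left-singular vector matrix of some singular value decomposition
`X = U diag(s) Vᵀ`, where `U` has orthonormal columns and `V` is orthogonal. -/
def IsLeftSingularMatrix {n d : ℕ} (X U : Matrix (Fin n) (Fin d) ℝ) : Prop :=
  ∃ (s : Fin d → ℝ) (V : Matrix (Fin d) (Fin d) ℝ),
    Uᵀ * U = 1 ∧ V ∈ Matrix.orthogonalGroup (Fin d) ℝ ∧ Antitone s ∧ (∀ k, 0 ≤ s k) ∧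
      X = U * Matrix.diagonal s * Vᵀ

/-- The `(k+1)`-th largest eigenvalue of a symmetric `d × d` matrix, `k = 0, …, d - 1`. -/
def kthEigenvalue {d : ℕ} {A : Matrix (Fin d) (Fin d) ℝ} (hA : A.IsHermitian) (k : Fin d) : ℝ :=
  hA.eigenvalues₀ (Fin.cast (Fintype.card_fin d).symm k)

/-- The standing conditions on the true latent positions `X₀ n`, one configuration for every
number `n` of vertices. -/
structure IsRegular {d : ℕ} (Δ : Matrix (Fin d) (Fin d) ℝ) (δ : ℝ)
    (X₀ : (n : ℕ) → Fin n → EuclideanSpace ℝ (Fin d)) : Prop where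
  mem_latentSpace : ∀ n i, X₀ n i ∈ latentSpace d
  le_inner : ∀ n i j, δ ≤ inner ℝ (X₀ n i) (X₀ n j)
  inner_le : ∀ n i j, inner ℝ (X₀ n i) (X₀ n j) ≤ 1 - δ
  tendsto : Tendsto (fun n : ℕ => (1 / (n : ℝ)) • ((latentMatrix (X₀ n))ᵀ * latentMatrix (X₀ n)))
    atTop (𝓝 Δ)

/-- The posterior contracts at `X₀` with constant `M₁`:
`E₀ Π((1/n) ‖X Xᵀ - X₀ X₀ᵀ‖_F > M₁ / √n ∣ Y) ≤ 8 exp(-n d / 2)` for all large `n`. -/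
def PosteriorContracts {d : ℕ} (dens : EuclideanSpace ℝ (Fin d) → ℝ)
    (X₀ : (n : ℕ) → Fin n → EuclideanSpace ℝ (Fin d)) (M₁ : ℝ) : Prop :=
  ∀ᶠ n : ℕ in atTop,
    ∫ Y, (posterior dens Y).real
        {x | M₁ / √(n : ℝ) < 1 / (n : ℝ) *
          ‖latentMatrix x * (latentMatrix x)ᵀ - latentMatrix (X₀ n) * (latentMatrix (X₀ n))ᵀ‖}
      ∂(rdpg (X₀ n)) ≤ 8 * Real.exp (-(1 / 2) * n * d)

end RDPG

end

/-!
The three parts rest on one deterministic fact about Gram matrices and on elementary estimates for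
the noise matrix `E = Y - X₀ X₀ᵀ`.

*Procrustes.* If `X₀ᵀ X₀ ≥ σ I`, then some orthogonal `W` satisfies
`4/5 σ ‖X - X₀ W‖² ≤ ‖X Xᵀ - X₀ X₀ᵀ‖²` (`exists_orthogonal_frobenius_sub_le`). For a regular sequence
`σ` may be taken to be `n λ_d(Δ) / 2` once `n` is large (`IsRegular.eventually_lower`).

*Contraction.* A single event serves as a test: the operator norm of `E` is at most `K √n`. Under the
truth it fails with probability exponentially small in `n` (`sum_likelihood_not_smallNoise_le`). On
this event `X Xᵀ - X₀ X₀ᵀ` is nearly uncorrelated with `E`, because it is a matrix of rank at most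
`2 d`. Hence under any `X` at distance `D ≥ M √n` the event has probability at most `exp (-D² / 16)`
(`sum_likelihood_smallNoise_le`). This number still has to be integrated over the prior and compared
with the prior mass of a neighbourhood of `X₀` of radius of order `n ^ (-1 / 2)` in every row. That
mass is of order `n ^ (-n d / 2)`, and a logarithm is lost if the integral is just bounded by the
value at `D = M √n`. The remedy is to keep half of the exponent: by the Procrustes bound it dominates
`c n ‖Q X‖²`, where `Q` is the projection of rank `n - d` that annihilates `X₀`, and the Gaussian
integral of this form under the prior is of the same order `n ^ (-n d / 2)`
(`exists_integral_prior_le`, `exists_prior_ball_ge`). The powers of `n` cancel and only factors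
exponential in `n` remain, which a large `M` beats. The evidence in the denominator of the posterior
is handled in the mean by a `χ²`-bound and the Cauchy–Schwarz inequality (`integral_posterior_le`,
`sum_likelihood_sq_div_evidence_le`).

*Embedding.* By Jensen's inequality the posterior mean `P` satisfies `‖P - X₀ X₀ᵀ‖² ≤ M₁² n + n² q`,
where `q` is the posterior mass outside the contraction ball
(`frobenius_posteriorMean_sub_sq_le_add`). The Eckart–Young theorem and the Procrustes bound turn
this into a bound for `Û Ŝ^(1/2)`, and a sine-theta argument into one for `Û`
(`procrustesSq_embedding_le`). The contraction bound makes `q` exponentially small in the mean, and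
Markov's inequality gives the large deviation bound.

*Lower bound.* Row norms are invariant under orthogonal transformations, so it suffices that they
cannot be estimated well. Assouad's argument applies to the `2 ^ n` configurations with rows
`1 / 2` or `1 / 2 + 1 / (4 √n)` times the first basis vector: a change of one row moves at most `n`
edge probabilities, each by a multiple of `1 / √n`, and so is not detectable (`exists_le_risk`).
-/

noncomputable section

namespace RDPG

/-! ### Frobenius norms and the Procrustes bound -/

lemma frobenius_sq_eq_sum {m n : Type*} [Fintype m] [Fintype n] (A : Matrix m n ℝ) :
    ‖A‖ ^ 2 = ∑ i, ∑ j, A i j ^ 2 := by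
  rw [Matrix.frobenius_norm_def, ← Real.sqrt_eq_rpow, Real.sq_sqrt (by positivity)]
  simp

lemma frobenius_sq_eq_trace {m n : Type*} [Fintype m] [Fintype n] (A : Matrix m n ℝ) :
    ‖A‖ ^ 2 = (Aᵀ * A).trace := by
  rw [frobenius_sq_eq_sum, Finset.sum_comm]
  simp [Matrix.trace, Matrix.mul_apply, sq]

lemma frobenius_sq_eq_trace' {m n : Type*} [Fintype m] [Fintype n] (A : Matrix m n ℝ) :
    ‖A‖ ^ 2 = (A * Aᵀ).trace := by
  rw [frobenius_sq_eq_trace, Matrix.trace_mul_comm]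

/-- Spectral theorem for real symmetric matrices, in terms of an orthogonal matrix. -/
lemma exists_orthogonal_diagonalization {m : Type*} [Fintype m] [DecidableEq m]
    {S : Matrix m m ℝ} (hS : Sᵀ = S) :
    ∃ V ∈ Matrix.orthogonalGroup m ℝ, ∃ e : m → ℝ, S = V * Matrix.diagonal e * Vᵀ := by
  have hH : S.IsHermitian := by simpa [Matrix.IsHermitian] using hS
  refine ⟨hH.eigenvectorUnitary, hH.eigenvectorUnitary.2, hH.eigenvalues, ?_⟩
  have := hH.spectral_theorem
  rw [Unitary.conjStarAlgAut_apply] at this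
  simpa [Function.comp_def, Matrix.star_eq_conjTranspose] using this

lemma nonneg_of_posSemidef_conj_diagonal {m : Type*} [Fintype m] [DecidableEq m]
    {V : Matrix m m ℝ} (hV : V ∈ Matrix.orthogonalGroup m ℝ) {e : m → ℝ}
    (h : (V * Matrix.diagonal e * Vᵀ).PosSemidef) (i : m) : 0 ≤ e i := by
  have hVV : Vᵀ * V = 1 := (Matrix.mem_orthogonalGroup_iff' _ _).1 hV
  have h1 : (Vᵀ * (V * Matrix.diagonal e * Vᵀ) * V).PosSemidef := by
    simpa using h.conjTranspose_mul_mul_same V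
  have h2 : Vᵀ * (V * Matrix.diagonal e * Vᵀ) * V = Matrix.diagonal e := by
    calc _ = (Vᵀ * V) * Matrix.diagonal e * (Vᵀ * V) := by simp only [Matrix.mul_assoc]
      _ = _ := by rw [hVV]; simp
  rw [h2] at h1
  exact Matrix.posSemidef_diagonal_iff.1 h1 i

/-- Singular value decomposition of a square matrix. -/
lemma exists_svd {d : ℕ} (M : Matrix (Fin d) (Fin d) ℝ) :
    ∃ U ∈ Matrix.orthogonalGroup (Fin d) ℝ, ∃ V ∈ Matrix.orthogonalGroup (Fin d) ℝ,
      ∃ s : Fin d → ℝ, (∀ i, 0 ≤ s i) ∧ M = U * Matrix.diagonal s * Vᵀ := by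
  obtain ⟨V, hVm, e, hspec⟩ := exists_orthogonal_diagonalization (S := Mᵀ * M) (by simp)
  have he0 : ∀ i, 0 ≤ e i := nonneg_of_posSemidef_conj_diagonal hVm <| by
    rw [← hspec]; simpa using Matrix.posSemidef_conjTranspose_mul_self M
  have hVV : Vᵀ * V = 1 := (Matrix.mem_orthogonalGroup_iff' _ _).1 hVm
  have hVV' : V * Vᵀ = 1 := (Matrix.mem_orthogonalGroup_iff _ _).1 hVm
  have hdiag : (M * V)ᵀ * (M * V) = Matrix.diagonal e := by
    rw [Matrix.transpose_mul]
    calc Vᵀ * Mᵀ * (M * V) = Vᵀ * (Mᵀ * M) * V := by simp only [Matrix.mul_assoc]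
      _ = (Vᵀ * V) * Matrix.diagonal e * (Vᵀ * V) := by rw [hspec]; simp only [Matrix.mul_assoc]
      _ = _ := by rw [hVV]; simp
  have hent : ∀ i j, ∑ k, (M * V) k i * (M * V) k j = Matrix.diagonal e i j := by
    intro i j
    rw [← hdiag, Matrix.mul_apply]; rfl
  let v : Fin d → EuclideanSpace ℝ (Fin d) := fun i =>
    WithLp.toLp 2 fun k => (√(e i))⁻¹ * (M * V) k i
  have hvin : ∀ i j, inner ℝ (v i) (v j) = (√(e i))⁻¹ * (√(e j))⁻¹ * Matrix.diagonal e i j := by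
    intro i j
    rw [← hent, Finset.mul_sum]
    simp only [v, PiLp.inner_apply]
    refine Finset.sum_congr rfl fun k _ => ?_
    simp
    ring
  have horth : Orthonormal ℝ (Set.domRestrict {i | e i ≠ 0} v) := by
    rw [orthonormal_iff_ite]
    rintro ⟨i, hi⟩ ⟨j, hj⟩
    simp only [Set.domRestrict_apply, hvin, Subtype.mk.injEq]
    split_ifs with h
    · subst h
      have : √(e i) ≠ 0 := by
        rw [Real.sqrt_ne_zero (he0 i)]; exact hi
      rw [Matrix.diagonal_apply_eq]
      field_simp
      exact (Real.sq_sqrt (he0 i)).symm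
    · rw [Matrix.diagonal_apply_ne _ h, mul_zero]
  obtain ⟨b, hb⟩ := horth.exists_orthonormalBasis_extension_of_card_eq (by simp)
  let U : Matrix (Fin d) (Fin d) ℝ := Matrix.of fun k i => b i k
  have hUU : Uᵀ * U = 1 := by
    ext i j
    have := orthonormal_iff_ite.1 b.orthonormal i j
    rw [PiLp.inner_apply] at this
    simp only [Matrix.mul_apply, Matrix.transpose_apply, U, Matrix.of_apply, Matrix.one_apply]
    rw [← this]
    refine Finset.sum_congr rfl fun k _ => ?_
    simp [mul_comm]
  refine ⟨U, (Matrix.mem_orthogonalGroup_iff' _ _).2 hUU, V, hVm, fun i => √(e i),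
    fun i => Real.sqrt_nonneg _, ?_⟩
  have hMV : M * V = U * Matrix.diagonal fun i => √(e i) := by
    ext k i
    rw [Matrix.mul_diagonal]
    by_cases hi : e i = 0
    · have h0 := hent i i
      rw [Matrix.diagonal_apply_eq, hi] at h0
      have := (Finset.sum_eq_zero_iff_of_nonneg (fun k _ => mul_self_nonneg _)).1 h0 k
        (Finset.mem_univ k)
      rw [hi, Real.sqrt_zero, mul_zero]
      exact mul_self_eq_zero.1 this
    · have : √(e i) ≠ 0 := by
        rw [Real.sqrt_ne_zero (he0 i)]; exact hi
      simp only [U, Matrix.of_apply, hb i hi, v]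
      field_simp
  rw [← hMV, Matrix.mul_assoc, hVV', Matrix.mul_one]

/-- Polar decomposition, with the positive semidefinite factor expressed through `M`. -/
lemma exists_orthogonal_transpose_mul_posSemidef {d : ℕ} (M : Matrix (Fin d) (Fin d) ℝ) :
    ∃ W ∈ Matrix.orthogonalGroup (Fin d) ℝ, (Wᵀ * M).PosSemidef := by
  obtain ⟨U, hU, V, hV, s, hs, rfl⟩ := exists_svd M
  have hUU : Uᵀ * U = 1 := (Matrix.mem_orthogonalGroup_iff' _ _).1 hU
  have hVV : Vᵀ * V = 1 := (Matrix.mem_orthogonalGroup_iff' _ _).1 hV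
  refine ⟨U * Vᵀ, (Matrix.mem_orthogonalGroup_iff' _ _).2 ?_, ?_⟩
  · have hVV' : V * Vᵀ = 1 := (Matrix.mem_orthogonalGroup_iff _ _).1 hV
    rw [Matrix.transpose_mul, Matrix.transpose_transpose]
    calc V * Uᵀ * (U * Vᵀ) = V * (Uᵀ * U) * Vᵀ := by simp only [Matrix.mul_assoc]
      _ = 1 := by rw [hUU, Matrix.mul_one, hVV']
  · have : (U * Vᵀ)ᵀ * (U * Matrix.diagonal s * Vᵀ) = V * Matrix.diagonal s * Vᵀ := by
      rw [Matrix.transpose_mul, Matrix.transpose_transpose]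
      calc V * Uᵀ * (U * Matrix.diagonal s * Vᵀ) = V * (Uᵀ * U) * Matrix.diagonal s * Vᵀ := by
            simp only [Matrix.mul_assoc]
        _ = _ := by rw [hUU, Matrix.mul_one]
    rw [this]
    have h := (Matrix.PosSemidef.diagonal hs).mul_mul_conjTranspose_same V
    simpa using h

lemma trace_mul_nonneg {m : Type*} [Fintype m] {A B : Matrix m m ℝ} (hA : A.PosSemidef)
    (hB : B.PosSemidef) : 0 ≤ (A * B).trace := by
  classical
  obtain ⟨V, hV, e, he⟩ := exists_orthogonal_diagonalization (S := A) (by simpa using hA.1.eq)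
  have he0 : ∀ i, 0 ≤ e i := nonneg_of_posSemidef_conj_diagonal hV (he ▸ hA)
  have hB' : (Vᵀ * B * V).PosSemidef := by simpa using hB.conjTranspose_mul_mul_same V
  have : (A * B).trace = (Matrix.diagonal e * (Vᵀ * B * V)).trace := by
    rw [he, Matrix.mul_assoc, Matrix.mul_assoc, Matrix.trace_mul_comm]
    simp only [Matrix.mul_assoc]
  rw [this]
  simp only [Matrix.trace, Matrix.diag_apply, Matrix.diagonal_mul]
  exact Finset.sum_nonneg fun i _ => mul_nonneg (he0 i) hB'.diag_nonneg

lemma mul_frobenius_sq_le_of_lower {m n k : Type*} [Fintype m] [Fintype n] [Fintype k]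
    {B : Matrix n k ℝ} {σ : ℝ}
    (hB : ∀ w : k → ℝ, σ * (w ⬝ᵥ w) ≤ (B *ᵥ w) ⬝ᵥ (B *ᵥ w)) (D : Matrix m k ℝ) :
    σ * ‖D‖ ^ 2 ≤ ‖B * Dᵀ‖ ^ 2 := by
  rw [frobenius_sq_eq_sum, frobenius_sq_eq_sum, Finset.mul_sum, Finset.sum_comm]
  refine Finset.sum_le_sum fun i _ => ?_
  have := hB (D i)
  simp only [dotProduct, ← sq] at this
  refine this.trans (le_of_eq (Finset.sum_congr rfl fun k _ => ?_))
  simp [Matrix.mul_apply, Matrix.mulVec, dotProduct]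

/-- A Gram matrix determines its factor up to an orthogonal transformation, and stably so: if `B`
is well conditioned, then a factor `A` of a nearby Gram matrix is close to some rotation `B W`.
With `W` from the polar decomposition of `Bᵀ A` and `D = A - B W`, the matrix `(B W)ᵀ D` is
symmetric, which makes the cross terms in the expansion of `A Aᵀ - B Bᵀ` controllable. -/
lemma exists_orthogonal_frobenius_sub_le {n d : ℕ} (A B : Matrix (Fin n) (Fin d) ℝ) {σ : ℝ}
    (hB : ∀ w : Fin d → ℝ, σ * (w ⬝ᵥ w) ≤ (B *ᵥ w) ⬝ᵥ (B *ᵥ w)) :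
    ∃ W ∈ Matrix.orthogonalGroup (Fin d) ℝ,
      4 / 5 * σ * ‖A - B * W‖ ^ 2 ≤ ‖A * Aᵀ - B * Bᵀ‖ ^ 2 := by
  obtain ⟨W, hW, hpsd⟩ := exists_orthogonal_transpose_mul_posSemidef (Bᵀ * A)
  refine ⟨W, hW, ?_⟩
  have hWW : Wᵀ * W = 1 := (Matrix.mem_orthogonalGroup_iff' _ _).1 hW
  have hWW' : W * Wᵀ = 1 := (Matrix.mem_orthogonalGroup_iff _ _).1 hW
  set R := B * W with hR
  have hRR : R * Rᵀ = B * Bᵀ := by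
    rw [hR, Matrix.transpose_mul]
    calc B * W * (Wᵀ * Bᵀ) = B * (W * Wᵀ) * Bᵀ := by simp only [Matrix.mul_assoc]
      _ = _ := by rw [hWW', Matrix.mul_one]
  have hRA : (Rᵀ * A).PosSemidef := by
    rw [hR, Matrix.transpose_mul, Matrix.mul_assoc]; exact hpsd
  have hRl : ∀ w : Fin d → ℝ, σ * (w ⬝ᵥ w) ≤ (R *ᵥ w) ⬝ᵥ (R *ᵥ w) := by
    intro w
    have := hB (W *ᵥ w)
    have e : (W *ᵥ w) ⬝ᵥ (W *ᵥ w) = w ⬝ᵥ w := by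
      rw [Matrix.dotProduct_mulVec, ← Matrix.mulVec_transpose, Matrix.mulVec_mulVec, hWW,
        Matrix.one_mulVec]
    rw [e, Matrix.mulVec_mulVec] at this
    exact this
  rw [← hRR]
  set D := A - R with hD
  have hA : A = R + D := by rw [hD]; abel
  set S := Rᵀ * D with hS
  set H := Dᵀ * D with hH
  set G := Rᵀ * R with hG
  have hSG : Rᵀ * A = G + S := by rw [hA, Matrix.mul_add]
  have hSt : Sᵀ = S := by
    have h1 : (Rᵀ * A)ᵀ = Rᵀ * A := by simpa using hRA.1.eq
    have h2 : Gᵀ = G := by rw [hG]; simp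
    rw [hSG, Matrix.transpose_add, h2] at h1
    exact add_left_cancel h1
  have hSt' : Dᵀ * R = S := by rw [← hSt, hS]; simp
  have hHt : Hᵀ = H := by rw [hH]; simp
  have hexp : ‖A * Aᵀ - R * Rᵀ‖ ^ 2 =
      (H * H).trace + 4 * (H * S).trace + 2 * (S * S).trace + 2 * (H * G).trace := by
    have e : A * Aᵀ - R * Rᵀ = D * Rᵀ + R * Dᵀ + D * Dᵀ := by
      rw [hA]; simp only [Matrix.transpose_add, Matrix.mul_add, Matrix.add_mul]; abel
    have et : (D * Rᵀ + R * Dᵀ + D * Dᵀ)ᵀ = D * Rᵀ + R * Dᵀ + D * Dᵀ := by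
      simp only [Matrix.transpose_add, Matrix.transpose_mul, Matrix.transpose_transpose]; abel
    have key : ∀ (P P' : Matrix (Fin n) (Fin d) ℝ) (Q Q' : Matrix (Fin n) (Fin d) ℝ),
        ((P * Qᵀ) * (P' * Q'ᵀ)).trace = ((Qᵀ * P') * (Q'ᵀ * P)).trace := by
      intro P P' Q Q'
      rw [Matrix.mul_assoc, Matrix.trace_mul_comm]
      simp only [Matrix.mul_assoc]
    rw [e, frobenius_sq_eq_trace, et]
    simp only [Matrix.add_mul, Matrix.mul_add, Matrix.trace_add, key]
    simp only [← hS, ← hH, ← hG, hSt']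
    rw [Matrix.trace_mul_comm S H, Matrix.trace_mul_comm G H]
    ring
  have hHpsd : H.PosSemidef := by simpa using Matrix.posSemidef_conjTranspose_mul_self D
  -- the expansion equals `2 tr (S + 7/10 H)² + 6/5 tr (H (G + S)) + 1/50 tr H² + 4/5 tr (H G)`
  have h1 : 0 ≤ (H * (G + S)).trace := trace_mul_nonneg hHpsd (hSG ▸ hRA)
  have h2 : 0 ≤ ((S + (7/10 : ℝ) • H) * (S + (7/10 : ℝ) • H)).trace := by
    have e : (S + (7/10 : ℝ) • H)ᵀ = S + (7/10 : ℝ) • H := by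
      rw [Matrix.transpose_add, Matrix.transpose_smul, hSt, hHt]
    calc (0:ℝ) ≤ ‖S + (7/10 : ℝ) • H‖ ^ 2 := by positivity
      _ = _ := by rw [frobenius_sq_eq_trace, e]
  have h3 : 0 ≤ (H * H).trace := trace_mul_nonneg hHpsd hHpsd
  have h4 : σ * ‖D‖ ^ 2 ≤ (H * G).trace := by
    refine (mul_frobenius_sq_le_of_lower hRl D).trans (le_of_eq ?_)
    rw [frobenius_sq_eq_trace, Matrix.transpose_mul, Matrix.transpose_transpose,
      hH, hG, Matrix.trace_mul_comm (Dᵀ * D)]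
    conv_rhs => rw [Matrix.mul_assoc, Matrix.trace_mul_comm]
    rw [Matrix.trace_mul_comm]
    simp only [Matrix.mul_assoc]
  simp only [Matrix.add_mul, Matrix.mul_add, Matrix.trace_add, Matrix.smul_mul, Matrix.mul_smul,
    Matrix.trace_smul, smul_eq_mul] at h1 h2
  rw [Matrix.trace_mul_comm S H] at h2
  rw [hexp]
  linarith

lemma procrustesSq_le {n d : ℕ} (A B : Matrix (Fin n) (Fin d) ℝ) {W : Matrix (Fin d) (Fin d) ℝ}
    (hW : W ∈ Matrix.orthogonalGroup (Fin d) ℝ) : procrustesSq A B ≤ ‖A - B * W‖ ^ 2 :=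
  ciInf_le (f := fun W : Matrix.orthogonalGroup (Fin d) ℝ =>
    ‖A - B * (W : Matrix (Fin d) (Fin d) ℝ)‖ ^ 2) ⟨0, by rintro _ ⟨W, rfl⟩; positivity⟩ ⟨W, hW⟩

/-! ### Truncated spectral decompositions and subspace angles -/

/-- The orthogonal projection onto the complement of the column space of a matrix of full column
rank. -/
lemma exists_projection_annihilating {n d : ℕ} {B : Matrix (Fin n) (Fin d) ℝ} {σ : ℝ} (hσ : 0 < σ)
    (hB : ∀ w : Fin d → ℝ, σ * (w ⬝ᵥ w) ≤ (B *ᵥ w) ⬝ᵥ (B *ᵥ w)) :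
    ∃ Q : Matrix (Fin n) (Fin n) ℝ, Qᵀ = Q ∧ Q * Q = Q ∧ Q * B = 0 ∧
      Q.trace = (n : ℝ) - d := by
  have hinj : ∀ w, (Bᵀ * B) *ᵥ w = 0 → w = 0 := by
    intro w hw
    have h1 := hB w
    have h2 : (B *ᵥ w) ⬝ᵥ (B *ᵥ w) = 0 := by
      rw [Matrix.dotProduct_mulVec, ← Matrix.mulVec_transpose, Matrix.mulVec_mulVec, hw]
      simp
    have h3 : w ⬝ᵥ w ≤ 0 := by
      rw [h2] at h1
      exact nonpos_of_mul_nonpos_right h1 hσ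
    have h4 : w ⬝ᵥ w = 0 := le_antisymm h3 (Finset.sum_nonneg fun i _ => mul_self_nonneg _)
    exact dotProduct_self_eq_zero.1 h4
  have hunit : IsUnit (Bᵀ * B) := by
    rw [← Matrix.mulVec_injective_iff_isUnit, ← Matrix.coe_mulVecLin]
    exact (injective_iff_map_eq_zero _).2 hinj
  have hdet : IsUnit (Bᵀ * B).det := (Matrix.isUnit_iff_isUnit_det _).1 hunit
  set G := Bᵀ * B with hG
  have hGt : Gᵀ = G := by simp [hG]
  have hGi : G⁻¹ᵀ = G⁻¹ := by rw [Matrix.transpose_nonsing_inv, hGt]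
  have hinv : G⁻¹ * G = 1 := Matrix.nonsing_inv_mul _ hdet
  have hinv' : G * G⁻¹ = 1 := Matrix.mul_nonsing_inv _ hdet
  have hQB : (1 - B * G⁻¹ * Bᵀ) * B = 0 := by
    rw [Matrix.sub_mul, Matrix.mul_assoc, ← hG, Matrix.mul_assoc, hinv]
    simp
  refine ⟨1 - B * G⁻¹ * Bᵀ, ?_, ?_, hQB, ?_⟩
  · simp [Matrix.transpose_sub, Matrix.transpose_mul, hGi, Matrix.mul_assoc]
  · rw [Matrix.mul_sub, Matrix.mul_one, ← Matrix.mul_assoc, ← Matrix.mul_assoc, hQB]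
    simp
  · rw [Matrix.trace_sub, Matrix.trace_mul_comm, ← Matrix.mul_assoc, ← hG, hinv']
    simp

lemma frobenius_projection_mul_le {n k : Type*} [Fintype n] [Fintype k] {Q : Matrix n n ℝ}
    (hQ : Qᵀ = Q) (hQQ : Q * Q = Q) (M : Matrix n k ℝ) : ‖Q * M‖ ≤ ‖M‖ := by
  classical
  have h : ‖M‖ ^ 2 = ‖Q * M‖ ^ 2 + ‖(1 - Q) * M‖ ^ 2 := by
    simp only [frobenius_sq_eq_trace]
    rw [← Matrix.trace_add]
    congr 1
    have h2 : (1 - Q) * (1 - Q) = 1 - Q := by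
      rw [Matrix.mul_sub, Matrix.sub_mul, Matrix.sub_mul, hQQ]; simp
    have h3 : (1 - Q)ᵀ = 1 - Q := by rw [Matrix.transpose_sub, hQ]; simp
    rw [Matrix.transpose_mul, Matrix.transpose_mul, hQ, h3]
    calc Mᵀ * M = Mᵀ * (Q * M) + Mᵀ * ((1 - Q) * M) := by
          rw [← Matrix.mul_add, ← Matrix.add_mul]; simp
      _ = Mᵀ * (Q * Q * M) + Mᵀ * ((1 - Q) * (1 - Q) * M) := by rw [hQQ, h2]
      _ = _ := by simp only [Matrix.mul_assoc]
  exact (sq_le_sq₀ (norm_nonneg _) (norm_nonneg _)).1 (by nlinarith [sq_nonneg ‖(1 - Q) * M‖])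

lemma projection_of_orthonormal_columns {n d : Type*} [Fintype n] [Fintype d] [DecidableEq n]
    [DecidableEq d]
    {U : Matrix n d ℝ} (hU : Uᵀ * U = 1) :
    (U * Uᵀ)ᵀ = U * Uᵀ ∧ (U * Uᵀ) * (U * Uᵀ) = U * Uᵀ ∧
    (1 - U * Uᵀ)ᵀ = 1 - U * Uᵀ ∧ (1 - U * Uᵀ) * (1 - U * Uᵀ) = 1 - U * Uᵀ ∧
    (1 - U * Uᵀ) * U = 0 := by
  have h1 : (U * Uᵀ) * U = U := by rw [Matrix.mul_assoc, hU, Matrix.mul_one]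
  have h2 : (U * Uᵀ) * (U * Uᵀ) = U * Uᵀ := by rw [← Matrix.mul_assoc, h1]
  refine ⟨by simp, h2, by simp, ?_, ?_⟩
  · rw [Matrix.mul_sub, Matrix.sub_mul, Matrix.sub_mul, h2]; simp
  · rw [Matrix.sub_mul, h1]; simp

lemma frobenius_mul_orthonormal_le {n d k : Type*} [Fintype n] [Fintype d] [Fintype k]
    [DecidableEq n] [DecidableEq d]
    {U : Matrix n d ℝ} (hU : Uᵀ * U = 1) (M : Matrix k n ℝ) : ‖M * U‖ ≤ ‖M‖ := by
  obtain ⟨h1, h2, -⟩ := projection_of_orthonormal_columns hU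
  have h3 : ‖M * U‖ ^ 2 = ‖(U * Uᵀ) * Mᵀ‖ ^ 2 := by
    rw [frobenius_sq_eq_trace', frobenius_sq_eq_trace, Matrix.transpose_mul, Matrix.transpose_mul,
      h1, Matrix.transpose_transpose]
    calc (M * U * (Uᵀ * Mᵀ)).trace = (M * (U * Uᵀ) * Mᵀ).trace := by simp only [Matrix.mul_assoc]
      _ = (M * ((U * Uᵀ) * (U * Uᵀ)) * Mᵀ).trace := by rw [h2]
      _ = _ := by simp only [Matrix.mul_assoc]
  rw [(sq_eq_sq₀ (norm_nonneg _) (norm_nonneg _)).1 h3, ← Matrix.frobenius_norm_transpose M]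
  exact frobenius_projection_mul_le h1 h2 _

lemma frobenius_sq_orthogonal_conj_diagonal {m : Type*} [Fintype m] [DecidableEq m]
    {V : Matrix m m ℝ} (hV : V ∈ Matrix.orthogonalGroup m ℝ) (e : m → ℝ) :
    ‖V * Matrix.diagonal e * Vᵀ‖ ^ 2 = ∑ i, e i ^ 2 := by
  have hVV : Vᵀ * V = 1 := (Matrix.mem_orthogonalGroup_iff' _ _).1 hV
  rw [frobenius_sq_eq_trace, Matrix.trace_mul_comm]
  have : V * Matrix.diagonal e * Vᵀ * (V * Matrix.diagonal e * Vᵀ)ᵀ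
      = V * (Matrix.diagonal e * Matrix.diagonal e) * Vᵀ := by
    simp only [Matrix.transpose_mul, Matrix.transpose_transpose, Matrix.diagonal_transpose]
    calc _ = V * Matrix.diagonal e * (Vᵀ * V) * Matrix.diagonal e * Vᵀ := by
          simp only [Matrix.mul_assoc]
      _ = _ := by rw [hVV]; simp only [Matrix.mul_assoc, Matrix.mul_one]
  rw [this, Matrix.mul_assoc, Matrix.trace_mul_comm, Matrix.mul_assoc, hVV, Matrix.mul_one,
    Matrix.diagonal_mul_diagonal, Matrix.trace_diagonal]
  simp [sq]

lemma truncation_eq {n d : ℕ} (hdn : d ≤ n) (lam : Fin n → ℝ) (V : Matrix (Fin n) (Fin n) ℝ) :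
    V.submatrix id (Fin.castLE hdn) * Matrix.diagonal (fun k => lam (Fin.castLE hdn k)) *
      (V.submatrix id (Fin.castLE hdn))ᵀ =
    V * Matrix.diagonal (fun i : Fin n => if (i : ℕ) < d then lam i else 0) * Vᵀ := by
  obtain ⟨m, rfl⟩ := Nat.exists_eq_add_of_le hdn
  ext i j
  rw [Matrix.mul_apply, Matrix.mul_apply, Fin.sum_univ_add]
  simp only [Matrix.mul_diagonal, Matrix.transpose_apply, Matrix.submatrix_apply, id_eq,
    Fin.val_castAdd, Fin.is_lt, if_true, Fin.val_natAdd, not_lt_of_ge (Nat.le_add_right d _),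
    if_false, mul_zero, zero_mul, Finset.sum_const_zero, add_zero]
  rfl

/-- **Eckart–Young**: truncating the spectral decomposition of a positive semidefinite matrix is at
least as good in Frobenius norm as any matrix whose column space has codimension at least `n - d`
(witnessed by a projection `Q` of trace `n - d` that annihilates it). -/
lemma frobenius_sub_truncation_le {n d : ℕ} (hd : 0 < d) (hdn : d ≤ n) {lam : Fin n → ℝ}
    (hlam : Antitone lam) (hlam0 : ∀ i, 0 ≤ lam i) {V : Matrix (Fin n) (Fin n) ℝ}
    (hV : V ∈ Matrix.orthogonalGroup (Fin n) ℝ) {P₀ Q : Matrix (Fin n) (Fin n) ℝ}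
    (hQ : Qᵀ = Q) (hQQ : Q * Q = Q) (hQP : Q * P₀ = 0) (htr : Q.trace = (n : ℝ) - d) :
    ‖V * Matrix.diagonal lam * Vᵀ -
      V * Matrix.diagonal (fun i : Fin n => if (i : ℕ) < d then lam i else 0) * Vᵀ‖ ≤
      ‖V * Matrix.diagonal lam * Vᵀ - P₀‖ := by
  have hVV : Vᵀ * V = 1 := (Matrix.mem_orthogonalGroup_iff' _ _).1 hV
  have hVV' : V * Vᵀ = 1 := (Matrix.mem_orthogonalGroup_iff _ _).1 hV
  refine le_trans ?_ (frobenius_projection_mul_le hQ hQQ _)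
  rw [Matrix.mul_sub, hQP, sub_zero]
  refine (sq_le_sq₀ (norm_nonneg _) (norm_nonneg _)).1 ?_
  rw [← Matrix.sub_mul, ← Matrix.mul_sub, Matrix.diagonal_sub,
    frobenius_sq_orthogonal_conj_diagonal hV]
  set q := Vᵀ * Q * V with hq
  have hqt : qᵀ = q := by
    rw [hq]; simp only [Matrix.transpose_mul, Matrix.transpose_transpose, hQ, Matrix.mul_assoc]
  have hqq : q * q = q := by
    rw [hq]
    calc _ = Vᵀ * Q * (V * Vᵀ) * Q * V := by simp only [Matrix.mul_assoc]
      _ = Vᵀ * (Q * Q) * V := by rw [hVV', Matrix.mul_one]; simp only [Matrix.mul_assoc]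
      _ = _ := by rw [hQQ]
  have hqtr : ∑ i, q i i = (n : ℝ) - d := by
    rw [← htr, ← Matrix.one_mul Q, ← hVV', Matrix.mul_assoc, Matrix.trace_mul_comm V]
    rfl
  have hqi : ∀ i, q i i = ∑ k, q i k ^ 2 := by
    intro i
    conv_lhs => rw [← hqq, Matrix.mul_apply]
    refine Finset.sum_congr rfl fun k _ => ?_
    rw [sq, ← congrFun (congrFun hqt i) k, Matrix.transpose_apply]
  have hq0 : ∀ i, 0 ≤ q i i := fun i => by rw [hqi]; positivity
  have hq1 : ∀ i, q i i ≤ 1 := by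
    intro i
    have h1 : q i i ^ 2 ≤ q i i := by
      conv_rhs => rw [hqi]
      exact Finset.single_le_sum (f := fun k => q i k ^ 2) (fun k _ => sq_nonneg _)
        (Finset.mem_univ i)
    nlinarith [hq0 i]
  have hR : ‖Q * (V * Matrix.diagonal lam * Vᵀ)‖ ^ 2 = ∑ i, lam i ^ 2 * q i i := by
    rw [frobenius_sq_eq_trace']
    have : Q * (V * Matrix.diagonal lam * Vᵀ) * (Q * (V * Matrix.diagonal lam * Vᵀ))ᵀ
        = Q * (V * (Matrix.diagonal lam * Matrix.diagonal lam) * Vᵀ) * Q := by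
      simp only [Matrix.transpose_mul, Matrix.transpose_transpose, Matrix.diagonal_transpose, hQ]
      calc _ = Q * (V * Matrix.diagonal lam * (Vᵀ * V) * Matrix.diagonal lam * Vᵀ) * Q := by
            simp only [Matrix.mul_assoc]
        _ = _ := by rw [hVV]; simp only [Matrix.mul_assoc, Matrix.mul_one]
    rw [this, Matrix.trace_mul_comm, ← Matrix.mul_assoc, hQQ]
    have : (Q * (V * (Matrix.diagonal lam * Matrix.diagonal lam) * Vᵀ)).trace
        = ((Matrix.diagonal lam * Matrix.diagonal lam) * q).trace := by
      rw [Matrix.mul_assoc V, ← Matrix.mul_assoc Q, Matrix.trace_mul_comm, hq]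
      simp only [Matrix.mul_assoc]
    rw [this, Matrix.diagonal_mul_diagonal]
    simp [Matrix.trace, Matrix.diagonal_mul, sq]
  rw [hR]
  -- Compare with the threshold `τ = lam_d ^ 2`, using that the weights `q i i` have sum `n - d`.
  set τ := lam ⟨d - 1, by omega⟩ ^ 2 with hτ
  have hcount : ∑ i : Fin n, (if (i : ℕ) < d then (0:ℝ) else 1) = (n : ℝ) - d := by
    obtain ⟨m, rfl⟩ := Nat.exists_eq_add_of_le hdn
    rw [Fin.sum_univ_add]
    simp
  have hterm : ∀ i : Fin n, τ * (q i i - if (i : ℕ) < d then (0:ℝ) else 1) ≤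
      lam i ^ 2 * q i i - (lam i - if (i : ℕ) < d then lam i else 0) ^ 2 := by
    intro i
    split_ifs with h
    · have h1 : lam ⟨d - 1, by omega⟩ ≤ lam i := hlam (by simp [Fin.le_def]; omega)
      have h2 : τ ≤ lam i ^ 2 := by rw [hτ]; exact pow_le_pow_left₀ (hlam0 _) h1 2
      nlinarith [hq0 i]
    · have h1 : lam i ≤ lam ⟨d - 1, by omega⟩ := hlam (by simp [Fin.le_def]; omega)
      have h2 : lam i ^ 2 ≤ τ := by rw [hτ]; exact pow_le_pow_left₀ (hlam0 _) h1 2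
      nlinarith [hq1 i]
  have hsum := Finset.sum_le_sum fun i (_ : i ∈ Finset.univ) => hterm i
  rw [← Finset.mul_sum, Finset.sum_sub_distrib, hqtr, hcount, sub_self, mul_zero,
    Finset.sum_sub_distrib] at hsum
  linarith

/-- The Procrustes distance between two orthonormal frames is controlled by the sines of the
principal angles between the subspaces they span. -/
lemma procrustesSq_le_sin_theta {n d : ℕ} {U U₀ : Matrix (Fin n) (Fin d) ℝ} (hU : Uᵀ * U = 1)
    (hU₀ : U₀ᵀ * U₀ = 1) : procrustesSq U U₀ ≤ 2 * ‖(1 - U * Uᵀ) * U₀‖ ^ 2 := by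
  obtain ⟨W, hW, hpsd⟩ := exists_orthogonal_transpose_mul_posSemidef (U₀ᵀ * U)
  have hWW : Wᵀ * W = 1 := (Matrix.mem_orthogonalGroup_iff' _ _).1 hW
  have hWW' : W * Wᵀ = 1 := (Matrix.mem_orthogonalGroup_iff _ _).1 hW
  refine (procrustesSq_le U U₀ hW).trans ?_
  set B := Wᵀ * (U₀ᵀ * U) with hB
  have hBt : Bᵀ = B := by simpa using hpsd.1.eq
  have hBB : B * B = Uᵀ * (U₀ * U₀ᵀ) * U := by
    nth_rw 1 [← hBt]
    rw [hB]
    simp only [Matrix.transpose_mul, Matrix.transpose_transpose]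
    calc _ = Uᵀ * U₀ * (W * Wᵀ) * U₀ᵀ * U := by simp only [Matrix.mul_assoc]
      _ = _ := by rw [hWW', Matrix.mul_one]; simp only [Matrix.mul_assoc]
  have h1 : ‖U - U₀ * W‖ ^ 2 = 2 * d - 2 * B.trace := by
    rw [frobenius_sq_eq_trace]
    have e : (U - U₀ * W)ᵀ * (U - U₀ * W) = 1 + 1 - B - B := by
      rw [Matrix.transpose_sub, Matrix.sub_mul, Matrix.mul_sub, Matrix.mul_sub, hU]
      have e1 : (U₀ * W)ᵀ * U = B := by rw [hB, Matrix.transpose_mul, Matrix.mul_assoc]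
      have e2 : Uᵀ * (U₀ * W) = B := by
        rw [← hBt, ← e1]; simp
      have e3 : (U₀ * W)ᵀ * (U₀ * W) = 1 := by
        rw [Matrix.transpose_mul]
        calc _ = Wᵀ * (U₀ᵀ * U₀) * W := by simp only [Matrix.mul_assoc]
          _ = 1 := by rw [hU₀, Matrix.mul_one, hWW]
      rw [e1, e2, e3]; abel
    rw [e]
    simp only [Matrix.trace_sub, Matrix.trace_add, Matrix.trace_one, Fintype.card_fin]
    ring
  obtain ⟨-, -, h3, h4, -⟩ := projection_of_orthonormal_columns hU
  have h2 : ‖(1 - U * Uᵀ) * U₀‖ ^ 2 = d - (B * B).trace := by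
    rw [frobenius_sq_eq_trace, Matrix.transpose_mul, h3]
    have e : U₀ᵀ * (1 - U * Uᵀ) * ((1 - U * Uᵀ) * U₀) = 1 - U₀ᵀ * (U * Uᵀ) * U₀ := by
      calc _ = U₀ᵀ * ((1 - U * Uᵀ) * (1 - U * Uᵀ)) * U₀ := by simp only [Matrix.mul_assoc]
        _ = _ := by rw [h4, Matrix.mul_sub, Matrix.sub_mul, Matrix.mul_one, hU₀]
    rw [e, Matrix.trace_sub, hBB]
    simp only [Matrix.trace_one, Fintype.card_fin]
    congr 1
    rw [Matrix.trace_mul_comm, Matrix.trace_mul_comm _ U, ← Matrix.mul_assoc, ← Matrix.mul_assoc U,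
      Matrix.trace_mul_comm]
  -- The eigenvalues of `B` lie in `[0, 1]`, so `tr B² ≤ tr B`.
  obtain ⟨V, hV, e, he⟩ := exists_orthogonal_diagonalization hBt
  have hVV : Vᵀ * V = 1 := (Matrix.mem_orthogonalGroup_iff' _ _).1 hV
  have hVV' : V * Vᵀ = 1 := (Matrix.mem_orthogonalGroup_iff _ _).1 hV
  have he0 : ∀ i, 0 ≤ e i := nonneg_of_posSemidef_conj_diagonal hV (he ▸ hpsd)
  have hBBe : B * B = V * Matrix.diagonal (fun i => e i ^ 2) * Vᵀ := by
    rw [he]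
    calc _ = V * Matrix.diagonal e * (Vᵀ * V) * Matrix.diagonal e * Vᵀ := by
          simp only [Matrix.mul_assoc]
      _ = V * (Matrix.diagonal e * Matrix.diagonal e) * Vᵀ := by
          rw [hVV]; simp only [Matrix.mul_assoc, Matrix.mul_one]
      _ = _ := by rw [Matrix.diagonal_mul_diagonal]; simp only [sq]
  have he1 : ∀ i, e i ≤ 1 := by
    intro i
    have hp : (V * Matrix.diagonal (fun i => 1 - e i ^ 2) * Vᵀ).PosSemidef := by
      have e1 : V * Matrix.diagonal (fun i => 1 - e i ^ 2) * Vᵀ = 1 - B * B := by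
        rw [hBBe, ← Matrix.diagonal_sub (fun _ => (1:ℝ)), Matrix.mul_sub, Matrix.sub_mul,
          Matrix.diagonal_one, Matrix.mul_one, hVV']
      obtain ⟨-, -, h5, h6, -⟩ := projection_of_orthonormal_columns hU₀
      have e2 : 1 - B * B = ((1 - U₀ * U₀ᵀ) * U)ᵀ * ((1 - U₀ * U₀ᵀ) * U) := by
        rw [Matrix.transpose_mul, h5]
        calc 1 - B * B = Uᵀ * (1 - U₀ * U₀ᵀ) * U := by
              rw [hBB, Matrix.mul_sub, Matrix.sub_mul, Matrix.mul_one, hU]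
          _ = Uᵀ * ((1 - U₀ * U₀ᵀ) * (1 - U₀ * U₀ᵀ)) * U := by rw [h6]
          _ = _ := by simp only [Matrix.mul_assoc]
      rw [e1, e2]
      rw [← Matrix.conjTranspose_eq_transpose_of_trivial]
      exact Matrix.posSemidef_conjTranspose_mul_self ((1 - U₀ * U₀ᵀ) * U)
    have := nonneg_of_posSemidef_conj_diagonal hV hp i
    nlinarith [he0 i]
  have htr : ∀ f : Fin d → ℝ, (V * Matrix.diagonal f * Vᵀ).trace = ∑ i, f i := by
    intro f
    rw [Matrix.mul_assoc, Matrix.trace_mul_comm, Matrix.mul_assoc, hVV, Matrix.mul_one,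
      Matrix.trace_diagonal]
  have hle : (B * B).trace ≤ B.trace := by
    rw [hBBe, htr]
    conv_rhs => rw [he, htr]
    exact Finset.sum_le_sum fun i _ => by nlinarith [he0 i, he1 i]
  rw [h1, h2]
  linarith

/-- Deterministic error bounds for the spectral embedding of an estimate `P` of the edge
probability matrix `X₀ X₀ᵀ`: the rescaled eigenvectors estimate `X₀`, and the eigenvectors
themselves estimate its left singular vectors. The truncation of `P` to rank `d` is by Eckart–Young
at most twice as far from `X₀ X₀ᵀ` as `P`. -/
lemma procrustesSq_embedding_le {n d : ℕ} (hd : 0 < d) {X₀ : Matrix (Fin n) (Fin d) ℝ} {σ : ℝ}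
    (hσ : 0 < σ) (hX : ∀ w : Fin d → ℝ, σ * (w ⬝ᵥ w) ≤ (X₀ *ᵥ w) ⬝ᵥ (X₀ *ᵥ w))
    {P : Matrix (Fin n) (Fin n) ℝ} (hP : P.PosSemidef) {U : Matrix (Fin n) (Fin d) ℝ}
    {s : Fin d → ℝ} (h : IsLeadingEigenpairs P U s) :
    σ * procrustesSq (U * Matrix.diagonal fun k => √(s k)) X₀ ≤ 5 * ‖P - X₀ * X₀ᵀ‖ ^ 2 ∧
    ∀ U₀, IsLeftSingularMatrix X₀ U₀ →
      σ ^ 2 * procrustesSq U U₀ ≤ 8 * ‖P - X₀ * X₀ᵀ‖ ^ 2 := by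
  obtain ⟨hdn, lam, V, hlam, hV, rfl, rfl, rfl⟩ := h
  have hVV : Vᵀ * V = 1 := (Matrix.mem_orthogonalGroup_iff' _ _).1 hV
  have hlam0 := nonneg_of_posSemidef_conj_diagonal hV hP
  obtain ⟨Q, hQ, hQQ, hQX, htr⟩ := exists_projection_annihilating hσ hX
  have hEY := frobenius_sub_truncation_le hd hdn hlam hlam0 hV (P₀ := X₀ * X₀ᵀ) hQ hQQ
    (by rw [← Matrix.mul_assoc, hQX, Matrix.zero_mul]) htr
  rw [← truncation_eq hdn] at hEY
  set P := V * Matrix.diagonal lam * Vᵀ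
  set U := V.submatrix id (Fin.castLE hdn) with hUdef
  set s : Fin d → ℝ := fun k => lam (Fin.castLE hdn k) with hs
  have hs0 : ∀ k, 0 ≤ s k := fun k => hlam0 _
  have hU : Uᵀ * U = 1 := by
    rw [hUdef, Matrix.transpose_submatrix, ← Matrix.submatrix_mul _ _ _ id _ Function.bijective_id,
      hVV]
    exact Matrix.submatrix_one _ (Fin.castLE_injective hdn)
  have hdist : ‖U * Matrix.diagonal s * Uᵀ - X₀ * X₀ᵀ‖ ≤ 2 * ‖P - X₀ * X₀ᵀ‖ := by
    have h1 := norm_add_le (-(P - U * Matrix.diagonal s * Uᵀ)) (P - X₀ * X₀ᵀ)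
    rw [norm_neg] at h1
    have h2 : -(P - U * Matrix.diagonal s * Uᵀ) + (P - X₀ * X₀ᵀ)
      = U * Matrix.diagonal s * Uᵀ - X₀ * X₀ᵀ := by abel
    rw [h2] at h1
    linarith
  have hdist2 : ‖U * Matrix.diagonal s * Uᵀ - X₀ * X₀ᵀ‖ ^ 2 ≤ 4 * ‖P - X₀ * X₀ᵀ‖ ^ 2 := by
    have := pow_le_pow_left₀ (norm_nonneg _) hdist 2
    linarith [mul_pow 2 ‖P - X₀ * X₀ᵀ‖ 2]
  constructor
  · obtain ⟨W, hW, hWle⟩ := exists_orthogonal_frobenius_sub_le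
      (U * Matrix.diagonal fun k => √(s k)) X₀ hX
    have hXX : (U * Matrix.diagonal fun k => √(s k)) * (U * Matrix.diagonal fun k => √(s k))ᵀ
        = U * Matrix.diagonal s * Uᵀ := by
      rw [Matrix.transpose_mul, Matrix.diagonal_transpose]
      calc _ = U * ((Matrix.diagonal fun k => √(s k)) *
              (Matrix.diagonal fun k => √(s k))) * Uᵀ := by
            simp only [Matrix.mul_assoc]
        _ = _ := by
            rw [Matrix.diagonal_mul_diagonal]
            simp only [fun k => Real.mul_self_sqrt (hs0 k)]
    rw [hXX] at hWle
    have := mul_le_mul_of_nonneg_left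
      (procrustesSq_le (U * Matrix.diagonal fun k => √(s k)) X₀ hW) hσ.le
    linarith
  · rintro U₀ ⟨t, O, hU₀, hO, -, ht0, hX₀⟩
    have hOO : Oᵀ * O = 1 := (Matrix.mem_orthogonalGroup_iff' _ _).1 hO
    have hP₀ : X₀ * X₀ᵀ * U₀ = U₀ * Matrix.diagonal fun k => t k ^ 2 := by
      rw [hX₀]
      simp only [Matrix.transpose_mul, Matrix.transpose_transpose, Matrix.diagonal_transpose]
      calc _ = U₀ * Matrix.diagonal t * (Oᵀ * O) * Matrix.diagonal t * (U₀ᵀ * U₀) := by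
            simp only [Matrix.mul_assoc]
        _ = U₀ * (Matrix.diagonal t * Matrix.diagonal t) := by
            rw [hOO, hU₀]; simp only [Matrix.mul_assoc, Matrix.mul_one]
        _ = _ := by rw [Matrix.diagonal_mul_diagonal]; simp only [sq]
    have ht : ∀ k, σ ≤ t k ^ 2 := by
      intro k
      have h1 := hX (O *ᵥ Pi.single k 1)
      have e1 : (O *ᵥ Pi.single k 1) ⬝ᵥ (O *ᵥ Pi.single k 1) = 1 := by
        rw [Matrix.dotProduct_mulVec, ← Matrix.mulVec_transpose, Matrix.mulVec_mulVec, hOO]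
        simp
      have e2 : X₀ *ᵥ (O *ᵥ Pi.single k 1) = U₀ *ᵥ (Pi.single k (t k)) := by
        rw [Matrix.mulVec_mulVec, hX₀, Matrix.mul_assoc, hOO, Matrix.mul_one,
          ← Matrix.mulVec_mulVec]
        congr 1
        simp
      have e3 : (U₀ *ᵥ (Pi.single k (t k))) ⬝ᵥ (U₀ *ᵥ (Pi.single k (t k))) = t k ^ 2 := by
        rw [Matrix.dotProduct_mulVec, ← Matrix.mulVec_transpose, Matrix.mulVec_mulVec, hU₀]
        simp [sq]
      rw [e1, e2, e3, mul_one] at h1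
      exact h1
    obtain ⟨-, -, h3, h4, h5⟩ := projection_of_orthonormal_columns hU
    -- the projection `1 - U Uᵀ` annihilates the truncation of `P`, so only `X₀ X₀ᵀ U₀` survives
    have hkey : (1 - U * Uᵀ) * ((U * Matrix.diagonal s * Uᵀ - X₀ * X₀ᵀ) * U₀)
        = -((1 - U * Uᵀ) * U₀ * Matrix.diagonal fun k => t k ^ 2) := by
      rw [Matrix.sub_mul _ _ U₀, hP₀, Matrix.mul_sub, Matrix.mul_assoc U, Matrix.mul_assoc U,
        ← Matrix.mul_assoc _ U, h5, Matrix.zero_mul, zero_sub]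
      simp only [Matrix.mul_assoc]
    have hup : ‖(1 - U * Uᵀ) * U₀ * Matrix.diagonal fun k => t k ^ 2‖ ≤
        ‖U * Matrix.diagonal s * Uᵀ - X₀ * X₀ᵀ‖ := by
      rw [← norm_neg, ← hkey]
      exact (frobenius_projection_mul_le h3 h4 _).trans (frobenius_mul_orthonormal_le hU₀ _)
    have hlow : σ ^ 2 * ‖(1 - U * Uᵀ) * U₀‖ ^ 2 ≤
        ‖(1 - U * Uᵀ) * U₀ * Matrix.diagonal fun k => t k ^ 2‖ ^ 2 := by
      rw [frobenius_sq_eq_sum, frobenius_sq_eq_sum, Finset.mul_sum]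
      refine Finset.sum_le_sum fun i _ => ?_
      rw [Finset.mul_sum]
      refine Finset.sum_le_sum fun k _ => ?_
      rw [Matrix.mul_diagonal, mul_pow, mul_comm]
      exact mul_le_mul_of_nonneg_left (pow_le_pow_left₀ hσ.le (ht k) 2) (sq_nonneg _)
    have hup2 := pow_le_pow_left₀ (norm_nonneg _) hup 2
    have := mul_le_mul_of_nonneg_left (procrustesSq_le_sin_theta hU hU₀) (sq_nonneg σ)
    linarith

/-! ### The likelihood and the noise matrix -/

lemma latentMatrix_mul_transpose_apply {n d : ℕ} (x : Fin n → EuclideanSpace ℝ (Fin d))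
    (i j : Fin n) : (latentMatrix x * (latentMatrix x)ᵀ) i j = inner ℝ (x i) (x j) := by
  rw [PiLp.inner_apply]
  simp [Matrix.mul_apply, latentMatrix, mul_comm]

lemma inner_nonneg_of_mem_latentSpace {d : ℕ} {x y : EuclideanSpace ℝ (Fin d)}
    (hx : x ∈ latentSpace d)
    (hy : y ∈ latentSpace d) : 0 ≤ inner ℝ x y := by
  rw [PiLp.inner_apply]
  exact Finset.sum_nonneg fun k _ => mul_nonneg (hy.2 k) (hx.2 k)

lemma inner_le_one_of_mem_latentSpace {d : ℕ} {x y : EuclideanSpace ℝ (Fin d)}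
    (hx : x ∈ latentSpace d)
    (hy : y ∈ latentSpace d) : inner ℝ x y ≤ 1 :=
  (real_inner_le_norm x y).trans (mul_le_one₀ hx.1 (norm_nonneg _) hy.1)

lemma edgeProb_mem_Icc {n d : ℕ} {x : Fin n → EuclideanSpace ℝ (Fin d)}
    (hx : ∀ i, x i ∈ latentSpace d) (e : VertexPair n) : edgeProb x e ∈ Set.Icc (0 : ℝ) 1 :=
  ⟨inner_nonneg_of_mem_latentSpace (hx _) (hx _), inner_le_one_of_mem_latentSpace (hx _) (hx _)⟩

/-- A sum over all graphs of a product over the edges factorizes. -/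
lemma sum_adjacency_prod {n : ℕ} (g : VertexPair n → Bool → ℝ) :
    ∑ Y : Adjacency n, ∏ e, g e (Y e) = ∏ e, (g e true + g e false) := by
  have := Finset.prod_univ_sum (fun _ : VertexPair n => (Finset.univ : Finset Bool)) g
  simp only [Fintype.piFinset_univ, Fintype.sum_bool] at this
  exact this.symm

lemma likelihood_nonneg {n d : ℕ} {x : Fin n → EuclideanSpace ℝ (Fin d)}
    (hx : ∀ i, x i ∈ latentSpace d) (Y : Adjacency n) : 0 ≤ likelihood Y x := by
  refine Finset.prod_nonneg fun e _ => ?_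
  have := edgeProb_mem_Icc hx e
  split_ifs
  · exact this.1
  · linarith [this.2]

lemma sum_likelihood {n d : ℕ} (x : Fin n → EuclideanSpace ℝ (Fin d)) :
    ∑ Y : Adjacency n, likelihood Y x = 1 := by
  rw [show (∑ Y : Adjacency n, likelihood Y x) = ∏ e : VertexPair n, _ from
    sum_adjacency_prod fun e b => if b then edgeProb x e else 1 - edgeProb x e]
  simp

lemma likelihood_le_one {n d : ℕ} {x : Fin n → EuclideanSpace ℝ (Fin d)}
    (hx : ∀ i, x i ∈ latentSpace d) (Y : Adjacency n) : likelihood Y x ≤ 1 := by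
  rw [← sum_likelihood x]
  exact Finset.single_le_sum (fun Y _ => likelihood_nonneg hx Y) (Finset.mem_univ Y)

instance {n d : ℕ} (x : Fin n → EuclideanSpace ℝ (Fin d)) : IsProbabilityMeasure (rdpg x) := by
  unfold rdpg; infer_instance

lemma rdpg_real_singleton {n d : ℕ} {x : Fin n → EuclideanSpace ℝ (Fin d)}
    (hx : ∀ i, x i ∈ latentSpace d) (Y : Adjacency n) : (rdpg x).real {Y} = likelihood Y x := by
  rw [measureReal_def, rdpg, ← Set.univ_pi_singleton, Measure.pi_pi, ENNReal.toReal_prod,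
    likelihood]
  refine Finset.prod_congr rfl fun e => ?_
  intro _
  rw [← measureReal_def, Set.projIcc_of_mem _ (edgeProb_mem_Icc hx e)]
  cases hY : Y e <;> simp

/-- Expectations under the random dot product graph are likelihood-weighted sums over graphs. -/
lemma integral_rdpg {n d : ℕ} {x : Fin n → EuclideanSpace ℝ (Fin d)}
    (hx : ∀ i, x i ∈ latentSpace d) (f : Adjacency n → ℝ) :
    ∫ Y, f Y ∂(rdpg x) = ∑ Y, likelihood Y x * f Y := by
  rw [integral_fintype Integrable.of_finite]
  simp [rdpg_real_singleton hx]

/-- The `χ²`-affinity `∑ p_y² / p_x` of two random dot product graphs is a product over the edges,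
with factors `1 + (q - p)² / (p (1 - p))`. -/
lemma sum_likelihood_sq_div_le {n d : ℕ} {x y : Fin n → EuclideanSpace ℝ (Fin d)}
    {c : VertexPair n → ℝ}
    (hx : ∀ e, 0 < edgeProb x e ∧ edgeProb x e < 1)
    (h : ∀ e, (edgeProb y e - edgeProb x e) ^ 2 ≤ c e * (edgeProb x e * (1 - edgeProb x e))) :
    ∑ Y, likelihood Y y ^ 2 / likelihood Y x ≤ Real.exp (∑ e, c e) := by
  let g : VertexPair n → Bool → ℝ := fun e b =>
    (if b then edgeProb y e else 1 - edgeProb y e) ^ 2 /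
      (if b then edgeProb x e else 1 - edgeProb x e)
  have e1 : ∀ Y : Adjacency n, likelihood Y y ^ 2 / likelihood Y x =
      ∏ e, g e (Y e) := by
    intro Y
    simp only [g, likelihood, ← Finset.prod_pow, ← Finset.prod_div_distrib]
  rw [Finset.sum_congr rfl fun Y _ => e1 Y, sum_adjacency_prod g, Real.exp_sum]
  refine Finset.prod_le_prod (fun e _ => ?_) fun e _ => ?_
  · have := hx e
    have h1 : 0 < 1 - edgeProb x e := by linarith
    have h0 := this.1
    simp only [g, if_true, Bool.false_eq_true, if_false]
    positivity
  · obtain ⟨h0, h1⟩ := hx e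
    have h1' : 0 < 1 - edgeProb x e := by linarith
    have h2 := Real.add_one_le_exp (c e)
    refine le_trans ?_ h2
    simp only [g, if_true, Bool.false_eq_true, if_false]
    rw [div_add_div _ _ h0.ne' h1'.ne', div_le_iff₀ (by positivity)]
    nlinarith [h e]

/-- A sub-Gaussian bound for the centred Bernoulli law. The constant `1 / 2` is not Hoeffding's `1
/ 8`, but symmetrization gives it without calculus. -/
lemma bernoulli_mgf_le {p : ℝ} (h0 : 0 ≤ p) (h1 : p ≤ 1) (t : ℝ) :
    p * Real.exp (t * (1 - p)) + (1 - p) * Real.exp (t * (0 - p)) ≤ Real.exp (t ^ 2 / 2) := by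
  set F := p * Real.exp (t * (1 - p)) + (1 - p) * Real.exp (t * (0 - p)) with hF
  -- symmetrization: multiply by the moment generating function of an independent copy at `-t`
  set G := p * Real.exp (-(t * (1 - p))) + (1 - p) * Real.exp (-(t * (0 - p))) with hG
  have hG1 : 1 ≤ G := by
    have a1 := Real.add_one_le_exp (-(t * (1 - p)))
    have a2 := Real.add_one_le_exp (-(t * (0 - p)))
    nlinarith
  have hF0 : 0 ≤ F := by
    have : 0 ≤ 1 - p := by linarith
    positivity
  have hFG : F * G = 1 + 2 * (p * (1 - p)) * (Real.cosh t - 1) := by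
    have b1 : Real.exp (t * (1 - p)) * Real.exp (-(t * (1 - p))) = 1 := by
      rw [← Real.exp_add]; simp
    have b2 : Real.exp (t * (0 - p)) * Real.exp (-(t * (0 - p))) = 1 := by
      rw [← Real.exp_add]; simp
    have b3 : Real.exp (t * (1 - p)) * Real.exp (-(t * (0 - p))) = Real.exp t := by
      rw [← Real.exp_add]; congr 1; ring
    have b4 : Real.exp (t * (0 - p)) * Real.exp (-(t * (1 - p))) = Real.exp (-t) := by
      rw [← Real.exp_add]; congr 1; ring
    rw [Real.cosh_eq, hF, hG]
    linear_combination p ^ 2 * b1 + (1 - p) ^ 2 * b2 + p * (1 - p) * b3 + p * (1 - p) * b4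
  have hc := Real.one_le_cosh t
  calc F ≤ F * G := le_mul_of_one_le_right hF0 hG1
    _ ≤ Real.cosh t := by rw [hFG]; nlinarith [sq_nonneg (2 * p - 1)]
    _ ≤ _ := Real.cosh_le_exp_half_sq t

lemma sum_likelihood_mul_exp_le {n d : ℕ} {x : Fin n → EuclideanSpace ℝ (Fin d)}
    (hx : ∀ i, x i ∈ latentSpace d) (c : VertexPair n → ℝ) :
    ∑ Y : Adjacency n, likelihood Y x *
      Real.exp (∑ e, c e * ((if Y e then (1 : ℝ) else 0) - edgeProb x e)) ≤
      Real.exp (∑ e, c e ^ 2 / 2) := by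
  let g : VertexPair n → Bool → ℝ := fun e b =>
    (if b then edgeProb x e else 1 - edgeProb x e) *
      Real.exp (c e * ((if b then (1 : ℝ) else 0) - edgeProb x e))
  have e1 : ∀ Y : Adjacency n, likelihood Y x *
      Real.exp (∑ e, c e * ((if Y e then (1 : ℝ) else 0) - edgeProb x e)) =
      ∏ e, g e (Y e) := by
    intro Y
    simp only [g, likelihood, Real.exp_sum, ← Finset.prod_mul_distrib]
  rw [Finset.sum_congr rfl fun Y _ => e1 Y, sum_adjacency_prod g, Real.exp_sum]
  refine Finset.prod_le_prod (fun e _ => ?_) fun e _ => ?_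
  · obtain ⟨h0, h1⟩ := edgeProb_mem_Icc hx e
    have h1' : 0 ≤ 1 - edgeProb x e := by linarith
    simp only [g, if_true, Bool.false_eq_true, if_false]
    positivity
  · obtain ⟨h0, h1⟩ := edgeProb_mem_Icc hx e
    simpa [g] using bernoulli_mgf_le h0 h1 (c e)

/-- The symmetric `0/1` matrix of a graph. -/
def adjMatrix {n : ℕ} (Y : Adjacency n) : Matrix (Fin n) (Fin n) ℝ :=
  Matrix.of fun i j => if Y ⟨(min i j, max i j), min_le_max⟩ then 1 else 0

/-- The noise matrix `Y - X Xᵀ`. -/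
def noise {n d : ℕ} (x : Fin n → EuclideanSpace ℝ (Fin d)) (Y : Adjacency n) :
    Matrix (Fin n) (Fin n) ℝ :=
  adjMatrix Y - latentMatrix x * (latentMatrix x)ᵀ

lemma noise_transpose {n d : ℕ} (x : Fin n → EuclideanSpace ℝ (Fin d)) (Y : Adjacency n) :
    (noise x Y)ᵀ = noise x Y := by
  have : (adjMatrix Y)ᵀ = adjMatrix Y := by
    ext i j
    simp [adjMatrix, min_comm, max_comm]
  simp [noise, this]

lemma noise_apply_pair {n d : ℕ} (x : Fin n → EuclideanSpace ℝ (Fin d)) (Y : Adjacency n)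
    (e : VertexPair n) :
    noise x Y e.1.1 e.1.2 = (if Y e then (1 : ℝ) else 0) - edgeProb x e := by
  have : (⟨(min e.1.1 e.1.2, max e.1.1 e.1.2), min_le_max⟩ : VertexPair n) = e := by
    ext <;> simp [e.2]
  rw [noise, Matrix.sub_apply, latentMatrix_mul_transpose_apply, adjMatrix, Matrix.of_apply, this]
  rfl

/-- The number of times an unordered pair occurs in a sum over ordered pairs. -/
def multiplicity {n : ℕ} (e : VertexPair n) : ℝ := if e.1.1 = e.1.2 then 1 else 2

lemma sum_sum_eq_sum_vertexPair {n : ℕ} (f : Fin n → Fin n → ℝ) (hf : ∀ i j, f i j = f j i) :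
    ∑ i, ∑ j, f i j = ∑ e : VertexPair n, multiplicity e * f e.1.1 e.1.2 := by
  have h1 : ∀ g : Fin n × Fin n → ℝ,
      ∑ e : VertexPair n, g e.1 = ∑ q : Fin n × Fin n, if q.1 ≤ q.2 then g q else 0 := by
    intro g
    rw [← Finset.sum_filter]
    exact (Finset.sum_subtype _ (by simp) g).symm
  have h2 := h1 fun q => (if q.1 = q.2 then 1 else 2) * f q.1 q.2
  simp only [multiplicity]
  rw [h2, Fintype.sum_prod_type]
  have h3 : ∑ i, ∑ j, (if i < j then f i j else 0) = ∑ i, ∑ j, (if j < i then f i j else 0) := by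
    rw [Finset.sum_comm]
    refine Finset.sum_congr rfl fun i _ => Finset.sum_congr rfl fun j _ => ?_
    rw [hf]
  have h4 : ∀ i j, f i j = (if i ≤ j then (if i = j then 1 else 2) * f i j else 0)
      - (if i < j then f i j else 0) + (if j < i then f i j else 0) := by
    intro i j
    rcases lt_trichotomy i j with h | h | h
    · simp [h, h.le, h.ne, h.not_gt]; ring
    · simp [h]
    · simp [h, h.not_ge, h.not_gt]
  calc ∑ i, ∑ j, f i j = ∑ i, ∑ j, ((if i ≤ j then (if i = j then 1 else 2) * f i j else 0)
      - (if i < j then f i j else 0) + (if j < i then f i j else 0)) :=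
        Finset.sum_congr rfl fun i _ => Finset.sum_congr rfl fun j _ => h4 i j
    _ = _ := by
        simp only [Finset.sum_add_distrib, Finset.sum_sub_distrib]
        rw [h3]; ring

/-- Sub-Gaussian bound for linear statistics of the noise matrix. -/
lemma sum_likelihood_mul_exp_noise_le {n d : ℕ} {x : Fin n → EuclideanSpace ℝ (Fin d)}
    (hx : ∀ i, x i ∈ latentSpace d) {M : Matrix (Fin n) (Fin n) ℝ} (hM : Mᵀ = M) :
    ∑ Y, likelihood Y x * Real.exp (∑ i, ∑ j, M i j * noise x Y i j) ≤ Real.exp (‖M‖ ^ 2) := by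
  have hMs : ∀ i j, M i j = M j i := fun i j => congrFun (congrFun hM j) i
  have hNs : ∀ Y i j, noise x Y i j = noise x Y j i :=
    fun Y i j => congrFun (congrFun (noise_transpose x Y) j) i
  have h1 : ∀ Y : Adjacency n, ∑ i, ∑ j, M i j * noise x Y i j =
      ∑ e : VertexPair n, (multiplicity e * M e.1.1 e.1.2) *
        ((if Y e then (1 : ℝ) else 0) - edgeProb x e) := by
    intro Y
    rw [sum_sum_eq_sum_vertexPair _ fun i j => by rw [hMs, hNs]]
    refine Finset.sum_congr rfl fun e _ => ?_
    rw [noise_apply_pair, mul_assoc]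
  simp only [h1]
  refine (sum_likelihood_mul_exp_le hx _).trans (Real.exp_le_exp.2 ?_)
  rw [frobenius_sq_eq_sum, sum_sum_eq_sum_vertexPair _ fun i j => by rw [hMs]]
  refine Finset.sum_le_sum fun e _ => ?_
  unfold multiplicity
  split_ifs <;> nlinarith [sq_nonneg (M e.1.1 e.1.2)]

/-! ### The operator norm of the noise -/

/-- The quadratic form `u ↦ uᵀ E u`. The operator norm of a symmetric `E` is the largest absolute
value of this form on the unit sphere. -/
def quadForm {n : ℕ} (E : Matrix (Fin n) (Fin n) ℝ) (u : EuclideanSpace ℝ (Fin n)) : ℝ :=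
  ∑ i, ∑ j, u i * u j * E i j

lemma continuous_quadForm {n : ℕ} (E : Matrix (Fin n) (Fin n) ℝ) : Continuous (quadForm E) := by
  unfold quadForm; fun_prop

lemma quadForm_smul {n : ℕ} (E : Matrix (Fin n) (Fin n) ℝ) (c : ℝ) (u : EuclideanSpace ℝ (Fin n)) :
    quadForm E (c • u) = c ^ 2 * quadForm E u := by
  simp only [quadForm, Finset.mul_sum, PiLp.smul_apply, smul_eq_mul]
  exact Finset.sum_congr rfl fun i _ => Finset.sum_congr rfl fun j _ => by ring

/-- Polarization with the vectors scaled as `v` and `8 w`: this is balanced when `‖w‖ ≤ ‖v‖ / 8`. -/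
lemma quadForm_add {n : ℕ} (E : Matrix (Fin n) (Fin n) ℝ) (v w : EuclideanSpace ℝ (Fin n)) :
    quadForm E (v + w) = quadForm E v + quadForm E w +
      1 / 16 * (quadForm E (v + (8 : ℝ) • w) - quadForm E (v - (8 : ℝ) • w)) := by
  simp only [quadForm, Finset.mul_sum, ← Finset.sum_add_distrib, ← Finset.sum_sub_distrib,
    PiLp.add_apply, PiLp.sub_apply, PiLp.smul_apply, smul_eq_mul]
  exact Finset.sum_congr rfl fun i _ => Finset.sum_congr rfl fun j _ => by ring

/-- A quadratic form which is large somewhere is large on a ball around a maximizer on the unit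
sphere. -/
lemma exists_ball_le_abs_quadForm {n : ℕ} (E : Matrix (Fin n) (Fin n) ℝ) {t : ℝ}
    {u : EuclideanSpace ℝ (Fin n)} (hu : t * ‖u‖ ^ 2 < |quadForm E u|) :
    ∃ v : EuclideanSpace ℝ (Fin n), ‖v‖ = 1 ∧
      ∀ w ∈ Metric.ball v (1 / 8), t / 2 ≤ |quadForm E w| := by
  have hu0 : u ≠ 0 := by
    rintro rfl
    simp [quadForm] at hu
  have hn : 0 < ‖u‖ := norm_pos_iff.2 hu0
  obtain ⟨v, hv, hmax⟩ := (isCompact_sphere (0 : EuclideanSpace ℝ (Fin n)) 1).exists_isMaxOn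
    ⟨‖u‖⁻¹ • u, by simp [norm_smul, hn.ne']⟩ (continuous_quadForm E).abs.continuousOn
  have hv1 : ‖v‖ = 1 := by simpa using hv
  set s := |quadForm E v| with hs
  have hall : ∀ w, |quadForm E w| ≤ s * ‖w‖ ^ 2 := by
    intro w
    rcases eq_or_ne w 0 with rfl | hw
    · simp [quadForm]
    have hwn : 0 < ‖w‖ := norm_pos_iff.2 hw
    have h1 : |quadForm E (‖w‖⁻¹ • w)| ≤ s := hmax (by simp [norm_smul, hwn.ne'])
    rw [quadForm_smul, abs_mul, abs_of_nonneg (by positivity), inv_pow,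
      inv_mul_le_iff₀ (by positivity)] at h1
    linarith
  have hts : t ≤ s := by
    have := hu.trans_le (hall u)
    exact (lt_of_mul_lt_mul_right this (by positivity)).le
  refine ⟨v, hv1, fun w hw => ?_⟩
  have hs0 : 0 ≤ s := abs_nonneg _
  obtain ⟨z, rfl⟩ : ∃ z, w = v + z := ⟨w - v, by abel⟩
  have hz : ‖z‖ < 1 / 8 := by simpa [Metric.mem_ball, dist_eq_norm] using hw
  have hz2 : ‖z‖ ^ 2 ≤ 1 / 64 := by nlinarith [norm_nonneg z]
  have h8 : ‖v + (8 : ℝ) • z‖ ^ 2 + ‖v - (8 : ℝ) • z‖ ^ 2 ≤ 4 := by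
    have := parallelogram_law_with_norm ℝ v ((8 : ℝ) • z)
    rw [norm_smul, hv1] at this
    norm_num at this
    nlinarith
  have a1 := hall (v + (8 : ℝ) • z)
  have a2 := hall (v - (8 : ℝ) • z)
  have a3 := hall z
  rw [quadForm_add]
  set a := quadForm E (v + (8 : ℝ) • z)
  set b := quadForm E (v - (8 : ℝ) • z)
  set c := quadForm E z
  have b1 : |a| + |b| ≤ s * 4 := by nlinarith
  have b3 : |c| ≤ s / 64 := by nlinarith
  have b4 : s ≤ |quadForm E v + c + 1 / 16 * (a - b)| + |c| + 1 / 16 * (|a| + |b|) := by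
    rw [hs]
    have e : quadForm E v = (quadForm E v + c + 1 / 16 * (a - b)) - c - 1 / 16 * (a - b) := by ring
    conv_lhs => rw [e]
    refine (abs_sub _ _).trans ?_
    rw [abs_mul, abs_of_pos (show (0:ℝ) < 1 / 16 by norm_num)]
    linarith [abs_sub (quadForm E v + c + 1 / 16 * (a - b)) c, abs_sub a b]
  linarith

/-- The event that the operator norm of the noise matrix is at most `t`. -/
def smallNoise {n d : ℕ} (x : Fin n → EuclideanSpace ℝ (Fin d)) (t : ℝ) : Set (Adjacency n) :=
  {Y | ∀ u, |quadForm (noise x Y) u| ≤ t * ‖u‖ ^ 2}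

lemma sum_likelihood_mul_exp_quadForm_le {n d : ℕ} {x : Fin n → EuclideanSpace ℝ (Fin d)}
    (hx : ∀ i, x i ∈ latentSpace d) (b : ℝ) (w : EuclideanSpace ℝ (Fin n)) :
    ∑ Y, likelihood Y x * Real.exp (b * quadForm (noise x Y) w) ≤ Real.exp (b ^ 2 * ‖w‖ ^ 4) := by
  let M : Matrix (Fin n) (Fin n) ℝ := Matrix.of fun i j => b * (w i * w j)
  have hM : Mᵀ = M := by ext i j; simp [M, mul_comm]
  have h := sum_likelihood_mul_exp_noise_le hx hM
  have hn : ‖M‖ ^ 2 = b ^ 2 * ‖w‖ ^ 4 := by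
    rw [frobenius_sq_eq_sum, show ‖w‖ ^ 4 = (‖w‖ ^ 2) * (‖w‖ ^ 2) by ring,
      EuclideanSpace.real_norm_sq_eq, Finset.sum_mul_sum, Finset.mul_sum]
    refine Finset.sum_congr rfl fun i _ => ?_
    rw [Finset.mul_sum]
    exact Finset.sum_congr rfl fun j _ => by simp [M]; ring
  rw [hn] at h
  refine le_trans (le_of_eq (Finset.sum_congr rfl fun Y _ => ?_)) h
  congr 2
  simp only [quadForm, Finset.mul_sum]
  exact Finset.sum_congr rfl fun i _ => Finset.sum_congr rfl fun j _ => by simp [M]; ring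

/-- The operator norm of the noise matrix is of order `√n` up to an exponentially small
probability. In place of a union bound over a net, the proof integrates the exponential moment of
the quadratic form over the ball of radius `2`: if the norm is large, then the integrand is large
on a ball of radius `1 / 8`, whose volume is smaller by the factor `16 ^ n` only. -/
lemma sum_likelihood_not_smallNoise_le {n d : ℕ} {x : Fin n → EuclideanSpace ℝ (Fin d)}
    (hx : ∀ i, x i ∈ latentSpace d) (K : ℝ) [DecidablePred (· ∈ smallNoise x (K * √n))] :
    ∑ Y, (if Y ∈ smallNoise x (K * √n) then 0 else likelihood Y x) ≤
      2 * Real.exp ((4 - K / 8) * n) := by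
  -- the exponent `b` makes `b ^ 2 ‖w‖ ^ 4 ≤ n` on the ball of radius `2`
  set b := √(n : ℝ) / 4 with hb
  have hb0 : 0 ≤ b := by positivity
  have hsq : √(n : ℝ) * √n = n := Real.mul_self_sqrt (Nat.cast_nonneg n)
  let F := EuclideanSpace ℝ (Fin n)
  let f : Adjacency n → F → ℝ := fun Y w =>
    Real.exp (b * quadForm (noise x Y) w) + Real.exp (-b * quadForm (noise x Y) w)
  have hfc : ∀ Y, Continuous (f Y) := fun Y => by
    have := continuous_quadForm (noise x Y)
    fun_prop
  have hf0 : ∀ Y w, 0 ≤ f Y w := fun Y w => by positivity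
  have hfi : ∀ Y, IntegrableOn (f Y) (Metric.closedBall 0 2) volume := fun Y =>
    (hfc Y).continuousOn.integrableOn_compact (isCompact_closedBall _ _)
  set ω := (volume : Measure F).real (Metric.ball 0 1) with hω
  have hω0 : 0 < ω := by
    refine ENNReal.toReal_pos (Metric.measure_ball_pos _ _ one_pos).ne' measure_ball_lt_top.ne
  have hfin : Module.finrank ℝ F = n := by simp [F]
  -- on the bad event the exponential moment is large on a small ball
  have hlow : ∀ Y, Y ∉ smallNoise x (K * √n) →
      (1 / 8) ^ n * ω * Real.exp (K * n / 8) ≤ ∫ w in Metric.closedBall (0 : F) 2, f Y w := by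
    intro Y hY
    simp only [smallNoise, Set.mem_ofPred_eq, not_forall, not_le] at hY
    obtain ⟨u, hu⟩ := hY
    obtain ⟨v, hv, hball⟩ := exists_ball_le_abs_quadForm _ hu
    have hsub : Metric.ball v (1 / 8) ⊆ Metric.closedBall (0 : F) 2 := by
      intro w hw
      rw [Metric.mem_ball, dist_eq_norm] at hw
      rw [mem_closedBall_zero_iff]
      have := norm_le_norm_add_norm_sub' w v
      linarith
    have hvol : (volume : Measure F).real (Metric.ball v (1 / 8)) = (1 / 8) ^ n * ω := by
      rw [measureReal_def, Measure.addHaar_ball_of_pos _ _ (by norm_num), ENNReal.toReal_mul, hfin,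
        ENNReal.toReal_ofReal (by positivity)]
      rfl
    calc (1 / 8) ^ n * ω * Real.exp (K * n / 8)
        = ∫ w in Metric.ball v (1 / 8), Real.exp (K * n / 8) := by
          rw [setIntegral_const, hvol, smul_eq_mul]
      _ ≤ ∫ w in Metric.ball v (1 / 8), f Y w := by
          refine setIntegral_mono_on (integrableOn_const measure_ball_lt_top.ne)
            ((hfi Y).mono_set hsub) measurableSet_ball fun w hw => ?_
          have h1 := hball w hw
          have h2 : K * n / 8 ≤ b * |quadForm (noise x Y) w| := by
            calc K * n / 8 = b * (K * √n / 2) := by rw [hb]; linear_combination (-K / 8) * hsq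
              _ ≤ _ := mul_le_mul_of_nonneg_left h1 hb0
          rcases abs_cases (quadForm (noise x Y) w) with ⟨h3, -⟩ | ⟨h3, -⟩
          · rw [h3] at h2
            have := Real.exp_le_exp.2 h2
            have h4 := Real.exp_pos (-b * quadForm (noise x Y) w)
            simp only [f]; linarith
          · rw [h3, mul_neg, ← neg_mul] at h2
            have := Real.exp_le_exp.2 h2
            have h4 := Real.exp_pos (b * quadForm (noise x Y) w)
            simp only [f]; linarith
      _ ≤ _ := setIntegral_mono_set (hfi Y) (ae_of_all _ (hf0 Y)) (ae_of_all _ hsub)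
  have hup : ∑ Y, likelihood Y x * ∫ w in Metric.closedBall (0 : F) 2, f Y w ≤
      2 ^ n * ω * (2 * Real.exp n) := by
    have hvol : (volume : Measure F).real (Metric.closedBall 0 2) = 2 ^ n * ω := by
      rw [measureReal_def, Measure.addHaar_closedBall _ _ (by norm_num), ENNReal.toReal_mul, hfin,
        ENNReal.toReal_ofReal (by positivity)]
      rfl
    calc _ = ∫ w in Metric.closedBall (0 : F) 2, ∑ Y, likelihood Y x * f Y w := by
          rw [integral_finsetSum _ fun Y _ => (hfi Y).const_mul _]
          simp only [integral_const_mul]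
      _ ≤ ∫ w in Metric.closedBall (0 : F) 2, 2 * Real.exp n := by
          refine setIntegral_mono_on (integrable_finsetSum _ fun Y _ => (hfi Y).const_mul _)
            (integrableOn_const measure_closedBall_lt_top.ne) measurableSet_closedBall
            fun w hw => ?_
          have hw2 : ‖w‖ ≤ 2 := by simpa using hw
          have hw4 : b ^ 2 * ‖w‖ ^ 4 ≤ n := by
            have h1 : ‖w‖ ^ 4 ≤ 2 ^ 4 := pow_le_pow_left₀ (norm_nonneg _) hw2 4
            have h2 : b ^ 2 = n / 16 := by rw [hb]; nlinarith
            rw [h2]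
            have : (0:ℝ) ≤ n := Nat.cast_nonneg n
            nlinarith
          have h1 := sum_likelihood_mul_exp_quadForm_le hx b w
          have h2 := sum_likelihood_mul_exp_quadForm_le hx (-b) w
          rw [neg_sq] at h2
          have h3 := Real.exp_le_exp.2 hw4
          simp only [f, mul_add, Finset.sum_add_distrib]
          linarith
      _ = _ := by rw [setIntegral_const, hvol, smul_eq_mul]
  have hmain : (∑ Y, (if Y ∈ smallNoise x (K * √n) then 0 else likelihood Y x)) *
      ((1 / 8) ^ n * ω * Real.exp (K * n / 8)) ≤ 2 ^ n * ω * (2 * Real.exp n) := by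
    refine le_trans ?_ hup
    rw [Finset.sum_mul]
    refine Finset.sum_le_sum fun Y _ => ?_
    split_ifs with h
    · rw [zero_mul]
      exact mul_nonneg (likelihood_nonneg hx Y) (integral_nonneg fun w => hf0 Y w)
    · exact mul_le_mul_of_nonneg_left (hlow Y h) (likelihood_nonneg hx Y)
  have h16 : (2:ℝ) ^ n ≤ (1 / 8) ^ n * Real.exp (3 * n) := by
    have h1 : (16:ℝ) ≤ Real.exp 3 := by
      have h2 := Real.exp_one_gt_d9
      rw [show (3:ℝ) = (3:ℕ) * 1 by norm_num, Real.exp_nat_mul]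
      calc (16:ℝ) ≤ 2.7 ^ 3 := by norm_num
        _ ≤ _ := pow_le_pow_left₀ (by norm_num) (by linarith) 3
    rw [mul_comm (3:ℝ), Real.exp_nat_mul, ← mul_pow]
    exact pow_le_pow_left₀ (by norm_num) (by linarith) n
  have hpos : 0 < (1 / 8 : ℝ) ^ n * ω * Real.exp (K * n / 8) := by positivity
  refine le_of_mul_le_mul_right (hmain.trans ?_) hpos
  have e1 : 2 * Real.exp ((4 - K / 8) * n) * ((1 / 8) ^ n * ω * Real.exp (K * n / 8)) =
      ((1 / 8) ^ n * Real.exp (3 * n)) * ω * (2 * Real.exp n) := by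
    have : Real.exp ((4 - K / 8) * n) * Real.exp (K * n / 8) = Real.exp (3 * n) * Real.exp n := by
      rw [← Real.exp_add, ← Real.exp_add]; congr 1; ring
    linear_combination 2 * (1 / 8) ^ n * ω * this
  rw [e1]
  gcongr

/-! ### The small noise event as a test -/

lemma frobenius_latentMatrix_sq_le {n d : ℕ} {x : Fin n → EuclideanSpace ℝ (Fin d)}
    (hx : ∀ i, x i ∈ latentSpace d) : ‖latentMatrix x‖ ^ 2 ≤ n := by
  rw [frobenius_sq_eq_sum]
  calc _ = ∑ i, ‖x i‖ ^ 2 := by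
        refine Finset.sum_congr rfl fun i _ => ?_
        rw [EuclideanSpace.real_norm_sq_eq]; rfl
    _ ≤ ∑ _i : Fin n, (1 : ℝ) :=
        Finset.sum_le_sum fun i _ => pow_le_one₀ (norm_nonneg _) (hx i).1
    _ = n := by simp

lemma frobenius_gram_sub_gram_le {n d : ℕ} {x y : Fin n → EuclideanSpace ℝ (Fin d)}
    (hx : ∀ i, x i ∈ latentSpace d) (hy : ∀ i, y i ∈ latentSpace d) :
    ‖latentMatrix x * (latentMatrix x)ᵀ - latentMatrix y * (latentMatrix y)ᵀ‖ ^ 2 ≤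
      (n : ℝ) ^ 2 := by
  rw [frobenius_sq_eq_sum]
  calc _ ≤ ∑ _i : Fin n, ∑ _j : Fin n, (1 : ℝ) := by
        refine Finset.sum_le_sum fun i _ => Finset.sum_le_sum fun j _ => ?_
        rw [Matrix.sub_apply, latentMatrix_mul_transpose_apply, latentMatrix_mul_transpose_apply,
          sq_le_one_iff_abs_le_one, abs_le]
        have h1 := inner_nonneg_of_mem_latentSpace (hx i) (hx j)
        have h2 := inner_nonneg_of_mem_latentSpace (hy i) (hy j)
        have h3 := inner_le_one_of_mem_latentSpace (hx i) (hx j)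
        have h4 := inner_le_one_of_mem_latentSpace (hy i) (hy j)
        constructor <;> linarith
    _ = (n : ℝ) ^ 2 := by simp [sq]

/-- A difference of Gram matrices pairs with a matrix of small quadratic form like a matrix of low
rank, namely through the operator norm of that matrix and `‖X - R‖ ‖X + R‖`. The proof is
polarization in each of the `d` columns, with a free scale `τ` between the two factors. -/
lemma sum_gram_sub_gram_mul_le {n d : ℕ} (X R : Matrix (Fin n) (Fin d) ℝ)
    {E : Matrix (Fin n) (Fin n) ℝ} {t τ : ℝ} (hτ : 0 < τ)
    (hE : ∀ u, |quadForm E u| ≤ t * ‖u‖ ^ 2) :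
    ∑ i, ∑ j, (X * Xᵀ - R * Rᵀ) i j * E i j ≤
      t / 2 * (τ * ‖X - R‖ ^ 2 + ‖X + R‖ ^ 2 / τ) := by
  let s := √τ
  have hs : 0 < s := Real.sqrt_pos.2 hτ
  have hss : s ^ 2 = τ := Real.sq_sqrt hτ.le
  let p : Fin d → EuclideanSpace ℝ (Fin n) := fun k =>
    WithLp.toLp 2 fun i => s * (X - R) i k + s⁻¹ * (X + R) i k
  let m : Fin d → EuclideanSpace ℝ (Fin n) := fun k =>
    WithLp.toLp 2 fun i => s * (X - R) i k - s⁻¹ * (X + R) i k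
  have h1 : ∑ i, ∑ j, (X * Xᵀ - R * Rᵀ) i j * E i j =
      ∑ k, 1 / 4 * (quadForm E (p k) - quadForm E (m k)) := by
    simp only [quadForm, Matrix.sub_apply, Matrix.mul_apply, Matrix.transpose_apply,
      ← Finset.sum_sub_distrib, Finset.mul_sum, Finset.sum_mul]
    conv_rhs => rw [Finset.sum_comm]
    refine Finset.sum_congr rfl fun i _ => ?_
    conv_rhs => rw [Finset.sum_comm]
    refine Finset.sum_congr rfl fun j _ => Finset.sum_congr rfl fun k _ => ?_
    simp only [p, m, Matrix.sub_apply, Matrix.add_apply]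
    field_simp
    ring
  have h2 : ∀ k, ‖p k‖ ^ 2 + ‖m k‖ ^ 2 =
      ∑ i, 2 * (τ * (X - R) i k ^ 2 + (X + R) i k ^ 2 / τ) := by
    intro k
    rw [EuclideanSpace.real_norm_sq_eq, EuclideanSpace.real_norm_sq_eq, ← Finset.sum_add_distrib]
    refine Finset.sum_congr rfl fun i _ => ?_
    simp only [p, m]
    rw [← hss]
    field_simp
    ring
  have h3 : ∑ k, (‖p k‖ ^ 2 + ‖m k‖ ^ 2) = 2 * (τ * ‖X - R‖ ^ 2 + ‖X + R‖ ^ 2 / τ) := by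
    simp only [h2]
    rw [frobenius_sq_eq_sum, frobenius_sq_eq_sum, Finset.sum_comm, Finset.mul_sum, Finset.sum_div,
      ← Finset.sum_add_distrib, Finset.mul_sum]
    refine Finset.sum_congr rfl fun i _ => ?_
    rw [Finset.mul_sum, Finset.sum_div, ← Finset.sum_add_distrib, Finset.mul_sum]
  rw [h1]
  calc _ ≤ ∑ k, t / 4 * (‖p k‖ ^ 2 + ‖m k‖ ^ 2) := by
        refine Finset.sum_le_sum fun k _ => ?_
        have a1 := (abs_le.1 (hE (p k))).2
        have a2 := (abs_le.1 (hE (m k))).1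
        linarith
    _ = _ := by rw [← Finset.mul_sum, h3]; ring

/-- On the event of small noise at the truth, the linear statistic in the direction of the
difference of two edge probability matrices is dominated by half its squared length. -/
lemma sum_mul_noise_le_half {n d : ℕ} (hn : 0 < n) {x x₀ : Fin n → EuclideanSpace ℝ (Fin d)}
    (hx : ∀ i, x i ∈ latentSpace d) (hx₀ : ∀ i, x₀ i ∈ latentSpace d) {μ K : ℝ} (hμ : 0 < μ)
    (hK : 0 < K) (hX₀ : ∀ w : Fin d → ℝ,
      n * μ * (w ⬝ᵥ w) ≤ (latentMatrix x₀ *ᵥ w) ⬝ᵥ (latentMatrix x₀ *ᵥ w))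
    (hfar : 20 * K ^ 2 / μ * n ≤
      ‖latentMatrix x * (latentMatrix x)ᵀ - latentMatrix x₀ * (latentMatrix x₀)ᵀ‖ ^ 2)
    {Y : Adjacency n} (hY : Y ∈ smallNoise x₀ (K * √n)) :
    ∑ i, ∑ j, (latentMatrix x * (latentMatrix x)ᵀ - latentMatrix x₀ * (latentMatrix x₀)ᵀ) i j *
      noise x₀ Y i j ≤
      ‖latentMatrix x * (latentMatrix x)ᵀ - latentMatrix x₀ * (latentMatrix x₀)ᵀ‖ ^ 2 / 2 := by
  obtain ⟨W, hW, hle⟩ := exists_orthogonal_frobenius_sub_le (latentMatrix x) (latentMatrix x₀) hX₀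
  have hWW : Wᵀ * W = 1 := (Matrix.mem_orthogonalGroup_iff' _ _).1 hW
  have hWW' : W * Wᵀ = 1 := (Matrix.mem_orthogonalGroup_iff _ _).1 hW
  set X := latentMatrix x
  set X₀ := latentMatrix x₀
  set R := X₀ * W with hR
  have hRR : R * Rᵀ = X₀ * X₀ᵀ := by
    rw [hR, Matrix.transpose_mul]
    calc X₀ * W * (Wᵀ * X₀ᵀ) = X₀ * (W * Wᵀ) * X₀ᵀ := by simp only [Matrix.mul_assoc]
      _ = _ := by rw [hWW', Matrix.mul_one]
  rw [← hRR] at hfar hle ⊢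
  set D := ‖X * Xᵀ - R * Rᵀ‖ ^ 2
  have hn' : (0 : ℝ) < n := Nat.cast_pos.2 hn
  have hr : (0 : ℝ) < √n := Real.sqrt_pos.2 hn'
  have hrr : √(n : ℝ) ^ 2 = n := Real.sq_sqrt hn'.le
  have hsum : ‖X + R‖ ^ 2 ≤ 4 * n := by
    have a1 : ‖X‖ ^ 2 ≤ n := frobenius_latentMatrix_sq_le hx
    have a2 : ‖R‖ ≤ ‖X₀‖ := frobenius_mul_orthonormal_le hWW X₀
    have a3 : ‖X₀‖ ^ 2 ≤ n := frobenius_latentMatrix_sq_le hx₀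
    have a4 := norm_add_le X R
    have a5 := pow_le_pow_left₀ (norm_nonneg _) a4 2
    have a6 := pow_le_pow_left₀ (norm_nonneg _) a2 2
    nlinarith [sq_nonneg (‖X‖ - ‖R‖)]
  -- the scale `τ` balances the two terms
  have h := sum_gram_sub_gram_mul_le X R (t := K * √n) (τ := 2 * μ / (5 * K) * √n)
    (by positivity) hY
  refine h.trans ?_
  have e1 : K * √n / 2 * (2 * μ / (5 * K) * √n * ‖X - R‖ ^ 2) =
      (4 / 5 * (n * μ) * ‖X - R‖ ^ 2) / 4 := by
    have c : K * (2 * μ / (5 * K)) = 2 * μ / 5 := by field_simp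
    linear_combination (√n ^ 2 * ‖X - R‖ ^ 2 / 2) * c + μ / 5 * ‖X - R‖ ^ 2 * hrr
  have e2 : K * √n / 2 * (‖X + R‖ ^ 2 / (2 * μ / (5 * K) * √n)) =
      5 * K ^ 2 / (4 * μ) * ‖X + R‖ ^ 2 := by
    field_simp
    ring
  have e3 : 5 * K ^ 2 / (4 * μ) * ‖X + R‖ ^ 2 ≤ 5 * K ^ 2 / (4 * μ) * (4 * n) :=
    mul_le_mul_of_nonneg_left hsum (by positivity)
  have e4 : 5 * K ^ 2 / (4 * μ) * (4 * n) = (20 * K ^ 2 / μ * n) / 4 := by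
    field_simp; ring
  rw [mul_add, e1, e2]
  linarith

/-- The event of small noise at the truth `x₀` is improbable under every configuration `x` far from
`x₀`. The linear statistic `∑ M_ij (Y - X₀ X₀ᵀ)_ij` in the direction `M = X Xᵀ - X₀ X₀ᵀ` has mean
`‖M‖²` under `x`, but is at most `‖M‖² / 2` on the event. -/
lemma sum_likelihood_smallNoise_le {n d : ℕ} (hn : 0 < n) {x x₀ : Fin n → EuclideanSpace ℝ (Fin d)}
    (hx : ∀ i, x i ∈ latentSpace d) (hx₀ : ∀ i, x₀ i ∈ latentSpace d) {μ K : ℝ} (hμ : 0 < μ)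
    (hK : 0 < K) (hX₀ : ∀ w : Fin d → ℝ,
      n * μ * (w ⬝ᵥ w) ≤ (latentMatrix x₀ *ᵥ w) ⬝ᵥ (latentMatrix x₀ *ᵥ w))
    (hfar : 20 * K ^ 2 / μ * n ≤
      ‖latentMatrix x * (latentMatrix x)ᵀ - latentMatrix x₀ * (latentMatrix x₀)ᵀ‖ ^ 2)
    [DecidablePred (· ∈ smallNoise x₀ (K * √n))] :
    ∑ Y, (if Y ∈ smallNoise x₀ (K * √n) then likelihood Y x else 0) ≤
      Real.exp (-(‖latentMatrix x * (latentMatrix x)ᵀ -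
        latentMatrix x₀ * (latentMatrix x₀)ᵀ‖ ^ 2 / 16)) := by
  set M := latentMatrix x * (latentMatrix x)ᵀ - latentMatrix x₀ * (latentMatrix x₀)ᵀ with hM
  -- Chernoff's bound, where the factor `1 / 4` minimizes `c ^ 2 - c / 2`
  have hMt : (-(1 / 4 : ℝ) • M)ᵀ = -(1 / 4 : ℝ) • M := by
    rw [Matrix.transpose_smul, hM]; simp
  have h := sum_likelihood_mul_exp_noise_le hx hMt
  have hnorm : ‖-(1 / 4 : ℝ) • M‖ ^ 2 = ‖M‖ ^ 2 / 16 := by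
    rw [norm_smul, mul_pow, Real.norm_eq_abs, sq_abs]; ring
  rw [hnorm] at h
  have hpt : ∀ Y, (if Y ∈ smallNoise x₀ (K * √n) then likelihood Y x else 0) ≤
      Real.exp (-(‖M‖ ^ 2 / 8)) * (likelihood Y x *
        Real.exp (∑ i, ∑ j, (-(1 / 4 : ℝ) • M) i j * noise x Y i j)) := by
    intro Y
    have hL := likelihood_nonneg hx Y
    split_ifs with hY
    · have h1 := sum_mul_noise_le_half hn hx hx₀ hμ hK hX₀ hfar hY
      rw [← hM] at h1
      have h2 : ∑ i, ∑ j, (-(1 / 4 : ℝ) • M) i j * noise x Y i j =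
          -(1 / 4) * (∑ i, ∑ j, M i j * noise x₀ Y i j - ‖M‖ ^ 2) := by
        rw [frobenius_sq_eq_sum, ← Finset.sum_sub_distrib, Finset.mul_sum]
        refine Finset.sum_congr rfl fun i _ => ?_
        rw [← Finset.sum_sub_distrib, Finset.mul_sum]
        refine Finset.sum_congr rfl fun j _ => ?_
        have : noise x Y i j = noise x₀ Y i j - M i j := by
          simp only [noise, hM, Matrix.sub_apply]; ring
        rw [this, Matrix.smul_apply, smul_eq_mul]; ring
      have h3 : 1 ≤ Real.exp (-(‖M‖ ^ 2 / 8)) *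
          Real.exp (∑ i, ∑ j, (-(1 / 4 : ℝ) • M) i j * noise x Y i j) := by
        rw [← Real.exp_add, Real.one_le_exp_iff, h2]
        linarith
      nlinarith
    · positivity
  calc _ ≤ _ := Finset.sum_le_sum fun Y _ => hpt Y
    _ ≤ Real.exp (-(‖M‖ ^ 2 / 8)) * Real.exp (‖M‖ ^ 2 / 16) := by
        rw [← Finset.mul_sum]
        exact mul_le_mul_of_nonneg_left h (Real.exp_pos _).le
    _ = _ := by rw [← Real.exp_add]; congr 1; ring

/-! ### Gaussian integrals over configurations -/

/-- The action of a square matrix on the rows of a configuration. -/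
def rowMap {n : ℕ} (d : ℕ) (V : Matrix (Fin n) (Fin n) ℝ) :
    (Fin n → EuclideanSpace ℝ (Fin d)) →ₗ[ℝ] (Fin n → EuclideanSpace ℝ (Fin d)) :=
  LinearMap.pi fun i => ∑ j, V i j • LinearMap.proj j

lemma latentMatrix_rowMap {n d : ℕ} (V : Matrix (Fin n) (Fin n) ℝ)
    (x : Fin n → EuclideanSpace ℝ (Fin d)) :
    latentMatrix (rowMap d V x) = V * latentMatrix x := by
  ext i k
  simp [latentMatrix, rowMap, Matrix.mul_apply]

lemma sum_norm_sq_eq {n d : ℕ} (x : Fin n → EuclideanSpace ℝ (Fin d)) :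
    ∑ i, ‖x i‖ ^ 2 = ‖latentMatrix x‖ ^ 2 := by
  rw [frobenius_sq_eq_sum]
  refine Finset.sum_congr rfl fun i _ => ?_
  rw [EuclideanSpace.real_norm_sq_eq]; rfl

lemma sum_norm_sq_rowMap {n d : ℕ} {V : Matrix (Fin n) (Fin n) ℝ} (hV : Vᵀ * V = 1)
    (x : Fin n → EuclideanSpace ℝ (Fin d)) : ∑ i, ‖rowMap d V x i‖ ^ 2 = ∑ i, ‖x i‖ ^ 2 := by
  rw [sum_norm_sq_eq, sum_norm_sq_eq, latentMatrix_rowMap, frobenius_sq_eq_trace,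
    frobenius_sq_eq_trace, Matrix.transpose_mul]
  congr 1
  calc _ = (latentMatrix x)ᵀ * (Vᵀ * V) * latentMatrix x := by simp only [Matrix.mul_assoc]
    _ = _ := by rw [hV, Matrix.mul_one]

/-- Orthogonal matrices acting on the rows preserve Lebesgue measure on configurations. The norm on
the space of configurations is a supremum over the rows, so the action is not an isometry. Instead,
the determinant has absolute value one because the action preserves a set of finite positive
volume. -/
lemma measurePreserving_rowMap {n d : ℕ} {V : Matrix (Fin n) (Fin n) ℝ} (hV : Vᵀ * V = 1) :
    MeasurePreserving (rowMap d V) := by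
  have hcont : Continuous (rowMap d V) := (rowMap d V).continuous_of_finiteDimensional
  have hinj : Function.Injective (rowMap d V) := by
    refine (injective_iff_map_eq_zero _).2 fun x hx => ?_
    have h1 := sum_norm_sq_rowMap hV x
    rw [hx] at h1
    simp only [Pi.zero_apply, norm_zero, ne_eq, OfNat.ofNat_ne_zero, not_false_eq_true, zero_pow,
      Finset.sum_const_zero] at h1
    ext1 i
    have := (Finset.sum_eq_zero_iff_of_nonneg fun i _ => by positivity).1 h1.symm i
      (Finset.mem_univ i)
    simpa using this
  have hdet : LinearMap.det (rowMap d V) ≠ 0 := by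
    exact (LinearEquiv.ofInjectiveEndo (rowMap d V) hinj).isUnit_det'.ne_zero
  -- the Euclidean unit ball of the space of configurations is invariant
  set S : Set (Fin n → EuclideanSpace ℝ (Fin d)) := {x | ∑ i, ‖x i‖ ^ 2 ≤ 1} with hSdef
  have hS : rowMap d V ⁻¹' S = S := by
    ext x
    simp only [hSdef, Set.mem_preimage, Set.mem_ofPred_eq, sum_norm_sq_rowMap hV]
  have hScont : Continuous fun x : Fin n → EuclideanSpace ℝ (Fin d) => ∑ i, ‖x i‖ ^ 2 := by fun_prop
  have hSpos : volume S ≠ 0 := by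
    have h0 : (0 : Fin n → EuclideanSpace ℝ (Fin d)) ∈
        {x : Fin n → EuclideanSpace ℝ (Fin d) | ∑ i, ‖x i‖ ^ 2 < 1} := by simp
    have hop : IsOpen {x : Fin n → EuclideanSpace ℝ (Fin d) | ∑ i, ‖x i‖ ^ 2 < 1} :=
      isOpen_lt hScont continuous_const
    have hsub : {x : Fin n → EuclideanSpace ℝ (Fin d) | ∑ i, ‖x i‖ ^ 2 < 1} ⊆ S :=
      Set.ofPred_subset_ofPred.2 fun x hx => le_of_lt hx
    exact ((hop.measure_pos volume ⟨0, h0⟩).trans_le (measure_mono hsub)).ne'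
  have hSfin : volume S ≠ ⊤ := by
    refine ((measure_mono fun x hx => ?_).trans_lt
      (measure_closedBall_lt_top (x := (0 : Fin n → EuclideanSpace ℝ (Fin d))) (r := 1))).ne
    rw [mem_closedBall_zero_iff, pi_norm_le_iff_of_nonneg zero_le_one]
    intro i
    have h1 : ‖x i‖ ^ 2 ≤ 1 := (Finset.single_le_sum (f := fun i => ‖x i‖ ^ 2)
      (fun i _ => by positivity) (Finset.mem_univ i)).trans hx
    exact (sq_le_one_iff₀ (norm_nonneg _)).1 h1
  have hpre := Measure.addHaar_preimage_linearMap
    (volume : Measure (Fin n → EuclideanSpace ℝ (Fin d))) hdet S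
  rw [hS] at hpre
  have hone : ENNReal.ofReal |(LinearMap.det (rowMap d V))⁻¹| = 1 :=
    (ENNReal.mul_left_inj hSpos hSfin).1 (by rw [one_mul]; exact hpre.symm)
  refine ⟨hcont.measurable, ?_⟩
  rw [Measure.map_linearMap_addHaar_eq_smul_addHaar volume hdet, hone, one_smul]

/-- An orthogonal projection of trace `n - d` is, up to a rotation, the projection that forgets
`d` of the coordinates. -/
lemma exists_coordinates_of_projection {n d : ℕ} {Q : Matrix (Fin n) (Fin n) ℝ} (hQ : Qᵀ = Q)
    (hQQ : Q * Q = Q) (htr : Q.trace = (n : ℝ) - d) :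
    ∃ V : Matrix (Fin n) (Fin n) ℝ, V * Vᵀ = 1 ∧ ∃ I : Finset (Fin n), I.card = d ∧
      ∀ x : Fin n → EuclideanSpace ℝ (Fin d),
        ‖Q * latentMatrix x‖ ^ 2 = ∑ i, if i ∈ I then 0 else ‖rowMap d Vᵀ x i‖ ^ 2 := by
  classical
  obtain ⟨V, hV, e, he⟩ := exists_orthogonal_diagonalization hQ
  have hVV : Vᵀ * V = 1 := (Matrix.mem_orthogonalGroup_iff' _ _).1 hV
  have hVV' : V * Vᵀ = 1 := (Matrix.mem_orthogonalGroup_iff _ _).1 hV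
  have hee : ∀ i, e i * e i = e i := by
    have h1 : Matrix.diagonal e = Vᵀ * Q * V := by
      rw [he]
      calc _ = (Vᵀ * V) * Matrix.diagonal e * (Vᵀ * V) := by rw [hVV]; simp
        _ = _ := by simp only [Matrix.mul_assoc]
    have h2 : Matrix.diagonal e * Matrix.diagonal e = Matrix.diagonal e := by
      calc _ = Vᵀ * Q * (V * Vᵀ) * Q * V := by rw [h1]; simp only [Matrix.mul_assoc]
        _ = Vᵀ * (Q * Q) * V := by rw [hVV']; simp only [Matrix.mul_assoc, Matrix.one_mul]
        _ = _ := by rw [hQQ, h1]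
    rw [Matrix.diagonal_mul_diagonal] at h2
    exact fun i => congrFun (Matrix.diagonal_injective h2) i
  have he01 : ∀ i, e i = 0 ∨ e i = 1 := fun i => by
    have : e i * (e i - 1) = 0 := by linear_combination hee i
    rcases mul_eq_zero.1 this with h | h
    · exact Or.inl h
    · exact Or.inr (by linarith)
  have hsum : ∑ i, e i = (n : ℝ) - d := by
    rw [← htr, he, Matrix.mul_assoc, Matrix.trace_mul_comm, Matrix.mul_assoc, hVV, Matrix.mul_one,
      Matrix.trace_diagonal]
  refine ⟨V, hVV', Finset.univ.filter fun i => e i = 0, ?_, fun x => ?_⟩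
  · have h1 : ∑ i, (1 - e i) = d := by
      rw [Finset.sum_sub_distrib, hsum]; simp
    have h2 : ∑ i, (1 - e i) = ∑ i, if e i = 0 then (1 : ℝ) else 0 := by
      refine Finset.sum_congr rfl fun i _ => ?_
      rcases he01 i with h | h <;> simp [h]
    rw [h2, Finset.sum_boole] at h1
    exact_mod_cast h1
  · have h1 : ‖Q * latentMatrix x‖ ^ 2 =
        ‖Matrix.diagonal e * latentMatrix (rowMap d Vᵀ x)‖ ^ 2 := by
      rw [frobenius_sq_eq_trace, frobenius_sq_eq_trace, latentMatrix_rowMap, Matrix.transpose_mul,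
        Matrix.transpose_mul, Matrix.transpose_mul, hQ, Matrix.diagonal_transpose,
        Matrix.transpose_transpose]
      congr 1
      calc _ = (latentMatrix x)ᵀ * Q * latentMatrix x := by
            rw [Matrix.mul_assoc, ← Matrix.mul_assoc Q, hQQ]; simp only [Matrix.mul_assoc]
        _ = (latentMatrix x)ᵀ * (V * (Matrix.diagonal e * Matrix.diagonal e) * Vᵀ) *
              latentMatrix x := by
            rw [Matrix.diagonal_mul_diagonal, funext hee, ← he]
        _ = _ := by simp only [Matrix.mul_assoc]
    rw [h1, frobenius_sq_eq_sum]
    refine Finset.sum_congr rfl fun i _ => ?_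
    rw [EuclideanSpace.real_norm_sq_eq]
    rcases he01 i with h | h
    · simp [h, Matrix.diagonal_mul]
    · simp [h, Matrix.diagonal_mul, latentMatrix]

lemma integrable_exp_neg_mul_sq_norm {d : ℕ} {b : ℝ} (hb : 0 < b) :
    Integrable fun s : EuclideanSpace ℝ (Fin d) => Real.exp (-b * ‖s‖ ^ 2) := by
  have := (GaussianFourier.integrable_cexp_neg_mul_sq_norm_add
    (V := EuclideanSpace ℝ (Fin d)) (b := (b : ℂ)) (by simpa using hb) 0 0).norm
  refine this.congr (ae_of_all _ fun s => ?_)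
  simp only [Complex.norm_exp]
  congr 1
  simp [← Complex.ofReal_pow]

/-- A Gaussian integral over a product, where the Gaussian factors in the coordinates `i ∈ I` are
replaced by a truncation. -/
lemma setIntegral_exp_neg_sum_le {n d : ℕ} {b r : ℝ} (hb : 0 < b) (hr : 0 ≤ r)
    (I : Finset (Fin n)) :
    ∫ t in {t : Fin n → EuclideanSpace ℝ (Fin d) | ∑ i, ‖t i‖ ^ 2 ≤ r ^ 2},
      Real.exp (-(b * ∑ i, if i ∈ I then 0 else ‖t i‖ ^ 2)) ≤
    (r ^ d * (volume : Measure (EuclideanSpace ℝ (Fin d))).real (Metric.ball 0 1)) ^ I.card *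
      ((Real.pi / b) ^ ((d : ℝ) / 2)) ^ (n - I.card) := by
  classical
  let h : Fin n → EuclideanSpace ℝ (Fin d) → ℝ := fun i =>
    if i ∈ I then Set.indicator (Metric.closedBall 0 r) fun _ => 1
    else fun s => Real.exp (-b * ‖s‖ ^ 2)
  have hSm : MeasurableSet {t : Fin n → EuclideanSpace ℝ (Fin d) | ∑ i, ‖t i‖ ^ 2 ≤ r ^ 2} :=
    (isClosed_le (by fun_prop) continuous_const).measurableSet
  have h0 : ∀ i s, 0 ≤ h i s := by
    intro i s
    simp only [h]
    split_ifs
    · exact Set.indicator_nonneg (fun _ _ => zero_le_one) _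
    · positivity
  have hint : ∀ i, Integrable (h i) := by
    intro i
    simp only [h]
    split_ifs
    · exact (integrable_indicator_iff measurableSet_closedBall).2
        (integrableOn_const measure_closedBall_lt_top.ne)
    · exact integrable_exp_neg_mul_sq_norm hb
  have hpi : Integrable fun t : Fin n → EuclideanSpace ℝ (Fin d) => ∏ i, h i (t i) := by
    rw [volume_pi]
    exact Integrable.fintype_prod hint
  have hle : ∀ t : Fin n → EuclideanSpace ℝ (Fin d), ∑ i, ‖t i‖ ^ 2 ≤ r ^ 2 →
      Real.exp (-(b * ∑ i, if i ∈ I then 0 else ‖t i‖ ^ 2)) ≤ ∏ i, h i (t i) := by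
    intro t ht
    rw [Finset.mul_sum, ← Finset.sum_neg_distrib, Real.exp_sum]
    refine Finset.prod_le_prod (fun i _ => (Real.exp_pos _).le) fun i _ => ?_
    simp only [h]
    split_ifs
    · have hti : t i ∈ Metric.closedBall (0 : EuclideanSpace ℝ (Fin d)) r := by
        rw [mem_closedBall_zero_iff]
        exact (sq_le_sq₀ (norm_nonneg _) hr).1 ((Finset.single_le_sum (f := fun i => ‖t i‖ ^ 2)
          (fun i _ => by positivity) (Finset.mem_univ i)).trans ht)
      rw [Set.indicator_of_mem hti]
      simp
    · simp
  calc _ ≤ ∫ t in {t : Fin n → EuclideanSpace ℝ (Fin d) | ∑ i, ‖t i‖ ^ 2 ≤ r ^ 2},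
          ∏ i, h i (t i) := by
        refine integral_mono_of_nonneg (ae_of_all _ fun t => (Real.exp_pos _).le)
          hpi.integrableOn ?_
        filter_upwards [ae_restrict_mem hSm] with t ht
        exact hle t ht
    _ ≤ ∫ t : Fin n → EuclideanSpace ℝ (Fin d), ∏ i, h i (t i) :=
        setIntegral_le_integral hpi (ae_of_all _ fun t => Finset.prod_nonneg fun i _ => h0 i _)
    _ = ∏ i, ∫ s, h i s := integral_fintype_prod_volume_eq_prod h
    _ = ∏ i, (if i ∈ I then
        (r ^ d * (volume : Measure (EuclideanSpace ℝ (Fin d))).real (Metric.ball 0 1)) else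
        (Real.pi / b) ^ ((d : ℝ) / 2)) := by
        refine Finset.prod_congr rfl fun i _ => ?_
        simp only [h]
        split_ifs with hi
        · rw [integral_indicator measurableSet_closedBall, setIntegral_const, smul_eq_mul, mul_one,
            measureReal_def, Measure.addHaar_closedBall _ _ hr,
            ENNReal.toReal_mul, ENNReal.toReal_ofReal (by positivity)]
          simp [measureReal_def]
        · rw [GaussianFourier.integral_rexp_neg_mul_sq_norm hb]
          simp
    _ = _ := by
        rw [Finset.prod_ite, Finset.prod_const, Finset.prod_const, Finset.filter_mem_eq_inter,
          Finset.univ_inter, Finset.filter_notMem_eq_sdiff, ← Finset.compl_eq_univ_sdiff,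
          Finset.card_compl, Fintype.card_fin]

/-- A Gaussian integral over configurations, for a quadratic form that degenerates on a subspace of
dimension `d` in each column. A rotation of the rows reduces it to a product integral. -/
lemma integral_exp_neg_projection_le {n d : ℕ} {b : ℝ} (hb : 0 < b)
    {Q : Matrix (Fin n) (Fin n) ℝ} (hQ : Qᵀ = Q) (hQQ : Q * Q = Q) (htr : Q.trace = (n : ℝ) - d) :
    ∫ x in {x : Fin n → EuclideanSpace ℝ (Fin d) | ∑ i, ‖x i‖ ^ 2 ≤ √(n : ℝ) ^ 2},
      Real.exp (-(b * ‖Q * latentMatrix x‖ ^ 2)) ≤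
    (√(n : ℝ) ^ d * (volume : Measure (EuclideanSpace ℝ (Fin d))).real (Metric.ball 0 1)) ^ d *
      ((Real.pi / b) ^ ((d : ℝ) / 2)) ^ (n - d) := by
  obtain ⟨V, hV, I, hI, hquad⟩ := exists_coordinates_of_projection hQ hQQ htr
  have hV2 : (Vᵀ)ᵀ * Vᵀ = 1 := by rw [Matrix.transpose_transpose, hV]
  have hT := measurePreserving_rowMap (d := d) hV2
  have h := setIntegral_exp_neg_sum_le (d := d) hb (Real.sqrt_nonneg (n : ℝ)) I
  rw [hI] at h
  refine le_trans (le_of_eq ?_) h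
  have hSm : MeasurableSet {t : Fin n → EuclideanSpace ℝ (Fin d) | ∑ i, ‖t i‖ ^ 2 ≤ √(n : ℝ) ^ 2} :=
    (isClosed_le (by fun_prop) continuous_const).measurableSet
  have hcont : Continuous fun t : Fin n → EuclideanSpace ℝ (Fin d) =>
      Real.exp (-(b * ∑ i, if i ∈ I then 0 else ‖t i‖ ^ 2)) := by
    have : ∀ i, Continuous fun t : Fin n → EuclideanSpace ℝ (Fin d) =>
        if i ∈ I then (0 : ℝ) else ‖t i‖ ^ 2 := by
      intro i
      split_ifs <;> fun_prop
    fun_prop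
  conv_rhs => rw [← hT.map_eq]
  rw [setIntegral_map hSm (by rw [hT.map_eq]; exact hcont.aestronglyMeasurable)
    hT.measurable.aemeasurable]
  have hpre : rowMap d Vᵀ ⁻¹' {t | ∑ i, ‖t i‖ ^ 2 ≤ √(n : ℝ) ^ 2} =
      {t | ∑ i, ‖t i‖ ^ 2 ≤ √(n : ℝ) ^ 2} := by
    ext x
    simp only [Set.mem_preimage, Set.mem_ofPred_eq, sum_norm_sq_rowMap hV2]
  rw [hpre]
  simp only [hquad]

/-! ### The prior -/

section Prior

lemma pi_mono_measure {ι α : Type*} [Fintype ι] [MeasurableSpace α] {μ ν : Measure α}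
    [SigmaFinite μ] (h : μ ≤ ν) :
    Measure.pi (fun _ : ι => μ) ≤ Measure.pi fun _ : ι => ν := by
  have h1 : (Measure.pi fun _ : ι => μ).toOuterMeasure ≤
      OuterMeasure.pi fun _ : ι => ν.toOuterMeasure := by
    rw [OuterMeasure.le_pi]
    intro s _
    change Measure.pi (fun _ : ι => μ) (Set.pi Set.univ s) ≤ _
    rw [Measure.pi_pi]
    exact Finset.prod_le_prod' fun i _ => h (s i)
  refine Measure.le_iff.2 fun s hs => ?_
  rw [Measure.pi_def (fun _ : ι => ν), toMeasure_apply _ _ hs]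
  exact h1 s

variable {d : ℕ}

lemma isClosed_latentSpace : IsClosed (latentSpace d) := by
  have : latentSpace d = {x | ‖x‖ ≤ 1} ∩ ⋂ k, {x : EuclideanSpace ℝ (Fin d) | 0 ≤ x k} := by
    ext x; simp [latentSpace]
  rw [this]
  refine (isClosed_le continuous_norm continuous_const).inter (isClosed_iInter fun k => ?_)
  exact isClosed_le continuous_const (by fun_prop)

lemma measurableSet_latentSpace : MeasurableSet (latentSpace d) :=
  isClosed_latentSpace.measurableSet

lemma zero_mem_latentSpace : (0 : EuclideanSpace ℝ (Fin d)) ∈ latentSpace d := by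
  simp [latentSpace]

lemma convex_latentSpace : Convex ℝ (latentSpace d) := by
  intro x hx y hy a b ha hb hab
  refine ⟨?_, fun k => ?_⟩
  · calc ‖a • x + b • y‖ ≤ ‖a • x‖ + ‖b • y‖ := norm_add_le _ _
      _ = a * ‖x‖ + b * ‖y‖ := by
        rw [norm_smul, norm_smul, Real.norm_of_nonneg ha, Real.norm_of_nonneg hb]
      _ ≤ 1 := by nlinarith [hx.1, hy.1]
  · have := hx.2 k
    have := hy.2 k
    simp only [PiLp.add_apply, PiLp.smul_apply, smul_eq_mul]
    positivity

lemma volume_latentSpace_lt_top : volume (latentSpace d) < ⊤ :=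
  (measure_mono fun x hx => by simpa using hx.1).trans_lt
    (measure_closedBall_lt_top (x := (0 : EuclideanSpace ℝ (Fin d))) (r := 1))

variable {dens : EuclideanSpace ℝ (Fin d) → ℝ}

lemma IsPriorDensity.isProbabilityMeasure (h : IsPriorDensity dens) :
    IsProbabilityMeasure (volume.withDensity fun x => ENNReal.ofReal (dens x)) :=
  ⟨by rw [withDensity_apply _ MeasurableSet.univ, Measure.restrict_univ, h.lintegral_eq_one]⟩

lemma IsPriorDensity.isProbabilityMeasure_prior (h : IsPriorDensity dens) (n : ℕ) :
    IsProbabilityMeasure (prior dens n) := by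
  have := h.isProbabilityMeasure
  unfold prior
  infer_instance

lemma withDensity_le_restrict (h : IsPriorDensity dens) {b : ℝ}
    (hb : ∀ x ∈ latentSpace d, dens x ≤ b) :
    (volume.withDensity fun x => ENNReal.ofReal (dens x)) ≤
      ENNReal.ofReal b • volume.restrict (latentSpace d) := by
  refine Measure.le_iff.2 fun s hs => ?_
  rw [withDensity_apply _ hs, Measure.smul_apply, Measure.restrict_apply hs, smul_eq_mul]
  calc _ ≤ ∫⁻ x in s, (latentSpace d).indicator (fun _ => ENNReal.ofReal b) x := by
        refine lintegral_mono fun x => ?_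
        by_cases hx : x ∈ latentSpace d
        · rw [Set.indicator_of_mem hx]
          exact ENNReal.ofReal_le_ofReal (hb x hx)
        · rw [h.eq_zero x hx]; simp
    _ = _ := by
        rw [lintegral_indicator measurableSet_latentSpace, lintegral_const,
          Measure.restrict_restrict measurableSet_latentSpace, Measure.restrict_apply_univ,
          Set.inter_comm]

lemma volume_latentSpace_pos (h : IsPriorDensity dens) : 0 < volume (latentSpace d) := by
  obtain ⟨a, b, -, hab⟩ := h.bounded
  have h1 := withDensity_le_restrict h (fun x hx => (hab x hx).2) Set.univ
  rw [h.isProbabilityMeasure.measure_univ, Measure.smul_apply, Measure.restrict_apply_univ] at h1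
  rw [pos_iff_ne_zero]
  intro h0
  rw [h0] at h1
  simp at h1

/-- The configurations whose rows are latent positions. -/
def configSpace (n d : ℕ) : Set (Fin n → EuclideanSpace ℝ (Fin d)) :=
  Set.pi Set.univ fun _ => latentSpace d

lemma measurableSet_configSpace {n : ℕ} : MeasurableSet (configSpace n d) :=
  MeasurableSet.univ_pi fun _ => measurableSet_latentSpace

lemma prior_le_restrict (h : IsPriorDensity dens) {b : ℝ} (hb : ∀ x ∈ latentSpace d, dens x ≤ b)
    (n : ℕ) : prior dens n ≤ ENNReal.ofReal b ^ n • volume.restrict (configSpace n d) := by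
  have := h.isProbabilityMeasure
  refine (pi_mono_measure (withDensity_le_restrict h hb)).trans (le_of_eq ?_)
  have hfin : IsFiniteMeasure (volume.restrict (latentSpace d)) :=
    ⟨by rw [Measure.restrict_apply_univ]; exact volume_latentSpace_lt_top⟩
  have hfin2 : IsFiniteMeasure (ENNReal.ofReal b • volume.restrict (latentSpace d)) :=
    Measure.smul_finite _ ENNReal.ofReal_ne_top
  refine Measure.pi_eq fun s hs => ?_
  rw [Measure.smul_apply, configSpace, volume_pi, Measure.restrict_pi_pi, Measure.pi_pi]
  simp [Finset.prod_mul_distrib]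

lemma ae_mem_configSpace (h : IsPriorDensity dens) (n : ℕ) :
    ∀ᵐ x ∂(prior dens n), ∀ i, x i ∈ latentSpace d := by
  obtain ⟨a, b, -, hab⟩ := h.bounded
  have h1 : prior dens n ≪ volume.restrict (configSpace n d) :=
    (Measure.absolutelyContinuous_of_le (prior_le_restrict h (fun x hx => (hab x hx).2) n)).trans
      (Measure.smul_absolutelyContinuous)
  refine h1.ae_le ?_
  filter_upwards [ae_restrict_mem measurableSet_configSpace] with x hx i
  exact hx i (Set.mem_univ i)

/-- A Gaussian integral under the prior is of order `n ^ (-d / 2)` per vertex. The `d` directions in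
which the quadratic form degenerates contribute a factor polynomial in `n`, which the constant `κ`
absorbs for large `n`. -/
lemma exists_integral_prior_le (h : IsPriorDensity dens) {c : ℝ} (hc : 0 < c) :
    ∃ κ : ℝ, 0 < κ ∧ ∀ᶠ n : ℕ in atTop, ∀ Q : Matrix (Fin n) (Fin n) ℝ, Qᵀ = Q → Q * Q = Q →
      Q.trace = (n : ℝ) - d →
      ∫ x, Real.exp (-(c * n * ‖Q * latentMatrix x‖ ^ 2)) ∂(prior dens n) ≤
        (κ * (√(n : ℝ))⁻¹ ^ d) ^ n := by
  obtain ⟨a, b, ha, hab⟩ := h.bounded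
  have hb : 0 < b := ha.trans_le
    ((hab 0 zero_mem_latentSpace).1.trans (hab 0 zero_mem_latentSpace).2)
  set α := (Real.pi / c) ^ ((d : ℝ) / 2) with hα
  have hα0 : 0 < α := by positivity
  set ω := (volume : Measure (EuclideanSpace ℝ (Fin d))).real (Metric.ball 0 1) with hω
  have hω0 : 0 ≤ ω := measureReal_nonneg
  refine ⟨Real.exp 1 * b * α, by positivity, ?_⟩
  have hpoly : ∀ᶠ n : ℕ in atTop, (ω / α) ^ d * (n : ℝ) ^ (d * d) ≤ Real.exp n := by
    have h1 : Tendsto (fun n : ℕ => (n : ℝ) ^ (d * d) * Real.exp (-n)) atTop (𝓝 0) :=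
      (Real.tendsto_pow_mul_exp_neg_atTop_nhds_zero (d * d)).comp tendsto_natCast_atTop_atTop
    have h2 := h1.const_mul ((ω / α) ^ d)
    rw [mul_zero] at h2
    filter_upwards [h2.eventually (gt_mem_nhds one_pos)] with n hn
    have h3 := mul_le_mul_of_nonneg_right hn.le (Real.exp_pos (n : ℝ)).le
    rw [one_mul, mul_assoc, mul_assoc, ← Real.exp_add, neg_add_cancel, Real.exp_zero, mul_one] at h3
    exact h3
  filter_upwards [hpoly, eventually_gt_atTop 0, eventually_ge_atTop d]
    with n hn hn0 hnd Q hQ hQQ htr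
  have hn' : (0 : ℝ) < n := Nat.cast_pos.2 hn0
  have hr : (0 : ℝ) < √n := Real.sqrt_pos.2 hn'
  have hrr : √(n : ℝ) ^ 2 = n := Real.sq_sqrt hn'.le
  set S : Set (Fin n → EuclideanSpace ℝ (Fin d)) := {x | ∑ i, ‖x i‖ ^ 2 ≤ √(n : ℝ) ^ 2} with hS
  have hSm : MeasurableSet S := (isClosed_le (by fun_prop) continuous_const).measurableSet
  have hsub : configSpace n d ⊆ S := by
    intro x hx
    rw [hS, Set.mem_ofPred_eq, sum_norm_sq_eq, hrr]
    exact frobenius_latentMatrix_sq_le fun i => hx i (Set.mem_univ i)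
  have hSfin : volume S ≠ ⊤ := by
    refine ((measure_mono fun x hx => ?_).trans_lt
      (measure_closedBall_lt_top (x := (0 : Fin n → EuclideanSpace ℝ (Fin d))) (r := √(n : ℝ)))).ne
    rw [mem_closedBall_zero_iff, pi_norm_le_iff_of_nonneg hr.le]
    intro i
    have h1 : ‖x i‖ ^ 2 ≤ √(n : ℝ) ^ 2 := (Finset.single_le_sum (f := fun i => ‖x i‖ ^ 2)
      (fun i _ => by positivity) (Finset.mem_univ i)).trans hx
    exact (sq_le_sq₀ (norm_nonneg _) hr.le).1 h1
  let g : (Fin n → EuclideanSpace ℝ (Fin d)) → ℝ := fun x =>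
    Real.exp (-(c * n * ‖Q * latentMatrix x‖ ^ 2))
  have hgc : Continuous g := by
    have h1 : ∀ x : Fin n → EuclideanSpace ℝ (Fin d), ‖Q * latentMatrix x‖ ^ 2 =
        ∑ i, ∑ k, (∑ j, Q i j * x j k) ^ 2 := fun x => by
      rw [frobenius_sq_eq_sum]; simp [Matrix.mul_apply, latentMatrix]
    simp only [g, h1]
    fun_prop
  have hg0 : ∀ x, 0 ≤ g x := fun x => (Real.exp_pos _).le
  have hg1 : ∀ x, g x ≤ 1 := fun x => Real.exp_le_one_iff.2 (by
    have : 0 ≤ c * n * ‖Q * latentMatrix x‖ ^ 2 := by positivity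
    linarith)
  have hgS : IntegrableOn g S := by
    refine Integrable.mono' (integrableOn_const hSfin (C := (1 : ℝ))) hgc.aestronglyMeasurable
      (ae_of_all _ fun x => ?_)
    rw [Real.norm_of_nonneg (hg0 x)]; exact hg1 x
  have hint := integral_exp_neg_projection_le (d := d) (b := c * n) (by positivity) hQ hQQ htr
  have e1 : (Real.pi / (c * n)) ^ ((d : ℝ) / 2) = α * (√(n : ℝ))⁻¹ ^ d := by
    rw [hα, ← div_div, div_eq_mul_inv (Real.pi / c), Real.mul_rpow (by positivity) (by positivity)]
    congr 1
    rw [show (√(n : ℝ))⁻¹ = (n : ℝ)⁻¹ ^ (1 / 2 : ℝ) by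
      rw [← Real.sqrt_inv, Real.sqrt_eq_rpow], ← Real.rpow_natCast, ← Real.rpow_mul (by positivity)]
    congr 1; ring
  set r := (√(n : ℝ))⁻¹ ^ d with hrdef
  have hr0 : 0 < r := by positivity
  have e2 : √(n : ℝ) ^ d * r = 1 := by
    rw [hrdef, ← mul_pow, mul_inv_cancel₀ hr.ne', one_pow]
  have e3 : (√(n : ℝ) ^ d) ^ 2 = (n : ℝ) ^ d := by rw [← pow_mul, mul_comm, pow_mul, hrr]
  calc ∫ x, g x ∂(prior dens n)
      ≤ ∫ x, g x ∂(ENNReal.ofReal b ^ n • volume.restrict (configSpace n d)) := by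
        refine integral_mono_measure (prior_le_restrict h (fun x hx => (hab x hx).2) n)
          (ae_of_all _ hg0) ?_
        exact (hgS.mono_set hsub).smul_measure (ENNReal.pow_ne_top ENNReal.ofReal_ne_top)
    _ = b ^ n * ∫ x in configSpace n d, g x := by
        rw [integral_smul_measure, ENNReal.toReal_pow, ENNReal.toReal_ofReal hb.le, smul_eq_mul]
    _ ≤ b ^ n * ∫ x in S, g x := by
        refine mul_le_mul_of_nonneg_left ?_ (by positivity)
        exact setIntegral_mono_set hgS (ae_of_all _ hg0) (ae_of_all _ hsub)
    _ ≤ b ^ n * ((√(n : ℝ) ^ d * ω) ^ d * (α * r) ^ (n - d)) := by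
        rw [e1] at hint
        exact mul_le_mul_of_nonneg_left hint (by positivity)
    _ = b ^ n * (α * r) ^ n * ((ω / α) ^ d * (n : ℝ) ^ (d * d)) := by
        have key : α * r * (ω / α * (√(n : ℝ) ^ d) ^ 2) = √(n : ℝ) ^ d * ω := by
          field_simp
          linear_combination ω * e2
        have key2 : (α * r) ^ n = (α * r) ^ d * (α * r) ^ (n - d) := by
          rw [← pow_add, Nat.add_sub_cancel' hnd]
        rw [pow_mul, ← e3, ← key, key2]
        simp only [mul_pow]
        ring
    _ ≤ b ^ n * (α * r) ^ n * Real.exp n := by gcongr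
    _ = _ := by
        rw [← mul_pow, show Real.exp (n : ℝ) = Real.exp 1 ^ n by rw [← Real.exp_nat_mul, mul_one],
          ← mul_pow]
        congr 1; ring

/-- The prior gives a ball of radius `η`, in the supremum over the rows, mass of order `η ^ d` per
vertex, also when the centre lies on the boundary of the latent space. -/
lemma exists_prior_ball_ge (h : IsPriorDensity dens) :
    ∃ κ : ℝ, 0 < κ ∧ ∀ (n : ℕ) (x₀ : Fin n → EuclideanSpace ℝ (Fin d)),
      (∀ i, x₀ i ∈ latentSpace d) → ∀ η : ℝ, 0 ≤ η → η ≤ 1 →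
      (κ * η ^ d) ^ n ≤ (prior dens n).real
        (Set.pi Set.univ fun i => latentSpace d ∩ Metric.closedBall (x₀ i) η) := by
  obtain ⟨a, b, ha, hab⟩ := h.bounded
  have := h.isProbabilityMeasure
  set v := (volume : Measure (EuclideanSpace ℝ (Fin d))).real (latentSpace d) with hv
  have hv0 : 0 < v := ENNReal.toReal_pos (volume_latentSpace_pos h).ne' volume_latentSpace_lt_top.ne
  refine ⟨a * v / 2 ^ d, by positivity, fun n x₀ hx₀ η h0 h1 => ?_⟩
  rw [measureReal_def, prior, Measure.pi_pi, ENNReal.toReal_prod]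
  have hone : ∀ i, a * v / 2 ^ d * η ^ d ≤ ((volume.withDensity fun x => ENNReal.ofReal (dens x))
      (latentSpace d ∩ Metric.closedBall (x₀ i) η)).toReal := by
    intro i
    set T := latentSpace d ∩ Metric.closedBall (x₀ i) η with hT
    have hTm : MeasurableSet T := measurableSet_latentSpace.inter measurableSet_closedBall
    -- shrinking the latent space towards `x₀ i` stays inside both the latent space and the ball
    have hsub : AffineMap.homothety (x₀ i) (η / 2) '' latentSpace d ⊆ T := by
      rintro _ ⟨y, hy, rfl⟩
      have hform : AffineMap.homothety (x₀ i) (η / 2) y = (1 - η / 2) • x₀ i + (η / 2) • y := by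
        rw [AffineMap.homothety_apply, vsub_eq_sub, vadd_eq_add, sub_smul, one_smul, smul_sub]
        abel
      refine ⟨?_, ?_⟩
      · rw [hform]
        exact convex_latentSpace (hx₀ i) hy (by linarith) (by linarith) (by ring)
      · rw [Metric.mem_closedBall, dist_eq_norm, AffineMap.homothety_apply, vadd_eq_add,
          add_sub_cancel_right, vsub_eq_sub, norm_smul, Real.norm_of_nonneg (by linarith)]
        have := norm_sub_le y (x₀ i)
        have := hy.1
        have := (hx₀ i).1
        nlinarith
    have h2 : ENNReal.ofReal (a * v / 2 ^ d * η ^ d) ≤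
        (volume.withDensity fun x => ENNReal.ofReal (dens x)) T := by
      rw [withDensity_apply _ hTm]
      calc ENNReal.ofReal (a * v / 2 ^ d * η ^ d)
          = ENNReal.ofReal a * (ENNReal.ofReal |(η / 2) ^ d| * volume (latentSpace d)) := by
            rw [abs_of_nonneg (by positivity), ← ENNReal.ofReal_toReal volume_latentSpace_lt_top.ne,
              ← ENNReal.ofReal_mul (by positivity), ← ENNReal.ofReal_mul ha.le, ← measureReal_def,
              ← hv]
            congr 1; rw [div_pow]; ring
        _ = ENNReal.ofReal a * volume (AffineMap.homothety (x₀ i) (η / 2) '' latentSpace d) := by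
            rw [Measure.addHaar_image_homothety]; simp
        _ ≤ ENNReal.ofReal a * volume T := by gcongr
        _ = ∫⁻ x in T, ENNReal.ofReal a := by rw [setLIntegral_const]
        _ ≤ ∫⁻ x in T, ENNReal.ofReal (dens x) := by
            refine setLIntegral_mono' hTm fun x hx => ENNReal.ofReal_le_ofReal (hab x hx.1).1
    exact (ENNReal.ofReal_le_iff_le_toReal (measure_ne_top _ _)).1 h2
  calc (a * v / 2 ^ d * η ^ d) ^ n = ∏ _i : Fin n, (a * v / 2 ^ d * η ^ d) := by simp
    _ ≤ _ := Finset.prod_le_prod (fun i _ => by positivity) fun i _ => hone i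

end Prior

/-! ### The posterior and the evidence -/

section Posterior

variable {n d : ℕ} {dens : EuclideanSpace ℝ (Fin d) → ℝ}

lemma continuous_edgeProb (e : VertexPair n) :
    Continuous fun x : Fin n → EuclideanSpace ℝ (Fin d) => edgeProb x e := by
  unfold edgeProb; fun_prop

lemma continuous_likelihood (Y : Adjacency n) :
    Continuous fun x : Fin n → EuclideanSpace ℝ (Fin d) => likelihood Y x := by
  unfold likelihood
  refine continuous_finsetProd _ fun e _ => ?_
  have := continuous_edgeProb (d := d) e
  split_ifs <;> fun_prop

lemma integrable_likelihood (h : IsPriorDensity dens) (Y : Adjacency n) :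
    Integrable (fun x => likelihood Y x) (prior dens n) := by
  have := h.isProbabilityMeasure_prior n
  refine Integrable.mono' (integrable_const 1) (continuous_likelihood Y).aestronglyMeasurable ?_
  filter_upwards [ae_mem_configSpace h n] with x hx
  rw [Real.norm_of_nonneg (likelihood_nonneg hx Y)]
  exact likelihood_le_one hx Y

/-- The marginal probability of the graph `Y` under the prior. -/
def evidence (dens : EuclideanSpace ℝ (Fin d) → ℝ) (Y : Adjacency n) : ℝ :=
  ∫ x, likelihood Y x ∂(prior dens n)

lemma unnormalizedPosterior_apply (h : IsPriorDensity dens) (Y : Adjacency n)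
    {A : Set (Fin n → EuclideanSpace ℝ (Fin d))} (hA : MeasurableSet A) :
    unnormalizedPosterior dens Y A = ENNReal.ofReal (∫ x in A, likelihood Y x ∂(prior dens n)) := by
  rw [unnormalizedPosterior, withDensity_apply _ hA, ofReal_integral_eq_lintegral_ofReal
    (integrable_likelihood h Y).integrableOn]
  filter_upwards [ae_restrict_of_ae (ae_mem_configSpace h n)] with x hx
  exact likelihood_nonneg hx Y

lemma posterior_real_eq (h : IsPriorDensity dens) (Y : Adjacency n)
    {A : Set (Fin n → EuclideanSpace ℝ (Fin d))} (hA : MeasurableSet A) :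
    (posterior dens Y).real A =
      (∫ x in A, likelihood Y x ∂(prior dens n)) / evidence dens Y := by
  have h0 : ∀ A : Set (Fin n → EuclideanSpace ℝ (Fin d)),
      0 ≤ ∫ x in A, likelihood Y x ∂(prior dens n) := fun A =>
    integral_nonneg_of_ae (by
      filter_upwards [ae_restrict_of_ae (ae_mem_configSpace h n)] with x hx
      exact likelihood_nonneg hx Y)
  have h1 := h0 Set.univ
  rw [Measure.restrict_univ] at h1
  rw [measureReal_def, posterior, Measure.smul_apply, unnormalizedPosterior_apply h Y hA,
    unnormalizedPosterior_apply h Y MeasurableSet.univ, Measure.restrict_univ, smul_eq_mul,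
    ENNReal.toReal_mul, ENNReal.toReal_inv, ENNReal.toReal_ofReal (h0 A), ENNReal.toReal_ofReal h1,
    evidence, div_eq_inv_mul]

lemma isProbabilityMeasure_posterior (h : IsPriorDensity dens) {Y : Adjacency n}
    (hY : 0 < evidence dens Y) : IsProbabilityMeasure (posterior dens Y) := by
  refine ⟨?_⟩
  have hY' : 0 < ∫ x, likelihood Y x ∂(prior dens n) := hY
  rw [posterior, Measure.smul_apply, unnormalizedPosterior_apply h Y MeasurableSet.univ,
    Measure.restrict_univ, smul_eq_mul, ENNReal.inv_mul_cancel]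
  · simpa using hY'
  · exact ENNReal.ofReal_ne_top

lemma ae_posterior_mem (h : IsPriorDensity dens) (Y : Adjacency n) :
    ∀ᵐ x ∂(posterior dens Y), ∀ i, x i ∈ latentSpace d := by
  have h1 : posterior dens Y ≪ prior dens n :=
    Measure.smul_absolutelyContinuous.trans (withDensity_absolutelyContinuous _ _)
  exact h1.ae_le (ae_mem_configSpace h n)

/-- The rows are latent positions, and all edge probabilities, those of self-pairs included, are at
distance at least `δ` from `0` and `1`. -/
def HasMargin (δ : ℝ) (x : Fin n → EuclideanSpace ℝ (Fin d)) : Prop :=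
  (∀ i, x i ∈ latentSpace d) ∧ ∀ e : VertexPair n, δ ≤ edgeProb x e ∧ edgeProb x e ≤ 1 - δ

/-- A neighbourhood of `x₀`, of radius of order `n ^ (-1 / 2)` uniformly over the rows. It is so
small that the `χ²`-affinity with `x₀` stays below `exp n`, since there are at most `n ^ 2` edges.
-/
def nearby (δ : ℝ) (x₀ : Fin n → EuclideanSpace ℝ (Fin d)) :
    Set (Fin n → EuclideanSpace ℝ (Fin d)) :=
  Set.pi Set.univ fun i => latentSpace d ∩ Metric.closedBall (x₀ i) (δ / (4 * √n))

lemma measurableSet_nearby (δ : ℝ) (x₀ : Fin n → EuclideanSpace ℝ (Fin d)) :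
    MeasurableSet (nearby δ x₀) :=
  MeasurableSet.univ_pi fun _ => measurableSet_latentSpace.inter measurableSet_closedBall

lemma edgeProb_nearby (hn : 0 < n) {δ : ℝ} (hδ : 0 < δ) (hδ' : δ < 1 / 2)
    {x₀ x : Fin n → EuclideanSpace ℝ (Fin d)} (hx₀ : HasMargin δ x₀) (hx : x ∈ nearby δ x₀)
    (e : VertexPair n) :
    δ / 2 ≤ edgeProb x e ∧ edgeProb x e ≤ 1 - δ / 2 ∧
      (edgeProb x₀ e - edgeProb x e) ^ 2 ≤ 1 / n * (edgeProb x e * (1 - edgeProb x e)) := by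
  have hn' : (1 : ℝ) ≤ n := Nat.one_le_cast.2 hn
  have hr : 1 ≤ √(n : ℝ) := Real.one_le_sqrt.2 hn'
  have hrr : √(n : ℝ) ^ 2 = n := Real.sq_sqrt (by linarith)
  set η := δ / (4 * √(n : ℝ)) with hη
  have hη0 : 0 < η := by positivity
  have hη1 : η ≤ δ / 4 := by
    rw [hη]; exact div_le_div_of_nonneg_left hδ.le (by norm_num) (by linarith)
  have hηsq : (2 * η) ^ 2 = δ ^ 2 / (4 * n) := by
    rw [hη, show (2 * (δ / (4 * √(n : ℝ)))) ^ 2 = δ ^ 2 / (4 * √(n : ℝ) ^ 2) by field_simp; ring,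
      hrr]
  have hd : ∀ i, ‖x i - x₀ i‖ ≤ η := fun i => by
    have := (hx i (Set.mem_univ i)).2
    rwa [Metric.mem_closedBall, dist_eq_norm] at this
  have hm : ∀ i, x i ∈ latentSpace d := fun i => (hx i (Set.mem_univ i)).1
  have hdiff : |edgeProb x₀ e - edgeProb x e| ≤ 2 * η := by
    have e1 : edgeProb x₀ e - edgeProb x e =
        -(inner ℝ (x e.1.1 - x₀ e.1.1) (x e.1.2) + inner ℝ (x₀ e.1.1) (x e.1.2 - x₀ e.1.2)) := by
      simp only [edgeProb, inner_sub_left, inner_sub_right]; ring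
    rw [e1, abs_neg]
    refine (abs_add_le _ _).trans ?_
    have a1 := abs_real_inner_le_norm (x e.1.1 - x₀ e.1.1) (x e.1.2)
    have a2 := abs_real_inner_le_norm (x₀ e.1.1) (x e.1.2 - x₀ e.1.2)
    have a3 := hd e.1.1
    have a4 := hd e.1.2
    have a5 := (hm e.1.2).1
    have a6 := (hx₀.1 e.1.1).1
    have a7 : ‖x e.1.1 - x₀ e.1.1‖ * ‖x e.1.2‖ ≤ η * 1 :=
      mul_le_mul a3 a5 (norm_nonneg _) hη0.le
    have a8 : ‖x₀ e.1.1‖ * ‖x e.1.2 - x₀ e.1.2‖ ≤ 1 * η :=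
      mul_le_mul a6 a4 (norm_nonneg _) zero_le_one
    linarith
  obtain ⟨hp1, hp2⟩ := hx₀.2 e
  obtain ⟨b1, b2⟩ := abs_le.1 hdiff
  set p := edgeProb x e
  have hp3 : δ / 2 ≤ p := by linarith
  have hp4 : p ≤ 1 - δ / 2 := by linarith
  refine ⟨hp3, hp4, ?_⟩
  have h1 : (edgeProb x₀ e - p) ^ 2 ≤ (2 * η) ^ 2 := sq_le_sq' b1 b2
  have h2 : δ / 4 ≤ p * (1 - p) := by nlinarith
  calc _ ≤ δ ^ 2 / (4 * n) := hηsq ▸ h1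
    _ = 1 / n * (δ ^ 2 / 4) := by field_simp
    _ ≤ 1 / n * (p * (1 - p)) := by
      refine mul_le_mul_of_nonneg_left ?_ (by positivity)
      nlinarith

lemma likelihood_nearby_ge (hn : 0 < n) {δ : ℝ} (hδ : 0 < δ) (hδ' : δ < 1 / 2)
    {x₀ x : Fin n → EuclideanSpace ℝ (Fin d)} (hx₀ : HasMargin δ x₀) (hx : x ∈ nearby δ x₀)
    (Y : Adjacency n) : (δ / 2) ^ Fintype.card (VertexPair n) ≤ likelihood Y x := by
  rw [← Finset.card_univ, ← Finset.prod_const]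
  refine Finset.prod_le_prod (fun e _ => by positivity) fun e _ => ?_
  obtain ⟨h1, h2, -⟩ := edgeProb_nearby hn hδ hδ' hx₀ hx e
  split_ifs
  · exact h1
  · linarith

lemma sum_likelihood_sq_div_nearby_le (hn : 0 < n) {δ : ℝ} (hδ : 0 < δ) (hδ' : δ < 1 / 2)
    {x₀ x : Fin n → EuclideanSpace ℝ (Fin d)} (hx₀ : HasMargin δ x₀) (hx : x ∈ nearby δ x₀) :
    ∑ Y, likelihood Y x₀ ^ 2 / likelihood Y x ≤ Real.exp n := by
  have hn' : (0 : ℝ) < n := Nat.cast_pos.2 hn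
  refine (sum_likelihood_sq_div_le (c := fun _ => 1 / (n : ℝ)) (fun e => ?_) fun e => ?_).trans ?_
  · obtain ⟨h1, h2, -⟩ := edgeProb_nearby hn hδ hδ' hx₀ hx e
    constructor <;> linarith
  · exact (edgeProb_nearby hn hδ hδ' hx₀ hx e).2.2
  · refine Real.exp_le_exp.2 ?_
    rw [Finset.sum_const, Finset.card_univ, nsmul_eq_mul]
    have hc : (Fintype.card (VertexPair n) : ℝ) ≤ n * n := by
      have := Fintype.card_subtype_le fun e : Fin n × Fin n => e.1 ≤ e.2
      rw [Fintype.card_prod, Fintype.card_fin] at this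
      exact_mod_cast this
    calc _ ≤ (n * n : ℝ) * (1 / n) := mul_le_mul_of_nonneg_right hc (by positivity)
      _ = n := by field_simp

lemma prior_nearby_mul_le_evidence (h : IsPriorDensity dens) (hn : 0 < n) {δ : ℝ} (hδ : 0 < δ)
    (hδ' : δ < 1 / 2) {x₀ : Fin n → EuclideanSpace ℝ (Fin d)} (hx₀ : HasMargin δ x₀)
    (Y : Adjacency n) :
    (prior dens n).real (nearby δ x₀) * (δ / 2) ^ Fintype.card (VertexPair n) ≤
      ∫ x in nearby δ x₀, likelihood Y x ∂(prior dens n) ∧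
    ∫ x in nearby δ x₀, likelihood Y x ∂(prior dens n) ≤ evidence dens Y := by
  have := h.isProbabilityMeasure_prior n
  constructor
  · rw [← smul_eq_mul, ← setIntegral_const]
    exact setIntegral_mono_on (integrableOn_const (measure_ne_top _ _))
      (integrable_likelihood h Y).integrableOn (measurableSet_nearby δ x₀)
      fun x hx => likelihood_nearby_ge hn hδ hδ' hx₀ hx Y
  · refine setIntegral_le_integral (integrable_likelihood h Y) ?_
    filter_upwards [ae_mem_configSpace h n] with x hx
    exact likelihood_nonneg hx Y

/-- The `χ²`-affinity of the truth and the marginal law of the graph. The evidence is at least the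
integral of the likelihood over `nearby δ x₀`, and Jensen's inequality for `t ↦ 1 / t` passes to the
affinities of the single configurations in that set. -/
lemma sum_likelihood_sq_div_evidence_le (h : IsPriorDensity dens) (hn : 0 < n) {δ : ℝ} (hδ : 0 < δ)
    (hδ' : δ < 1 / 2) {x₀ : Fin n → EuclideanSpace ℝ (Fin d)} (hx₀ : HasMargin δ x₀)
    (hpos : 0 < (prior dens n).real (nearby δ x₀)) :
    ∑ Y, likelihood Y x₀ ^ 2 / evidence dens Y ≤
      Real.exp n / (prior dens n).real (nearby δ x₀) := by
  have := h.isProbabilityMeasure_prior n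
  set B := nearby δ x₀ with hB
  set m := (prior dens n).real B with hm
  have hBm : MeasurableSet B := measurableSet_nearby δ x₀
  have hLpos : ∀ x ∈ B, ∀ Y, 0 < likelihood Y x := fun x hx Y =>
    lt_of_lt_of_le (by positivity) (likelihood_nearby_ge hn hδ hδ' hx₀ hx Y)
  have hinv : ∀ Y, IntegrableOn (fun x => (likelihood Y x)⁻¹) B (prior dens n) := by
    intro Y
    refine Integrable.mono' (integrable_const (((δ / 2) ^ Fintype.card (VertexPair n))⁻¹))
      (continuous_likelihood Y).measurable.inv.aestronglyMeasurable ?_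
    filter_upwards [ae_restrict_mem hBm] with x hx
    rw [Real.norm_of_nonneg (inv_nonneg.2 (hLpos x hx Y).le)]
    exact inv_anti₀ (by positivity) (likelihood_nearby_ge hn hδ hδ' hx₀ hx Y)
  have hmain : ∀ Y, m ^ 2 * (evidence dens Y)⁻¹ ≤ ∫ x in B, (likelihood Y x)⁻¹ ∂(prior dens n) := by
    intro Y
    obtain ⟨h1, h2⟩ := prior_nearby_mul_le_evidence h hn hδ hδ' hx₀ Y
    set D := ∫ x in B, likelihood Y x ∂(prior dens n) with hD
    have hD0 : 0 < D := lt_of_lt_of_le (by positivity) h1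
    -- Jensen's inequality, in the form of the tangent bound `1 / L ≥ 2 t - t² L` at `t = m / D`
    have h3 : ∫ x in B, (2 * (m / D) - (m / D) ^ 2 * likelihood Y x) ∂(prior dens n) ≤
        ∫ x in B, (likelihood Y x)⁻¹ ∂(prior dens n) := by
      refine setIntegral_mono_on ?_ (hinv Y) hBm fun x hx => ?_
      · exact (integrable_const _).sub ((integrable_likelihood h Y).integrableOn.const_mul _)
      · have hL := hLpos x hx Y
        rw [← sub_nonneg]
        have : (likelihood Y x)⁻¹ - (2 * (m / D) - (m / D) ^ 2 * likelihood Y x) =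
            (1 - m / D * likelihood Y x) ^ 2 / likelihood Y x := by
          field_simp; ring
        rw [this]; positivity
    rw [integral_sub (integrable_const _) ((integrable_likelihood h Y).integrableOn.const_mul _),
      setIntegral_const, integral_const_mul, ← hD, ← hm, smul_eq_mul] at h3
    have h4 : m * (2 * (m / D)) - (m / D) ^ 2 * D = m ^ 2 * D⁻¹ := by field_simp; ring
    rw [h4] at h3
    refine le_trans ?_ h3
    exact mul_le_mul_of_nonneg_left (inv_anti₀ hD0 h2) (sq_nonneg _)
  have hsum : m ^ 2 * ∑ Y, likelihood Y x₀ ^ 2 / evidence dens Y ≤ m * Real.exp n := by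
    calc m ^ 2 * ∑ Y, likelihood Y x₀ ^ 2 / evidence dens Y
        ≤ ∑ Y, likelihood Y x₀ ^ 2 * ∫ x in B, (likelihood Y x)⁻¹ ∂(prior dens n) := by
          rw [Finset.mul_sum]
          refine Finset.sum_le_sum fun Y _ => ?_
          calc m ^ 2 * (likelihood Y x₀ ^ 2 / evidence dens Y)
              = likelihood Y x₀ ^ 2 * (m ^ 2 * (evidence dens Y)⁻¹) := by ring
            _ ≤ _ := mul_le_mul_of_nonneg_left (hmain Y) (sq_nonneg _)
      _ = ∫ x in B, ∑ Y, likelihood Y x₀ ^ 2 / likelihood Y x ∂(prior dens n) := by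
          simp only [div_eq_mul_inv]
          rw [integral_finsetSum _ fun Y _ => (hinv Y).const_mul _]
          simp only [integral_const_mul]
      _ ≤ ∫ x in B, Real.exp n ∂(prior dens n) := by
          refine setIntegral_mono_on (integrable_finsetSum _ fun Y _ => ?_) (integrable_const _) hBm
            fun x hx => sum_likelihood_sq_div_nearby_le hn hδ hδ' hx₀ hx
          simp only [div_eq_mul_inv]
          exact (hinv Y).const_mul _
      _ = m * Real.exp n := by rw [setIntegral_const, smul_eq_mul]
  rw [le_div_iff₀ hpos]
  have : m * ((∑ Y, likelihood Y x₀ ^ 2 / evidence dens Y) * m) ≤ m * Real.exp n := by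
    linarith
  exact le_of_mul_le_mul_left this hpos

/-- Splitting the expected posterior mass of `A` with the help of a test event `Ω`: the posterior
mass is at most one on the complement of `Ω`, and on `Ω` it is at most its own square root, to which
the Cauchy–Schwarz inequality applies. -/
lemma integral_posterior_le (h : IsPriorDensity dens) {x₀ : Fin n → EuclideanSpace ℝ (Fin d)}
    (hx₀ : ∀ i, x₀ i ∈ latentSpace d) (hev : ∀ Y : Adjacency n, 0 < evidence dens Y)
    {A : Set (Fin n → EuclideanSpace ℝ (Fin d))} (hA : MeasurableSet A) (Ω : Set (Adjacency n))
    [DecidablePred (· ∈ Ω)] :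
    ∫ Y, (posterior dens Y).real A ∂(rdpg x₀) ≤
      ∑ Y, (if Y ∈ Ω then 0 else likelihood Y x₀) +
      √((∑ Y, likelihood Y x₀ ^ 2 / evidence dens Y) *
        ∫ x in A, (∑ Y, if Y ∈ Ω then likelihood Y x else 0) ∂(prior dens n)) := by
  have := h.isProbabilityMeasure_prior n
  let N : Adjacency n → ℝ := fun Y => ∫ x in A, likelihood Y x ∂(prior dens n)
  have hN0 : ∀ Y, 0 ≤ N Y := fun Y => integral_nonneg_of_ae (by
      filter_upwards [ae_restrict_of_ae (ae_mem_configSpace h n)] with x hx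
      exact likelihood_nonneg hx Y)
  have hpost : ∀ Y, (posterior dens Y).real A = N Y / evidence dens Y :=
    fun Y => posterior_real_eq h Y hA
  have hle1 : ∀ Y, (posterior dens Y).real A ≤ 1 := fun Y => by
    have := isProbabilityMeasure_posterior h (hev Y)
    exact measureReal_le_one
  have hL := fun Y => likelihood_nonneg hx₀ Y
  have hsw : ∫ x in A, (∑ Y, if Y ∈ Ω then likelihood Y x else 0) ∂(prior dens n) =
      ∑ Y, if Y ∈ Ω then N Y else 0 := by
    rw [integral_finsetSum]
    · refine Finset.sum_congr rfl fun Y _ => ?_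
      split_ifs <;> simp [N]
    · intro Y _
      split_ifs
      · exact (integrable_likelihood h Y).integrableOn
      · exact integrable_zero _ _ _
  rw [integral_rdpg hx₀, hsw]
  have hcs := Real.sum_mul_le_sqrt_mul_sqrt (Finset.univ : Finset (Adjacency n))
    (fun Y => √(likelihood Y x₀ ^ 2 / evidence dens Y))
    (fun Y => √(if Y ∈ Ω then N Y else 0))
  have e1 : ∀ Y, √(likelihood Y x₀ ^ 2 / evidence dens Y) ^ 2 =
      likelihood Y x₀ ^ 2 / evidence dens Y := fun Y =>
    Real.sq_sqrt (div_nonneg (sq_nonneg _) (hev Y).le)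
  have e2 : ∀ Y, √(if Y ∈ Ω then N Y else 0) ^ 2 = if Y ∈ Ω then N Y else 0 := fun Y =>
    Real.sq_sqrt (by split_ifs; exacts [hN0 Y, le_rfl])
  simp only [e1, e2] at hcs
  rw [← Real.sqrt_mul (Finset.sum_nonneg fun Y _ => div_nonneg (sq_nonneg _) (hev Y).le)] at hcs
  refine le_trans ?_ (add_le_add_right hcs _)
  rw [← Finset.sum_add_distrib]
  refine Finset.sum_le_sum fun Y _ => ?_
  split_ifs with hY
  · rw [zero_add, hpost, Real.sqrt_div (sq_nonneg _), Real.sqrt_sq (hL Y)]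
    have hq : N Y / evidence dens Y ≤ √(N Y / evidence dens Y) := by
      refine Real.le_sqrt_of_sq_le ?_
      have h1 : N Y / evidence dens Y ≤ 1 := hpost Y ▸ hle1 Y
      have h2 : 0 ≤ N Y / evidence dens Y := div_nonneg (hN0 Y) (hev Y).le
      nlinarith
    calc likelihood Y x₀ * (N Y / evidence dens Y)
        ≤ likelihood Y x₀ * √(N Y / evidence dens Y) := mul_le_mul_of_nonneg_left hq (hL Y)
      _ = _ := by rw [Real.sqrt_div (hN0 Y)]; ring
  · rw [Real.sqrt_zero, mul_zero, add_zero]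
    exact mul_le_of_le_one_right (hL Y) (hle1 Y)

end Posterior

/-! ### Posterior contraction -/

section Contraction

variable {d : ℕ} {dens : EuclideanSpace ℝ (Fin d) → ℝ}

/-- The smallest eigenvalue of a positive definite matrix is positive and bounds its quadratic form
from below. -/
lemma kthEigenvalue_last_pos_and_le (hd : 0 < d) {Δ : Matrix (Fin d) (Fin d) ℝ} (hΔ : Δ.PosDef) :
    0 < kthEigenvalue hΔ.isHermitian ⟨d - 1, Nat.sub_lt hd one_pos⟩ ∧
    ∀ w : Fin d → ℝ, kthEigenvalue hΔ.isHermitian ⟨d - 1, Nat.sub_lt hd one_pos⟩ * (w ⬝ᵥ w) ≤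
      w ⬝ᵥ (Δ *ᵥ w) := by
  set lam := kthEigenvalue hΔ.isHermitian ⟨d - 1, Nat.sub_lt hd one_pos⟩ with hlam
  have hle : ∀ i, lam ≤ hΔ.isHermitian.eigenvalues i := by
    intro i
    refine hΔ.isHermitian.eigenvalues₀_antitone ?_
    rw [Fin.le_def]
    have := ((Fintype.equivOfCardEq (Fintype.card_fin _)).symm i :
      Fin (Fintype.card (Fin d))).isLt.trans_eq (Fintype.card_fin d)
    change _ ≤ d - 1
    omega
  have hpos : 0 < lam := by
    have h1 := hΔ.eigenvalues_pos ((Fintype.equivOfCardEq (Fintype.card_fin _) :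
      Fin (Fintype.card (Fin d)) ≃ Fin d)
      (Fin.cast (Fintype.card_fin d).symm ⟨d - 1, Nat.sub_lt hd one_pos⟩))
    simpa [Matrix.IsHermitian.eigenvalues, hlam, kthEigenvalue] using h1
  refine ⟨hpos, fun w => ?_⟩
  let V : Matrix (Fin d) (Fin d) ℝ := hΔ.isHermitian.eigenvectorUnitary
  have hV : V ∈ Matrix.orthogonalGroup (Fin d) ℝ := hΔ.isHermitian.eigenvectorUnitary.2
  have hVV' : V * Vᵀ = 1 := (Matrix.mem_orthogonalGroup_iff _ _).1 hV
  have hspec : Δ = V * Matrix.diagonal hΔ.isHermitian.eigenvalues * Vᵀ := by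
    have := hΔ.isHermitian.spectral_theorem
    rw [Unitary.conjStarAlgAut_apply] at this
    simpa [Function.comp_def, Matrix.star_eq_conjTranspose] using this
  have e1 : w ⬝ᵥ w = (Vᵀ *ᵥ w) ⬝ᵥ (Vᵀ *ᵥ w) := by
    rw [Matrix.dotProduct_mulVec, ← Matrix.mulVec_transpose, Matrix.mulVec_mulVec,
      Matrix.transpose_transpose, hVV', Matrix.one_mulVec]
  have e2 : w ⬝ᵥ (Δ *ᵥ w) =
      (Vᵀ *ᵥ w) ⬝ᵥ (Matrix.diagonal hΔ.isHermitian.eigenvalues *ᵥ (Vᵀ *ᵥ w)) := by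
    conv_lhs => rw [hspec]
    rw [Matrix.mul_assoc, ← Matrix.mulVec_mulVec, Matrix.dotProduct_mulVec,
      ← Matrix.mulVec_transpose, ← Matrix.mulVec_mulVec]
  rw [e1, e2]
  simp only [dotProduct, Finset.mul_sum, Matrix.mulVec_diagonal]
  refine Finset.sum_le_sum fun i _ => ?_
  nlinarith [hle i, mul_self_nonneg ((Vᵀ *ᵥ w) i)]

lemma dotProduct_mulVec_le_frobenius {m : Type*} [Fintype m] (M : Matrix m m ℝ) (w : m → ℝ) :
    |w ⬝ᵥ (M *ᵥ w)| ≤ ‖M‖ * (w ⬝ᵥ w) := by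
  have hw : 0 ≤ w ⬝ᵥ w := Finset.sum_nonneg fun i _ => mul_self_nonneg _
  refine abs_le_of_sq_le_sq ?_ (by positivity)
  rw [mul_pow, frobenius_sq_eq_sum]
  have e1 : w ⬝ᵥ (M *ᵥ w) = ∑ q : m × m, M q.1 q.2 * (w q.1 * w q.2) := by
    rw [Fintype.sum_prod_type]
    simp only [dotProduct, Matrix.mulVec, Finset.mul_sum]
    exact Finset.sum_congr rfl fun i _ => Finset.sum_congr rfl fun j _ => by ring
  have e2 : (w ⬝ᵥ w) ^ 2 = ∑ q : m × m, (w q.1 * w q.2) ^ 2 := by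
    rw [Fintype.sum_prod_type, sq, dotProduct, Finset.sum_mul_sum]
    exact Finset.sum_congr rfl fun i _ => Finset.sum_congr rfl fun j _ => by ring
  rw [e1, e2, ← Fintype.sum_prod_type (f := fun q : m × m => M q.1 q.2 ^ 2)]
  exact Finset.sum_mul_sq_le_sq_mul_sq _ _ _

/-- For a regular sequence the Gram matrices of the truth are eventually well conditioned. -/
lemma IsRegular.eventually_lower {Δ : Matrix (Fin d) (Fin d) ℝ} {δ : ℝ}
    {X₀ : (n : ℕ) → Fin n → EuclideanSpace ℝ (Fin d)} (h : IsRegular Δ δ X₀) {μ : ℝ} (hμ : 0 < μ)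
    (hΔ : ∀ w : Fin d → ℝ, 2 * μ * (w ⬝ᵥ w) ≤ w ⬝ᵥ (Δ *ᵥ w)) :
    ∀ᶠ n : ℕ in atTop, ∀ w : Fin d → ℝ,
      n * μ * (w ⬝ᵥ w) ≤ (latentMatrix (X₀ n) *ᵥ w) ⬝ᵥ (latentMatrix (X₀ n) *ᵥ w) := by
  have h1 := tendsto_iff_norm_sub_tendsto_zero.1 h.tendsto
  filter_upwards [h1.eventually (gt_mem_nhds hμ), eventually_gt_atTop 0] with n hn hn0 w
  have hn' : (0 : ℝ) < n := Nat.cast_pos.2 hn0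
  have hw : 0 ≤ w ⬝ᵥ w := Finset.sum_nonneg fun i _ => mul_self_nonneg _
  set X := latentMatrix (X₀ n)
  have h2 := (abs_le.1 (dotProduct_mulVec_le_frobenius ((1 / (n : ℝ)) • (Xᵀ * X) - Δ) w)).1
  rw [Matrix.sub_mulVec, dotProduct_sub, Matrix.smul_mulVec, dotProduct_smul, smul_eq_mul] at h2
  have e1 : w ⬝ᵥ ((Xᵀ * X) *ᵥ w) = (X *ᵥ w) ⬝ᵥ (X *ᵥ w) := by
    rw [← Matrix.mulVec_mulVec, Matrix.dotProduct_mulVec, Matrix.vecMul_transpose]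
  rw [e1] at h2
  have h3 : ‖(1 / (n : ℝ)) • (Xᵀ * X) - Δ‖ * (w ⬝ᵥ w) ≤ μ * (w ⬝ᵥ w) :=
    mul_le_mul_of_nonneg_right hn.le hw
  have h4 : μ * (w ⬝ᵥ w) ≤ 1 / (n : ℝ) * ((X *ᵥ w) ⬝ᵥ (X *ᵥ w)) := by linarith [hΔ w]
  rw [one_div, ← div_eq_inv_mul, le_div_iff₀ hn'] at h4
  linarith

lemma IsRegular.hasMargin {Δ : Matrix (Fin d) (Fin d) ℝ} {δ : ℝ}
    {X₀ : (n : ℕ) → Fin n → EuclideanSpace ℝ (Fin d)} (h : IsRegular Δ δ X₀) (n : ℕ) :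
    HasMargin δ (X₀ n) :=
  ⟨h.mem_latentSpace n, fun _ => ⟨h.le_inner n _ _, h.inner_le n _ _⟩⟩

lemma continuous_frobenius_gram_sub {n : ℕ} (C : Matrix (Fin n) (Fin n) ℝ) :
    Continuous fun x : Fin n → EuclideanSpace ℝ (Fin d) =>
      ‖latentMatrix x * (latentMatrix x)ᵀ - C‖ := by
  have h1 : ∀ x : Fin n → EuclideanSpace ℝ (Fin d), ‖latentMatrix x * (latentMatrix x)ᵀ - C‖ =
      √(∑ i, ∑ j, (inner ℝ (x i) (x j) - C i j) ^ 2) := fun x => by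
    rw [← Real.sqrt_sq (norm_nonneg (latentMatrix x * (latentMatrix x)ᵀ - C)), frobenius_sq_eq_sum]
    simp only [Matrix.sub_apply, latentMatrix_mul_transpose_apply]
  simp only [h1]
  fun_prop

lemma evidence_pos (h : IsPriorDensity dens) {n : ℕ} (hn : 0 < n) {δ : ℝ} (hδ : 0 < δ)
    (hδ' : δ < 1 / 2) {x₀ : Fin n → EuclideanSpace ℝ (Fin d)} (hx₀ : HasMargin δ x₀)
    (Y : Adjacency n) : 0 < evidence dens Y := by
  obtain ⟨κ, hκ, hball⟩ := exists_prior_ball_ge h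
  have hn' : (1 : ℝ) ≤ n := Nat.one_le_cast.2 hn
  have hr : 1 ≤ √(n : ℝ) := Real.one_le_sqrt.2 hn'
  have h1 := hball n x₀ hx₀.1 (δ / (4 * √n)) (by positivity)
    (by rw [div_le_one (by positivity)]; linarith)
  obtain ⟨h2, h3⟩ := prior_nearby_mul_le_evidence h hn hδ hδ' hx₀ Y
  have hpos : 0 < (prior dens n).real (nearby δ x₀) := lt_of_lt_of_le (by positivity) h1
  have : 0 < (prior dens n).real (nearby δ x₀) * (δ / 2) ^ Fintype.card (VertexPair n) := by
    positivity
  linarith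

/-- The posterior mass of the complement of a Frobenius ball of radius `M √n`. The bounds `hball`
for the prior mass of a neighbourhood of the truth and `hgauss` for a Gaussian integral under the
prior carry the same power of `n`, which cancels. -/
lemma integral_posterior_far_le (h : IsPriorDensity dens) {n : ℕ} (hn : 0 < n) {δ : ℝ} (hδ : 0 < δ)
    (hδ' : δ < 1 / 2) {x₀ : Fin n → EuclideanSpace ℝ (Fin d)} (hx₀ : HasMargin δ x₀) {μ K M : ℝ}
    (hμ : 0 < μ) (hK : 0 < K) (hM : 0 < M) (hMK : 20 * K ^ 2 / μ ≤ M ^ 2)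
    (hX₀ : ∀ w : Fin d → ℝ,
      n * μ * (w ⬝ᵥ w) ≤ (latentMatrix x₀ *ᵥ w) ⬝ᵥ (latentMatrix x₀ *ᵥ w))
    {κ : ℝ} (hκ : 0 < κ)
    (hball : (κ * (δ / (4 * √n)) ^ d) ^ n ≤ (prior dens n).real (nearby δ x₀)) {κ' : ℝ}
    (hgauss : ∀ Q : Matrix (Fin n) (Fin n) ℝ, Qᵀ = Q → Q * Q = Q → Q.trace = (n : ℝ) - d →
      ∫ x, Real.exp (-(μ / 40 * n * ‖Q * latentMatrix x‖ ^ 2)) ∂(prior dens n) ≤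
        (κ' * (√(n : ℝ))⁻¹ ^ d) ^ n) :
    ∫ Y, (posterior dens Y).real
        {x | M / √(n : ℝ) < 1 / (n : ℝ) *
          ‖latentMatrix x * (latentMatrix x)ᵀ - latentMatrix x₀ * (latentMatrix x₀)ᵀ‖}
      ∂(rdpg x₀) ≤ 2 * Real.exp ((4 - K / 8) * n) +
        √(Real.exp ((1 - M ^ 2 / 32) * n) * (κ' / (κ * (δ / 4) ^ d)) ^ n) := by
  classical
  have := h.isProbabilityMeasure_prior n
  have hn' : (0 : ℝ) < n := Nat.cast_pos.2 hn
  have hr : (0 : ℝ) < √n := Real.sqrt_pos.2 hn'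
  have hrr : √(n : ℝ) ^ 2 = n := Real.sq_sqrt hn'.le
  set f : (Fin n → EuclideanSpace ℝ (Fin d)) → ℝ := fun x =>
    ‖latentMatrix x * (latentMatrix x)ᵀ - latentMatrix x₀ * (latentMatrix x₀)ᵀ‖ with hf
  have hfc : Continuous f := continuous_frobenius_gram_sub _
  set A := {x | M / √(n : ℝ) < 1 / (n : ℝ) * f x} with hA
  have hAm : MeasurableSet A :=
    (isOpen_lt continuous_const (continuous_const.mul hfc)).measurableSet
  have hfar : ∀ x ∈ A, M ^ 2 * n ≤ f x ^ 2 := by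
    intro x hx
    have hx' : M / √(n : ℝ) < 1 / (n : ℝ) * f x := hx
    rw [one_div, ← div_eq_inv_mul, div_lt_div_iff₀ hr hn'] at hx'
    have h1 : M * √n ≤ f x := by
      refine le_of_mul_le_mul_right ?_ hr
      calc M * √n * √n = M * n := by rw [mul_assoc, ← sq, hrr]
        _ ≤ f x * √n := hx'.le
    calc M ^ 2 * n = (M * √n) ^ 2 := by rw [mul_pow, hrr]
      _ ≤ _ := pow_le_pow_left₀ (by positivity) h1 2
  have hev := fun Y => evidence_pos h hn hδ hδ' hx₀ Y
  have hmain := integral_posterior_le h hx₀.1 hev hAm (smallNoise x₀ (K * √n))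
  have hnoise := sum_likelihood_not_smallNoise_le hx₀.1 K
  refine hmain.trans (add_le_add hnoise (Real.sqrt_le_sqrt ?_))
  have hB0 : 0 < (κ * (δ / (4 * √(n : ℝ))) ^ d) ^ n := by positivity
  have hB := hB0.trans_le hball
  have hden := sum_likelihood_sq_div_evidence_le h hn hδ hδ' hx₀ hB
  obtain ⟨Q, hQ, hQQ, hQX, htr⟩ := exists_projection_annihilating (by positivity) hX₀
  -- the quadratic lower bound for the distance, through the Procrustes bound
  have hdist : ∀ x, μ / 40 * n * ‖Q * latentMatrix x‖ ^ 2 ≤ f x ^ 2 / 32 := by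
    intro x
    obtain ⟨W, hW, hle⟩ := exists_orthogonal_frobenius_sub_le (latentMatrix x) _ hX₀
    have h1 := frobenius_projection_mul_le hQ hQQ (latentMatrix x - latentMatrix x₀ * W)
    rw [Matrix.mul_sub, ← Matrix.mul_assoc, hQX, Matrix.zero_mul, sub_zero] at h1
    have h2 := pow_le_pow_left₀ (norm_nonneg _) h1 2
    have h3 := mul_le_mul_of_nonneg_left h2 (show 0 ≤ 4 / 5 * (n * μ) by positivity)
    simp only [hf]
    linarith
  have hpow : ∫ x in A, (∑ Y, if Y ∈ smallNoise x₀ (K * √n) then likelihood Y x else 0)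
      ∂(prior dens n) ≤ Real.exp (-(M ^ 2 / 32) * n) * (κ' * (√(n : ℝ))⁻¹ ^ d) ^ n := by
    have hgm : Integrable (fun x : Fin n → EuclideanSpace ℝ (Fin d) =>
        Real.exp (-(μ / 40 * n * ‖Q * latentMatrix x‖ ^ 2))) (prior dens n) := by
      refine Integrable.mono' (integrable_const 1) ?_ (ae_of_all _ fun x => ?_)
      · have h1 : ∀ x : Fin n → EuclideanSpace ℝ (Fin d), ‖Q * latentMatrix x‖ ^ 2 =
            ∑ i, ∑ k, (∑ j, Q i j * x j k) ^ 2 := fun x => by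
          rw [frobenius_sq_eq_sum]; simp [Matrix.mul_apply, latentMatrix]
        simp only [h1]
        exact Continuous.aestronglyMeasurable (by fun_prop)
      · rw [Real.norm_of_nonneg (Real.exp_pos _).le, Real.exp_le_one_iff, neg_nonpos]
        positivity
    calc _ ≤ ∫ x in A, Real.exp (-(M ^ 2 / 32) * n) *
          Real.exp (-(μ / 40 * n * ‖Q * latentMatrix x‖ ^ 2)) ∂(prior dens n) := by
          refine setIntegral_mono_on_ae ?_ (hgm.integrableOn.const_mul _) hAm ?_
          · refine integrable_finsetSum _ fun Y _ => ?_
            split_ifs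
            · exact (integrable_likelihood h Y).integrableOn
            · exact integrable_zero _ _ _
          · filter_upwards [ae_mem_configSpace h n] with x hx hxA
            have hxf := hfar x hxA
            have h1 := sum_likelihood_smallNoise_le hn hx hx₀.1 hμ hK hX₀
              ((mul_le_mul_of_nonneg_right hMK hn'.le).trans hxf)
            refine h1.trans ?_
            rw [← Real.exp_add]
            refine Real.exp_le_exp.2 ?_
            have h2 := hdist x
            simp only [hf] at h2 hxf
            linarith
      _ ≤ ∫ x, Real.exp (-(M ^ 2 / 32) * n) *
          Real.exp (-(μ / 40 * n * ‖Q * latentMatrix x‖ ^ 2)) ∂(prior dens n) :=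
          setIntegral_le_integral (hgm.const_mul _) (ae_of_all _ fun x => by positivity)
      _ ≤ _ := by
          rw [integral_const_mul]
          exact mul_le_mul_of_nonneg_left (hgauss Q hQ hQQ htr) (Real.exp_pos _).le
  have hint0 : 0 ≤ ∫ x in A, (∑ Y, if Y ∈ smallNoise x₀ (K * √n) then likelihood Y x else 0)
      ∂(prior dens n) := by
    refine integral_nonneg_of_ae ?_
    filter_upwards [ae_restrict_of_ae (ae_mem_configSpace h n)] with x hx
    refine Finset.sum_nonneg fun Y _ => ?_
    split_ifs
    · exact likelihood_nonneg hx Y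
    · exact le_rfl
  calc _ ≤ Real.exp n / (κ * (δ / (4 * √(n : ℝ))) ^ d) ^ n *
        (Real.exp (-(M ^ 2 / 32) * n) * (κ' * (√(n : ℝ))⁻¹ ^ d) ^ n) := by
        refine mul_le_mul (hden.trans ?_) hpow hint0 (by positivity)
        exact div_le_div_of_nonneg_left (Real.exp_pos _).le hB0 hball
    _ = Real.exp n * Real.exp (-(M ^ 2 / 32) * n) *
        (κ' * (√(n : ℝ))⁻¹ ^ d / (κ * (δ / (4 * √(n : ℝ))) ^ d)) ^ n := by
        rw [div_pow]; ring
    _ = _ := by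
        rw [← Real.exp_add]
        congr 2
        · ring
        · rw [show δ / (4 * √(n : ℝ)) = δ / 4 * (√(n : ℝ))⁻¹ by field_simp, mul_pow]
          have : (√(n : ℝ))⁻¹ ^ d ≠ 0 := by positivity
          field_simp

/-- The posterior distribution contracts at the rate `n ^ (-1 / 2)`, without a logarithmic factor
and with a constant that is uniform over the regular sequences. -/
lemma exists_posteriorContracts (hd : 0 < d) (h : IsPriorDensity dens)
    {Δ : Matrix (Fin d) (Fin d) ℝ} (hΔ : Δ.PosDef) {δ : ℝ} (hδ : 0 < δ) (hδ' : δ < 1 / 2) :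
    ∃ M₁ : ℝ, 0 < M₁ ∧ ∀ X₀ : (n : ℕ) → Fin n → EuclideanSpace ℝ (Fin d), IsRegular Δ δ X₀ →
      PosteriorContracts dens X₀ M₁ := by
  obtain ⟨hlam, hlamle⟩ := kthEigenvalue_last_pos_and_le hd hΔ
  set lam := kthEigenvalue hΔ.isHermitian ⟨d - 1, Nat.sub_lt hd one_pos⟩
  set μ := lam / 2 with hμdef
  have hμ : 0 < μ := by positivity
  obtain ⟨κ, hκ, hball⟩ := exists_prior_ball_ge h
  obtain ⟨κ', hκ', hgauss⟩ := exists_integral_prior_le h (c := μ / 40) (by positivity)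
  -- `K` makes the noise event fail with probability at most `2 exp (-n d)`; the two summands in
  -- `M ^ 2` make the test powerful and beat the exponential factors that remain
  set K : ℝ := 8 * (4 + d) with hK
  have hK0 : 0 < K := by positivity
  set ρ := κ' / (κ * (δ / 4) ^ d) with hρ
  have hρ0 : 0 < ρ := by positivity
  set M := √(20 * K ^ 2 / μ + 32 * (1 + ρ + d)) with hM
  have hMsq : M ^ 2 = 20 * K ^ 2 / μ + 32 * (1 + ρ + d) := Real.sq_sqrt (by positivity)
  have hM0 : 0 < M := Real.sqrt_pos.2 (by positivity)
  refine ⟨M, hM0, fun X₀ hX₀ => ?_⟩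
  have hlow := hX₀.eventually_lower hμ (fun w => by
    have := hlamle w
    rw [hμdef, mul_div_cancel₀ _ two_ne_zero]; exact this)
  unfold PosteriorContracts
  filter_upwards [hlow, hgauss, eventually_gt_atTop 0] with n hlow hgauss hn
  have hn' : (1 : ℝ) ≤ n := Nat.one_le_cast.2 hn
  have hr : 1 ≤ √(n : ℝ) := Real.one_le_sqrt.2 hn'
  have hd0 : (0 : ℝ) ≤ d := Nat.cast_nonneg d
  have hb := hball n (X₀ n) (hX₀.mem_latentSpace n) (δ / (4 * √n)) (by positivity)
    (by rw [div_le_one (by positivity)]; linarith)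
  refine (integral_posterior_far_le h hn hδ hδ' (hX₀.hasMargin n) hμ hK0 hM0
    (by rw [hMsq]; linarith) hlow hκ hb hgauss).trans ?_
  have h1 : Real.exp ((4 - K / 8) * n) ≤ Real.exp (-(1 / 2) * n * d) := by
    refine Real.exp_le_exp.2 ?_
    rw [hK]; nlinarith
  have h2 : √(Real.exp ((1 - M ^ 2 / 32) * n) * ρ ^ n) ≤ Real.exp (-(1 / 2) * n * d) := by
    rw [Real.sqrt_le_left (Real.exp_pos _).le, ← Real.exp_nat_mul]
    have h3 : ρ ^ n ≤ Real.exp (ρ * n) := by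
      rw [mul_comm, Real.exp_nat_mul]
      exact pow_le_pow_left₀ hρ0.le (by linarith [Real.add_one_le_exp ρ]) n
    refine (mul_le_mul_of_nonneg_left h3 (Real.exp_pos _).le).trans ?_
    rw [← Real.exp_add]
    refine Real.exp_le_exp.2 ?_
    have h4 : 0 ≤ 20 * K ^ 2 / μ / 32 * n := by positivity
    rw [hMsq]
    push_cast
    linarith
  have h3 := Real.exp_pos (-(1 / 2) * n * d)
  linarith

end Contraction

/-! ### The posterior mean and its spectral embedding -/

section PosteriorMean

variable {n d : ℕ} {dens : EuclideanSpace ℝ (Fin d) → ℝ}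

lemma integrable_inner_posterior (h : IsPriorDensity dens) {Y : Adjacency n}
    (hY : 0 < evidence dens Y) (i j : Fin n) :
    Integrable (fun x : Fin n → EuclideanSpace ℝ (Fin d) => (inner ℝ (x i) (x j) : ℝ))
      (posterior dens Y) := by
  have := isProbabilityMeasure_posterior h hY
  refine Integrable.mono' (integrable_const 1)
    (Continuous.aestronglyMeasurable (by fun_prop)) ?_
  filter_upwards [ae_posterior_mem h Y] with x hx
  rw [Real.norm_of_nonneg (inner_nonneg_of_mem_latentSpace (hx i) (hx j))]
  exact inner_le_one_of_mem_latentSpace (hx i) (hx j)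

lemma posteriorMean_apply (Y : Adjacency n) (i j : Fin n) :
    posteriorMean dens Y i j = ∫ x, (inner ℝ (x i) (x j) : ℝ) ∂(posterior dens Y) := by
  simp only [posteriorMean, Matrix.of_apply, latentMatrix_mul_transpose_apply]

lemma posSemidef_posteriorMean (h : IsPriorDensity dens) {Y : Adjacency n}
    (hY : 0 < evidence dens Y) : (posteriorMean dens Y).PosSemidef := by
  have := isProbabilityMeasure_posterior h hY
  refine Matrix.PosSemidef.of_dotProduct_mulVec_nonneg ?_ fun w => ?_
  · ext i j
    simp only [Matrix.conjTranspose_apply, posteriorMean_apply, star_trivial]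
    exact integral_congr_ae (ae_of_all _ fun x => real_inner_comm _ _)
  · have e1 : star w ⬝ᵥ (posteriorMean dens Y *ᵥ w) =
        ∫ x, ‖∑ i, w i • x i‖ ^ 2 ∂(posterior dens Y) := by
      have e2 : ∀ x : Fin n → EuclideanSpace ℝ (Fin d), ‖∑ i, w i • x i‖ ^ 2 =
          ∑ i, ∑ j, w i * w j * inner ℝ (x i) (x j) := fun x => by
        rw [← real_inner_self_eq_norm_sq, sum_inner]
        simp only [inner_sum, real_inner_smul_left, real_inner_smul_right]
        exact Finset.sum_congr rfl fun i _ => Finset.sum_congr rfl fun j _ => by ring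
      simp only [e2]
      rw [integral_finsetSum _ fun i _ => integrable_finsetSum _ fun j _ =>
        (integrable_inner_posterior h hY i j).const_mul _]
      simp only [dotProduct, Matrix.mulVec, Finset.mul_sum]
      refine Finset.sum_congr rfl fun i _ => ?_
      rw [integral_finsetSum _ fun j _ => (integrable_inner_posterior h hY i j).const_mul _]
      refine Finset.sum_congr rfl fun j _ => ?_
      rw [integral_const_mul, posteriorMean_apply]
      simp only [star_trivial]
      ring
    rw [e1]
    exact integral_nonneg fun x => by positivity

/-- Jensen's inequality for the squared Frobenius distance. -/
lemma frobenius_posteriorMean_sub_sq_le (h : IsPriorDensity dens) {Y : Adjacency n}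
    (hY : 0 < evidence dens Y) (C : Matrix (Fin n) (Fin n) ℝ) :
    Integrable (fun x => ‖latentMatrix x * (latentMatrix x)ᵀ - C‖ ^ 2) (posterior dens Y) ∧
    ‖posteriorMean dens Y - C‖ ^ 2 ≤
      ∫ x, ‖latentMatrix x * (latentMatrix x)ᵀ - C‖ ^ 2 ∂(posterior dens Y) := by
  have := isProbabilityMeasure_posterior h hY
  have hsq : ∀ i j, Integrable (fun x : Fin n → EuclideanSpace ℝ (Fin d) =>
      ((inner ℝ (x i) (x j) : ℝ) - C i j) ^ 2) (posterior dens Y) := fun i j => by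
    refine Integrable.mono' (integrable_const ((1 + |C i j|) ^ 2))
      (Continuous.aestronglyMeasurable (by fun_prop)) ?_
    filter_upwards [ae_posterior_mem h Y] with x hx
    rw [Real.norm_of_nonneg (sq_nonneg _), ← sq_abs]
    refine pow_le_pow_left₀ (abs_nonneg _) ((abs_sub _ _).trans ?_) 2
    rw [abs_of_nonneg (inner_nonneg_of_mem_latentSpace (hx i) (hx j))]
    linarith [inner_le_one_of_mem_latentSpace (hx i) (hx j)]
  simp only [frobenius_sq_eq_sum, Matrix.sub_apply, latentMatrix_mul_transpose_apply]
  refine ⟨integrable_finsetSum _ fun i _ => integrable_finsetSum _ fun j _ => hsq i j, ?_⟩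
  rw [integral_finsetSum _ fun i _ => integrable_finsetSum _ fun j _ => hsq i j]
  refine Finset.sum_le_sum fun i _ => ?_
  rw [integral_finsetSum _ fun j _ => hsq i j]
  refine Finset.sum_le_sum fun j _ => ?_
  have hI := integrable_inner_posterior h hY i j
  set m := posteriorMean dens Y i j with hm
  have hmI : ∫ x, (inner ℝ (x i) (x j) : ℝ) ∂(posterior dens Y) = m :=
    (posteriorMean_apply Y i j).symm
  have hIC : Integrable (fun x : Fin n → EuclideanSpace ℝ (Fin d) =>
      (inner ℝ (x i) (x j) : ℝ) - C i j) (posterior dens Y) := hI.sub (integrable_const _)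
  -- the tangent bound `t ^ 2 ≥ 2 s t - s ^ 2` at `s = m - C i j`
  have hle : ∫ x, (2 * (m - C i j) * ((inner ℝ (x i) (x j) : ℝ) - C i j) - (m - C i j) ^ 2)
      ∂(posterior dens Y) ≤ ∫ x, ((inner ℝ (x i) (x j) : ℝ) - C i j) ^ 2 ∂(posterior dens Y) := by
    refine integral_mono ((hIC.const_mul _).sub (integrable_const _))
      (hsq i j) fun x => ?_
    change 2 * (m - C i j) * ((inner ℝ (x i) (x j) : ℝ) - C i j) - (m - C i j) ^ 2 ≤
      ((inner ℝ (x i) (x j) : ℝ) - C i j) ^ 2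
    nlinarith [sq_nonneg ((inner ℝ (x i) (x j) : ℝ) - m)]
  rw [integral_sub (hIC.const_mul _) (integrable_const _),
    integral_const_mul, integral_sub hI (integrable_const _), hmI] at hle
  simp only [integral_const, probReal_univ, smul_eq_mul, one_mul] at hle
  linarith

/-- The posterior mean inherits the rate of the posterior, up to the posterior mass of the
complement of the Frobenius ball. -/
lemma frobenius_posteriorMean_sub_sq_le_add (h : IsPriorDensity dens) (hn : 0 < n) {Y : Adjacency n}
    (hY : 0 < evidence dens Y) {x₀ : Fin n → EuclideanSpace ℝ (Fin d)}
    (hx₀ : ∀ i, x₀ i ∈ latentSpace d) {M : ℝ} (hM : 0 < M) :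
    ‖posteriorMean dens Y - latentMatrix x₀ * (latentMatrix x₀)ᵀ‖ ^ 2 ≤
      M ^ 2 * n + n ^ 2 * (posterior dens Y).real
        {x | M / √(n : ℝ) < 1 / (n : ℝ) *
          ‖latentMatrix x * (latentMatrix x)ᵀ - latentMatrix x₀ * (latentMatrix x₀)ᵀ‖} := by
  have := isProbabilityMeasure_posterior h hY
  have hn' : (0 : ℝ) < n := Nat.cast_pos.2 hn
  have hr : (0 : ℝ) < √n := Real.sqrt_pos.2 hn'
  have hrr : √(n : ℝ) ^ 2 = n := Real.sq_sqrt hn'.le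
  set A := {x : Fin n → EuclideanSpace ℝ (Fin d) | M / √(n : ℝ) < 1 / (n : ℝ) *
    ‖latentMatrix x * (latentMatrix x)ᵀ - latentMatrix x₀ * (latentMatrix x₀)ᵀ‖} with hA
  have hAm : MeasurableSet A := (isOpen_lt continuous_const
    (continuous_const.mul (continuous_frobenius_gram_sub _))).measurableSet
  obtain ⟨hint, hle⟩ := frobenius_posteriorMean_sub_sq_le h hY
    (latentMatrix x₀ * (latentMatrix x₀)ᵀ)
  refine hle.trans ?_
  have hind : Integrable (A.indicator fun _ => (n : ℝ) ^ 2) (posterior dens Y) :=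
    (integrable_const _).indicator hAm
  have hb : ∫ x, ‖latentMatrix x * (latentMatrix x)ᵀ - latentMatrix x₀ * (latentMatrix x₀)ᵀ‖ ^ 2
      ∂(posterior dens Y) ≤
      ∫ x, (M ^ 2 * n + A.indicator (fun _ => (n : ℝ) ^ 2) x) ∂(posterior dens Y) := by
    refine integral_mono_ae hint ((integrable_const _).add hind) ?_
    filter_upwards [ae_posterior_mem h Y] with x hx
    by_cases hxA : x ∈ A
    · rw [Set.indicator_of_mem hxA]
      have := frobenius_gram_sub_gram_le hx hx₀
      have h0 : 0 ≤ M ^ 2 * n := by positivity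
      linarith
    · rw [Set.indicator_of_notMem hxA, add_zero]
      have hx' := not_lt.1 (show ¬ (M / √(n : ℝ) < 1 / (n : ℝ) *
        ‖latentMatrix x * (latentMatrix x)ᵀ - latentMatrix x₀ * (latentMatrix x₀)ᵀ‖) from hxA)
      rw [one_div, ← div_eq_inv_mul, div_le_div_iff₀ hn' hr] at hx'
      have h1 := le_of_mul_le_mul_right (a := √(n : ℝ)) (b := ‖latentMatrix x * (latentMatrix x)ᵀ -
        latentMatrix x₀ * (latentMatrix x₀)ᵀ‖) (c := M * √n)
        (by rw [mul_assoc, ← sq, hrr]; exact hx') hr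
      calc _ ≤ (M * √n) ^ 2 := pow_le_pow_left₀ (norm_nonneg _) h1 2
        _ = M ^ 2 * n := by rw [mul_pow, hrr]
  refine hb.trans (le_of_eq ?_)
  rw [integral_add (integrable_const _) hind, integral_indicator_const _ hAm]
  simp [mul_comm]

/-- The bound from Markov's inequality is eventually below the large deviation bound, as `M √n ≤ n`
for `n ≥ M ^ 2`. -/
lemma eventually_mul_exp_le {M : ℝ} (hM : 0 < M) (hd : 0 < d) :
    ∀ᶠ n : ℕ in atTop, n / (3 * M ^ 2) * (8 * Real.exp (-(1 / 2) * n * d)) ≤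
      2 * Real.exp (-(1 / 4) * M * d * √(n : ℝ)) := by
  have h1 : Tendsto (fun n : ℕ => (n : ℝ) * Real.exp (-(1 / 4) * n)) atTop (𝓝 0) := by
    have := (Real.tendsto_pow_mul_exp_neg_atTop_nhds_zero 1).comp
      ((tendsto_natCast_atTop_atTop (R := ℝ)).const_mul_atTop (show (0 : ℝ) < 1 / 4 by norm_num))
    have h2 := this.const_mul 4
    rw [mul_zero] at h2
    refine h2.congr fun n => ?_
    simp only [Function.comp, pow_one, neg_mul]
    ring
  have hc : (0 : ℝ) < 3 * M ^ 2 / 4 := by positivity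
  filter_upwards [h1.eventually (gt_mem_nhds hc), eventually_ge_atTop ⌈M ^ 2⌉₊,
    eventually_gt_atTop 0] with n hn hnM hn0
  have hn' : (0 : ℝ) < n := Nat.cast_pos.2 hn0
  have hd1 : (1 : ℝ) ≤ d := Nat.one_le_cast.2 hd
  have hM2 : M ^ 2 ≤ n := (Nat.le_ceil _).trans (Nat.cast_le.2 hnM)
  have hMr : M ≤ √n := Real.le_sqrt_of_sq_le hM2
  have hMn : M * √n ≤ n := by
    calc M * √n ≤ √n * √n := mul_le_mul_of_nonneg_right hMr (Real.sqrt_nonneg _)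
      _ = n := Real.mul_self_sqrt hn'.le
  have h2 : Real.exp (-(1 / 2) * n * d) ≤
      Real.exp (-(1 / 4) * n) * Real.exp (-(1 / 4) * M * d * √(n : ℝ)) := by
    rw [← Real.exp_add]
    refine Real.exp_le_exp.2 ?_
    have h3 : M * √n * d ≤ n * d := mul_le_mul_of_nonneg_right hMn (by linarith)
    have h4 : (n : ℝ) ≤ n * d := le_mul_of_one_le_right hn'.le hd1
    linarith
  calc n / (3 * M ^ 2) * (8 * Real.exp (-(1 / 2) * n * d))
      ≤ n / (3 * M ^ 2) * (8 * (Real.exp (-(1 / 4) * n) *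
        Real.exp (-(1 / 4) * M * d * √(n : ℝ)))) := by gcongr
    _ = n * Real.exp (-(1 / 4) * n) * (8 / (3 * M ^ 2)) *
        Real.exp (-(1 / 4) * M * d * √(n : ℝ)) := by ring
    _ ≤ 3 * M ^ 2 / 4 * (8 / (3 * M ^ 2)) * Real.exp (-(1 / 4) * M * d * √(n : ℝ)) := by gcongr
    _ = _ := by field_simp; norm_num

/-- The embedding of the posterior mean attains the rate `1 / n`, and its eigenvectors concentrate
around the left singular vectors of the truth. -/
lemma exists_embedding_risk_le (hd : 0 < d) (h : IsPriorDensity dens)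
    {Δ : Matrix (Fin d) (Fin d) ℝ} (hΔ : Δ.PosDef) {δ : ℝ} (hδ : 0 < δ) (hδ' : δ < 1 / 2)
    {M : ℝ} (hM : 0 < M) :
    ∃ C : ℝ, 0 < C ∧ ∀ X₀ : (n : ℕ) → Fin n → EuclideanSpace ℝ (Fin d), IsRegular Δ δ X₀ →
      PosteriorContracts dens X₀ M → ∀ᶠ n : ℕ in atTop,
        ∀ (Uhat : Adjacency n → Matrix (Fin n) (Fin d) ℝ) (Shat : Adjacency n → Fin d → ℝ),
          (∀ Y, IsLeadingEigenpairs (posteriorMean dens Y) (Uhat Y) (Shat Y)) →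
          (∫ Y, 1 / (n : ℝ) * procrustesSq
              (Uhat Y * Matrix.diagonal fun k => √(Shat Y k)) (latentMatrix (X₀ n))
            ∂(rdpg (X₀ n)) ≤ C / n) ∧
          ∀ U₀ : Matrix (Fin n) (Fin d) ℝ, IsLeftSingularMatrix (latentMatrix (X₀ n)) U₀ →
            (rdpg (X₀ n)).real
                {Y | 128 * M ^ 2 * d /
                    ((kthEigenvalue hΔ.isHermitian ⟨d - 1, Nat.sub_lt hd one_pos⟩) ^ 2 * n)
                  < procrustesSq (Uhat Y) U₀} ≤
              2 * Real.exp (-(1 / 4) * M * d * √(n : ℝ)) := by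
  classical
  obtain ⟨hlam, hlamle⟩ := kthEigenvalue_last_pos_and_le hd hΔ
  set lam := kthEigenvalue hΔ.isHermitian ⟨d - 1, Nat.sub_lt hd one_pos⟩
  set μ := lam / 2 with hμdef
  have hμ : 0 < μ := by positivity
  have hlam2 : lam = 2 * μ := by rw [hμdef]; ring
  refine ⟨5 / μ * (M ^ 2 + 16), by positivity, fun X₀ hX₀ hcon => ?_⟩
  have hlow := hX₀.eventually_lower hμ (fun w => hlam2 ▸ hlamle w)
  filter_upwards [hlow, hcon, eventually_mul_exp_le hM hd, eventually_gt_atTop 0]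
    with n hlow hcon hexp hn Uhat Shat hUS
  have hn' : (0 : ℝ) < n := Nat.cast_pos.2 hn
  have hd1 : (1 : ℝ) ≤ d := Nat.one_le_cast.2 hd
  have hx₀ := hX₀.mem_latentSpace n
  have hev := fun Y => evidence_pos h hn hδ hδ' (hX₀.hasMargin n) Y
  set P₀ := latentMatrix (X₀ n) * (latentMatrix (X₀ n))ᵀ
  set q : Adjacency n → ℝ := fun Y => (posterior dens Y).real
    {x | M / √(n : ℝ) < 1 / (n : ℝ) * ‖latentMatrix x * (latentMatrix x)ᵀ - P₀‖} with hq
  have hq0 : ∀ Y, 0 ≤ q Y := fun Y => measureReal_nonneg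
  have hP : ∀ Y, ‖posteriorMean dens Y - P₀‖ ^ 2 ≤ M ^ 2 * n + n ^ 2 * q Y := fun Y =>
    frobenius_posteriorMean_sub_sq_le_add h hn (hev Y) hx₀ hM
  have hemb := fun Y => procrustesSq_embedding_le hd (σ := n * μ) (by positivity) hlow
    (posSemidef_posteriorMean h (hev Y)) (hUS Y)
  have hcon' : ∫ Y, q Y ∂(rdpg (X₀ n)) ≤ 8 * Real.exp (-(1 / 2) * n * d) := hcon
  have hcon'' := hcon'
  rw [integral_rdpg hx₀] at hcon'
  constructor
  · have h1 : ∫ Y, 1 / (n : ℝ) * procrustesSq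
        (Uhat Y * Matrix.diagonal fun k => √(Shat Y k)) (latentMatrix (X₀ n)) ∂(rdpg (X₀ n)) ≤
        ∫ Y, 5 / μ / n * (M ^ 2 + n * q Y) ∂(rdpg (X₀ n)) := by
      refine integral_mono Integrable.of_finite Integrable.of_finite fun Y => ?_
      have h2 := (hemb Y).1.trans (mul_le_mul_of_nonneg_left (hP Y) (by norm_num))
      set p := procrustesSq (Uhat Y * Matrix.diagonal fun k => √(Shat Y k)) (latentMatrix (X₀ n))
      have h3 : p ≤ 5 / μ * (M ^ 2 + n * q Y) := by
        rw [div_mul_eq_mul_div, le_div_iff₀ hμ]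
        refine le_of_mul_le_mul_left ?_ hn'
        linarith
      change 1 / (n : ℝ) * p ≤ 5 / μ / n * (M ^ 2 + n * q Y)
      calc 1 / (n : ℝ) * p ≤ 1 / n * (5 / μ * (M ^ 2 + n * q Y)) :=
            mul_le_mul_of_nonneg_left h3 (by positivity)
        _ = _ := by ring
    refine h1.trans ?_
    rw [integral_const_mul, integral_add (integrable_const _) Integrable.of_finite,
      integral_const_mul, integral_const, probReal_univ, one_smul]
    have h4 : (n : ℝ) * Real.exp (-(1 / 2) * n * d) ≤ 2 := by
      have h5 : Real.exp (-(1 / 2) * n * d) ≤ Real.exp (-(n / 2)) := by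
        refine Real.exp_le_exp.2 ?_
        nlinarith
      have h6 := Real.add_one_le_exp ((n : ℝ) / 2)
      have h7 : Real.exp (n / 2) * Real.exp (-(n / 2 : ℝ)) = 1 := by rw [← Real.exp_add]; simp
      have h8 := Real.exp_pos (-(n / 2 : ℝ))
      nlinarith
    calc 5 / μ / n * (M ^ 2 + n * ∫ Y, q Y ∂(rdpg (X₀ n)))
        ≤ 5 / μ / n * (M ^ 2 + n * (8 * Real.exp (-(1 / 2) * n * d))) := by gcongr
      _ ≤ 5 / μ / n * (M ^ 2 + 16) := by
          refine mul_le_mul_of_nonneg_left ?_ (by positivity)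
          linarith
      _ = _ := by ring
  · intro U₀ hU₀
    -- On the exceptional event the posterior mass `q Y` is at least of order `1 / n`:
    -- otherwise `‖P - X₀ X₀ᵀ‖² ≤ 4 M² n`, and `8 * 4 M² n / (n μ)² = 128 M² / (lam² n)`.
    have hsub : {Y | 128 * M ^ 2 * d / (lam ^ 2 * n) < procrustesSq (Uhat Y) U₀} ⊆
        {Y | 3 * M ^ 2 / n ≤ q Y} := by
      intro Y hY
      by_contra hlt
      have hlt' : q Y < 3 * M ^ 2 / n := not_le.1 hlt
      have hY' : 128 * M ^ 2 * d / (lam ^ 2 * n) < procrustesSq (Uhat Y) U₀ := hY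
      have h1 : (n : ℝ) ^ 2 * q Y ≤ 3 * M ^ 2 * n := by
        rw [lt_div_iff₀ hn'] at hlt'
        nlinarith
      have h2 := ((hemb Y).2 U₀ hU₀).trans (mul_le_mul_of_nonneg_left (hP Y) (by norm_num))
      have h3 : (n * μ) ^ 2 * procrustesSq (Uhat Y) U₀ ≤ 32 * M ^ 2 * n := by linarith
      rw [div_lt_iff₀ (by positivity), hlam2] at hY'
      have h4 : 128 * M ^ 2 ≤ 128 * M ^ 2 * d := le_mul_of_one_le_right (by positivity) hd1
      have h5 : 128 * M ^ 2 * n < 128 * M ^ 2 * n := by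
        calc 128 * M ^ 2 * n < procrustesSq (Uhat Y) U₀ * ((2 * μ) ^ 2 * n) * n :=
              mul_lt_mul_of_pos_right (h4.trans_lt hY') hn'
          _ = 4 * ((n * μ) ^ 2 * procrustesSq (Uhat Y) U₀) := by ring
          _ ≤ 4 * (32 * M ^ 2 * n) := by linarith
          _ = _ := by ring
      exact lt_irrefl _ h5
    have hmk := mul_meas_ge_le_integral_of_nonneg (μ := rdpg (X₀ n)) (f := q)
      (ae_of_all _ hq0) Integrable.of_finite (3 * M ^ 2 / n)
    have h6 : (rdpg (X₀ n)).real {Y | 3 * M ^ 2 / n ≤ q Y} ≤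
        n / (3 * M ^ 2) * (8 * Real.exp (-(1 / 2) * n * d)) := by
      rw [div_mul_eq_mul_div, le_div_iff₀ (by positivity)]
      have h7 := hmk.trans hcon''
      rw [div_mul_eq_mul_div, div_le_iff₀ hn'] at h7
      linarith
    exact (measureReal_mono hsub).trans (h6.trans hexp)

end PosteriorMean

/-! ### The minimax lower bound -/

section LowerBound

variable {n d : ℕ}

/-- The norms of the rows do not depend on the orthogonal transformation, so that their estimation
error bounds the Procrustes distance from below. -/
lemma sum_row_norm_sub_sq_le_procrustesSq (A B : Matrix (Fin n) (Fin d) ℝ) :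
    ∑ i, (√(∑ k, A i k ^ 2) - √(∑ k, B i k ^ 2)) ^ 2 ≤ procrustesSq A B := by
  refine le_ciInf fun W => ?_
  have hW : (W : Matrix (Fin d) (Fin d) ℝ) * (W : Matrix (Fin d) (Fin d) ℝ)ᵀ = 1 :=
    (Matrix.mem_orthogonalGroup_iff _ _).1 W.2
  set D := B * (W : Matrix (Fin d) (Fin d) ℝ) with hD
  have hrow : ∀ i, ∑ k, D i k ^ 2 = ∑ k, B i k ^ 2 := by
    intro i
    have h1 : D * Dᵀ = B * Bᵀ := by
      rw [hD, Matrix.transpose_mul, Matrix.mul_assoc,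
        ← Matrix.mul_assoc (W : Matrix (Fin d) (Fin d) ℝ), hW, Matrix.one_mul]
    have h2 := congrFun (congrFun h1 i) i
    simpa [Matrix.mul_apply, sq] using h2
  rw [frobenius_sq_eq_sum]
  refine Finset.sum_le_sum fun i _ => ?_
  rw [← hrow i]
  have h1 := Real.sum_mul_le_sqrt_mul_sqrt Finset.univ (fun k => A i k) (fun k => D i k)
  have h2 : √(∑ k, A i k ^ 2) ^ 2 = ∑ k, A i k ^ 2 :=
    Real.sq_sqrt (Finset.sum_nonneg fun k _ => sq_nonneg _)
  have h3 : √(∑ k, D i k ^ 2) ^ 2 = ∑ k, D i k ^ 2 :=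
    Real.sq_sqrt (Finset.sum_nonneg fun k _ => sq_nonneg _)
  have h4 : ∑ k, (A - D) i k ^ 2 =
      ∑ k, A i k ^ 2 - 2 * ∑ k, A i k * D i k + ∑ k, D i k ^ 2 := by
    rw [Finset.mul_sum, ← Finset.sum_sub_distrib, ← Finset.sum_add_distrib]
    exact Finset.sum_congr rfl fun k _ => by rw [Matrix.sub_apply]; ring
  rw [h4]
  nlinarith

/-- Le Cam's two-point bound: if two configurations have a bounded `χ²`-affinity, then no statistic
is close to `a` under the first and close to `b` under the second. -/
lemma sq_sub_le_sum_risk {x y : Fin n → EuclideanSpace ℝ (Fin d)}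
    (hx : ∀ Y : Adjacency n, 0 < likelihood Y x) (hy : ∀ Y : Adjacency n, 0 ≤ likelihood Y y)
    {K : ℝ} (hK1 : 1 ≤ K) (hK : ∑ Y, likelihood Y y ^ 2 / likelihood Y x ≤ K)
    (r : Adjacency n → ℝ) (a b : ℝ) :
    (a - b) ^ 2 / (2 * K) ≤
      ∑ Y, likelihood Y x * (r Y - a) ^ 2 + ∑ Y, likelihood Y y * (r Y - b) ^ 2 := by
  set F := ∑ Y, likelihood Y x * (r Y - a) ^ 2 with hF
  set G := ∑ Y, likelihood Y y * (r Y - b) ^ 2 with hG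
  have hF0 : 0 ≤ F := Finset.sum_nonneg fun Y _ => mul_nonneg (hx Y).le (sq_nonneg _)
  have hG0 : 0 ≤ G := Finset.sum_nonneg fun Y _ => mul_nonneg (hy Y) (sq_nonneg _)
  set f := ∑ Y, likelihood Y y * (r Y - a) with hf
  set g := ∑ Y, likelihood Y y * (r Y - b) with hg
  have h1 : f ^ 2 ≤ (∑ Y, likelihood Y y ^ 2 / likelihood Y x) * F :=
    Finset.sum_sq_le_sum_mul_sum_of_sq_le_mul _
      (fun Y _ => div_nonneg (sq_nonneg _) (hx Y).le)
      (fun Y _ => mul_nonneg (hx Y).le (sq_nonneg _))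
      fun Y _ => le_of_eq (by have := (hx Y).ne'; field_simp)
  have h2 : g ^ 2 ≤ (∑ Y : Adjacency n, likelihood Y y) * G :=
    Finset.sum_sq_le_sum_mul_sum_of_sq_le_mul _ (fun Y _ => hy Y)
      (fun Y _ => mul_nonneg (hy Y) (sq_nonneg _)) fun Y _ => le_of_eq (by ring)
  rw [sum_likelihood, one_mul] at h2
  have h3 : g - f = a - b := by
    rw [hf, hg, ← Finset.sum_sub_distrib]
    calc _ = ∑ Y : Adjacency n, likelihood Y y * (a - b) :=
          Finset.sum_congr rfl fun Y _ => by ring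
      _ = _ := by rw [← Finset.sum_mul, sum_likelihood, one_mul]
  have h4 : f ^ 2 ≤ K * F := h1.trans (mul_le_mul_of_nonneg_right hK hF0)
  have h5 : G ≤ K * G := le_mul_of_one_le_left hG0 hK1
  rw [div_le_iff₀ (by positivity), ← h3]
  nlinarith [sq_nonneg (g + f)]

/-- The nonzero coordinate `1 / 2 + τ_i / (4 √n)` of a row of `cubeConfig`. -/
def cubeCoord (τ : Fin n → Bool) (i : Fin n) : ℝ := 1 / 2 + if τ i then 1 / (4 * √(n : ℝ)) else 0

/-- The configuration on the first coordinate axis given by a vertex `τ` of the hypercube: row `i`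
is `(1 / 2 + τ_i / (4 √n)) e_1`. -/
def cubeConfig (hd : 0 < d) (τ : Fin n → Bool) : Fin n → EuclideanSpace ℝ (Fin d) :=
  fun i => EuclideanSpace.single ⟨0, hd⟩ (cubeCoord τ i)

lemma cubeCoord_mem (hn : 0 < n) (τ : Fin n → Bool) (i : Fin n) :
    1 / 2 ≤ cubeCoord τ i ∧ cubeCoord τ i ≤ 3 / 4 := by
  have hr : 1 ≤ √(n : ℝ) := Real.one_le_sqrt.2 (Nat.one_le_cast.2 hn)
  have h1 : 0 < 1 / (4 * √(n : ℝ)) := by positivity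
  have h2 : 1 / (4 * √(n : ℝ)) ≤ 1 / 4 := one_div_le_one_div_of_le (by norm_num) (by linarith)
  unfold cubeCoord
  split_ifs <;> constructor <;> linarith

lemma cubeConfig_mem (hd : 0 < d) (hn : 0 < n) (τ : Fin n → Bool) (i : Fin n) :
    cubeConfig hd τ i ∈ latentSpace d := by
  have h := cubeCoord_mem hn τ i
  refine ⟨?_, fun k => ?_⟩
  · rw [cubeConfig, PiLp.norm_single, Real.norm_of_nonneg (by linarith)]; linarith
  · rw [cubeConfig, PiLp.single_apply]
    split_ifs
    · linarith
    · exact le_rfl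

lemma edgeProb_cubeConfig (hd : 0 < d) (τ : Fin n → Bool) (e : VertexPair n) :
    edgeProb (cubeConfig hd τ) e = cubeCoord τ e.1.1 * cubeCoord τ e.1.2 := by
  rw [edgeProb, cubeConfig, cubeConfig, EuclideanSpace.inner_single_left]
  simp

lemma row_norm_cubeConfig (hd : 0 < d) (hn : 0 < n) (τ : Fin n → Bool) (i : Fin n) :
    √(∑ k, latentMatrix (cubeConfig hd τ) i k ^ 2) = cubeCoord τ i := by
  have h1 := EuclideanSpace.norm_eq (cubeConfig hd τ i)
  have h2 : ‖cubeConfig hd τ i‖ = cubeCoord τ i := by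
    rw [cubeConfig, PiLp.norm_single, Real.norm_of_nonneg (by linarith [(cubeCoord_mem hn τ i).1])]
  rw [← h2, h1]
  simp [latentMatrix]

lemma likelihood_cubeConfig_pos (hd : 0 < d) (hn : 0 < n) (τ : Fin n → Bool) (Y : Adjacency n) :
    0 < likelihood Y (cubeConfig hd τ) := by
  refine Finset.prod_pos fun e _ => ?_
  have h1 := cubeCoord_mem hn τ e.1.1
  have h2 := cubeCoord_mem hn τ e.1.2
  rw [edgeProb_cubeConfig]
  split_ifs <;> nlinarith

/-- Flip the `i`-th coordinate of a point of the hypercube. -/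
def flipAt (i : Fin n) (τ : Fin n → Bool) : Fin n → Bool := Function.update τ i (!τ i)

lemma flipAt_involutive (i : Fin n) : Function.Involutive (flipAt i) := fun τ => by
  simp [flipAt]

lemma sq_cubeCoord_sub_flipAt (τ : Fin n → Bool) (i : Fin n) :
    (cubeCoord τ i - cubeCoord (flipAt i τ) i) ^ 2 = 1 / (16 * n) := by
  have hrr : √(n : ℝ) ^ 2 = n := Real.sq_sqrt (Nat.cast_nonneg n)
  have h1 : (1 / (4 * √(n : ℝ))) ^ 2 = 1 / (16 * n) := by
    rw [div_pow, mul_pow, hrr]; norm_num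
  rw [← h1]
  cases h : τ i <;> simp [cubeCoord, flipAt, h]

lemma cubeCoord_flipAt_of_ne {i j : Fin n} (hij : j ≠ i) (τ : Fin n → Bool) :
    cubeCoord (flipAt i τ) j = cubeCoord τ j := by
  simp [cubeCoord, flipAt, Function.update_of_ne hij]

/-- Neighbouring vertices of the hypercube are statistically indistinguishable: of the edge
probabilities at most `n` differ, each by a multiple of `1 / √n`. The summand of `c` for an edge is
`2 / n` for each of its endpoints that equals `i`. -/
lemma sum_likelihood_sq_div_flipAt_le (hd : 0 < d) (hn : 0 < n) (τ : Fin n → Bool) (i : Fin n) :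
    ∑ Y, likelihood Y (cubeConfig hd (flipAt i τ)) ^ 2 / likelihood Y (cubeConfig hd τ) ≤
      Real.exp 4 := by
  have hn' : (0 : ℝ) < n := Nat.cast_pos.2 hn
  set c : Fin n × Fin n → ℝ := fun e => (if e.1 = i then 2 / (n : ℝ) else 0) +
    if e.2 = i then 2 / (n : ℝ) else 0 with hc
  have h2n : 0 ≤ 2 / (n : ℝ) := by positivity
  have hc0 : ∀ e, 0 ≤ c e := fun e => by
    simp only [hc]
    split_ifs <;> linarith
  refine (sum_likelihood_sq_div_le (c := fun e => c e.1) (fun e => ?_) fun e => ?_).trans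
    (Real.exp_le_exp.2 ?_)
  · have h1 := cubeCoord_mem hn τ e.1.1
    have h2 := cubeCoord_mem hn τ e.1.2
    rw [edgeProb_cubeConfig]
    constructor <;> nlinarith
  · rw [edgeProb_cubeConfig, edgeProb_cubeConfig]
    obtain ⟨⟨a, b⟩, hab⟩ := e
    dsimp only
    obtain ⟨ha1, ha2⟩ := cubeCoord_mem hn τ a
    obtain ⟨hb1, hb2⟩ := cubeCoord_mem hn τ b
    by_cases h : a = i ∨ b = i
    · have hcge : 2 / (n : ℝ) ≤ c (a, b) := by
        simp only [hc]
        rcases h with h | h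
        · rw [if_pos h]; split_ifs <;> linarith
        · rw [if_pos h]; split_ifs <;> linarith
      have hstep : ∀ j, (cubeCoord (flipAt i τ) j - cubeCoord τ j) ^ 2 ≤ 1 / (16 * n) := by
        intro j
        by_cases hj : j = i
        · rw [hj, ← sq_cubeCoord_sub_flipAt τ i]; exact le_of_eq (by ring)
        · rw [cubeCoord_flipAt_of_ne hj, sub_self, zero_pow two_ne_zero]; positivity
      obtain ⟨ha3, ha4⟩ := cubeCoord_mem hn (flipAt i τ) a
      have h1 := hstep a
      have h2 := hstep b
      set p := cubeCoord τ a
      set q := cubeCoord τ b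
      set p' := cubeCoord (flipAt i τ) a
      set q' := cubeCoord (flipAt i τ) b
      set t : ℝ := 1 / (16 * n) with ht
      have ht0 : 0 < t := by positivity
      have ht2 : 2 / (n : ℝ) = 32 * t := by rw [ht]; field_simp; norm_num
      have h3 : (p' * q' - p * q) ^ 2 ≤ 9 / 4 * t := by
        have e1 : p' * q' - p * q = p' * (q' - q) + q * (p' - p) := by ring
        have b1 : (p' * (q' - q)) ^ 2 ≤ 9 / 16 * t := by
          rw [mul_pow]; exact mul_le_mul (by nlinarith) h2 (sq_nonneg _) (by norm_num)
        have b2 : (q * (p' - p)) ^ 2 ≤ 9 / 16 * t := by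
          rw [mul_pow]; exact mul_le_mul (by nlinarith) h1 (sq_nonneg _) (by norm_num)
        rw [e1]
        nlinarith [sq_nonneg (p' * (q' - q) - q * (p' - p))]
      have h4 : 7 / 64 ≤ p * q * (1 - p * q) := by
        have hp1 : 1 / 4 ≤ p * q := by nlinarith
        have hp2 : p * q ≤ 9 / 16 := by nlinarith
        nlinarith
      calc _ ≤ 9 / 4 * t := h3
        _ ≤ 32 * t * (7 / 64) := by linarith
        _ ≤ c (a, b) * (p * q * (1 - p * q)) :=
          mul_le_mul (ht2 ▸ hcge) h4 (by norm_num) (hc0 _)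
    · push Not at h
      rw [cubeCoord_flipAt_of_ne h.1, cubeCoord_flipAt_of_ne h.2, sub_self, zero_pow two_ne_zero]
      have := hc0 (a, b)
      have h1 : cubeCoord τ a * cubeCoord τ b ≤ 1 := by nlinarith
      have h2 : 0 ≤ 1 - cubeCoord τ a * cubeCoord τ b := by linarith
      have h3 : 0 ≤ cubeCoord τ a * cubeCoord τ b := by nlinarith
      exact mul_nonneg this (mul_nonneg h3 h2)
  · calc ∑ e : VertexPair n, c e.1 = ∑ e with e.1 ≤ e.2, c e :=
          (Finset.sum_subtype _ (by simp) c).symm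
      _ ≤ ∑ e, c e := Finset.sum_le_univ_sum_of_nonneg hc0
      _ = 4 := by
          simp only [hc, Finset.sum_add_distrib, Fintype.sum_prod_type]
          have h1 : (n : ℝ) * (2 / n) = 2 := by field_simp
          rw [Finset.sum_comm]
          simp only [Finset.sum_ite_eq', Finset.sum_const, Finset.mem_univ, if_true,
            Finset.card_univ, Fintype.card_fin, nsmul_eq_mul, h1]
          norm_num

/-- Assouad's lemma on the hypercube `cubeConfig`: no estimator attains a rate better than `1 / n`.
-/
lemma exists_le_risk (hd : 0 < d) (hn : 0 < n) (Xhat : Adjacency n → Matrix (Fin n) (Fin d) ℝ) :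
    ∃ X : Fin n → EuclideanSpace ℝ (Fin d), (∀ i, X i ∈ latentSpace d) ∧
      1 / (64 * Real.exp 4) / n ≤
        ∫ Y, 1 / (n : ℝ) * procrustesSq (Xhat Y) (latentMatrix X) ∂(rdpg X) := by
  have hn' : (0 : ℝ) < n := Nat.cast_pos.2 hn
  set K := Real.exp 4
  have hK1 : 1 ≤ K := Real.one_le_exp (by norm_num)
  let r : Fin n → Adjacency n → ℝ := fun i Y => √(∑ k, Xhat Y i k ^ 2)
  let R : (Fin n → Bool) → Fin n → ℝ := fun τ i =>
    ∑ Y, likelihood Y (cubeConfig hd τ) * (r i Y - cubeCoord τ i) ^ 2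
  -- each pair of neighbours in direction `i` contributes, and the average over the hypercube is the
  -- average over such pairs
  have hpair : ∀ τ i, 1 / (16 * n) / (2 * K) ≤ R τ i + R (flipAt i τ) i := fun τ i => by
    rw [← sq_cubeCoord_sub_flipAt τ i]
    exact sq_sub_le_sum_risk (likelihood_cubeConfig_pos hd hn τ)
      (fun Y => (likelihood_cubeConfig_pos hd hn _ Y).le) hK1
      (sum_likelihood_sq_div_flipAt_le hd hn τ i) (r i) _ _
  have hsum : ∀ i, ∑ _τ : Fin n → Bool, 1 / (16 * n) / (4 * K) ≤ ∑ τ, R τ i := fun i => by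
    have h1 : ∑ τ, R (flipAt i τ) i = ∑ τ, R τ i :=
      Equiv.sum_comp (flipAt_involutive i).toPerm fun τ => R τ i
    have h2 : ∑ _τ : Fin n → Bool, 1 / (16 * n) / (2 * K) ≤ ∑ τ, (R τ i + R (flipAt i τ) i) :=
      Finset.sum_le_sum fun τ _ => hpair τ i
    rw [Finset.sum_add_distrib, h1] at h2
    have h3 : ∑ _τ : Fin n → Bool, 1 / (16 * n) / (2 * K) =
        2 * ∑ _τ : Fin n → Bool, 1 / (16 * n) / (4 * K) := by
      rw [Finset.mul_sum]
      exact Finset.sum_congr rfl fun τ _ => by field_simp; norm_num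
    linarith
  obtain ⟨τ, -, hτ⟩ := Finset.exists_le_of_sum_le (s := (Finset.univ : Finset (Fin n → Bool)))
    (f := fun _ => ∑ _i : Fin n, 1 / (16 * n) / (4 * K)) (g := fun τ => ∑ i, R τ i)
    Finset.univ_nonempty (by
      rw [Finset.sum_comm, Finset.sum_comm (f := R)]
      exact Finset.sum_le_sum fun i _ => hsum i)
  refine ⟨cubeConfig hd τ, cubeConfig_mem hd hn τ, ?_⟩
  rw [integral_rdpg (cubeConfig_mem hd hn τ)]
  have h1 : ∑ i, R τ i ≤ ∑ Y, likelihood Y (cubeConfig hd τ) *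
      procrustesSq (Xhat Y) (latentMatrix (cubeConfig hd τ)) := by
    rw [Finset.sum_comm]
    refine Finset.sum_le_sum fun Y _ => ?_
    rw [← Finset.mul_sum]
    refine mul_le_mul_of_nonneg_left ?_ (likelihood_cubeConfig_pos hd hn τ Y).le
    have := sum_row_norm_sub_sq_le_procrustesSq (Xhat Y) (latentMatrix (cubeConfig hd τ))
    simpa only [row_norm_cubeConfig hd hn] using this
  rw [Finset.sum_const, Finset.card_univ, Fintype.card_fin, nsmul_eq_mul] at hτ
  calc 1 / (64 * K) / n = 1 / n * (n * (1 / (16 * n) / (4 * K))) := by field_simp; norm_num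
    _ ≤ 1 / n * ∑ Y, likelihood Y (cubeConfig hd τ) *
        procrustesSq (Xhat Y) (latentMatrix (cubeConfig hd τ)) :=
        mul_le_mul_of_nonneg_left (hτ.trans h1) (by positivity)
    _ = _ := by
        rw [Finset.mul_sum]
        exact Finset.sum_congr rfl fun Y _ => by ring

end LowerBound

end RDPG

end

theorem mainTheorem3 (d : ℕ) (hd : 0 < d)
    (dens : EuclideanSpace ℝ (Fin d) → ℝ) (hdens : RDPG.IsPriorDensity dens)
    (Δ : Matrix (Fin d) (Fin d) ℝ) (hΔ : Δ.PosDef)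
    (δ : ℝ) (hδ : 0 < δ) (hδ' : δ < 1 / 2) :
    -- A constant `M₁` as in the posterior contraction bound exists.
    (∃ M₁ : ℝ, 0 < M₁ ∧
      ∀ X₀ : (n : ℕ) → Fin n → EuclideanSpace ℝ (Fin d), RDPG.IsRegular Δ δ X₀ →
        RDPG.PosteriorContracts dens X₀ M₁) ∧
    -- For every such constant, the risk bound and the large deviation bound hold.
    (∀ M₁ : ℝ, 0 < M₁ → ∃ C : ℝ, 0 < C ∧
      ∀ X₀ : (n : ℕ) → Fin n → EuclideanSpace ℝ (Fin d), RDPG.IsRegular Δ δ X₀ →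
        RDPG.PosteriorContracts dens X₀ M₁ →
        ∀ᶠ n : ℕ in atTop,
          ∀ (Uhat : RDPG.Adjacency n → Matrix (Fin n) (Fin d) ℝ)
            (Shat : RDPG.Adjacency n → Fin d → ℝ),
            (∀ Y, RDPG.IsLeadingEigenpairs (RDPG.posteriorMean dens Y) (Uhat Y) (Shat Y)) →
            (∫ Y, 1 / (n : ℝ) * RDPG.procrustesSq
                (Uhat Y * Matrix.diagonal fun k => √(Shat Y k)) (RDPG.latentMatrix (X₀ n))
              ∂(RDPG.rdpg (X₀ n)) ≤ C / n) ∧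
            ∀ U₀ : Matrix (Fin n) (Fin d) ℝ,
              RDPG.IsLeftSingularMatrix (RDPG.latentMatrix (X₀ n)) U₀ →
              (RDPG.rdpg (X₀ n)).real
                  {Y | 128 * M₁ ^ 2 * d /
                      ((RDPG.kthEigenvalue hΔ.isHermitian ⟨d - 1, Nat.sub_lt hd one_pos⟩) ^ 2 * n)
                    < RDPG.procrustesSq (Uhat Y) U₀} ≤
                2 * Real.exp (-(1 / 4) * M₁ * d * √(n : ℝ))) ∧
    -- The rate `1 / n` is the minimax lower bound, over all estimators.
    (∃ c : ℝ, 0 < c ∧ ∀ n : ℕ, 0 < n →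
      ∀ Xhat : RDPG.Adjacency n → Matrix (Fin n) (Fin d) ℝ,
        ∃ X : Fin n → EuclideanSpace ℝ (Fin d), (∀ i, X i ∈ RDPG.latentSpace d) ∧
          c / n ≤ ∫ Y, 1 / (n : ℝ) * RDPG.procrustesSq (Xhat Y) (RDPG.latentMatrix X)
            ∂(RDPG.rdpg X)) :=
  ⟨RDPG.exists_posteriorContracts hd hdens hΔ hδ hδ',
    fun _ hM => RDPG.exists_embedding_risk_le hd hdens hΔ hδ hδ' hM,
    1 / (64 * Real.exp 4), by positivity, fun _ hn Xhat => RDPG.exists_le_risk hd hn Xhat⟩
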